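/- Let $F$ be an algebraically closed field with $\operatorname{char}F\neq 2$, let $p,q\in F^\times$ not be roots of unity, and let $n\ge 0$. Let ${\mathcal H}_n$ be the affine Hecke algebra of type $B_n$, i.e. the associative unital $F$-algebra on generators $X_0^{\pm1},\dots,X_n^{\pm1},T_0,\dots,T_{n-1}$ in which the $X_i$ are invertible and commute with each other, and $(T_0-p)(T_0+p^{-1})=0$; $(T_i-q)(T_i+q^{-1})=0$ for $i\ge1$; $T_iT_{i+1}T_i=T_{i+1}T_iT_{i+1}$ for $i\geq 1$; $T_iT_j=T_jT_i$ for $|i-j|>1$; $T_1T_0T_1T_0=T_0T_1T_0T_1$; $T_0X_0T_0=X_0X_1$; $T_iX_j=X_jT_i$ for $j\ne i,i+1$; $T_iX_iT_i=X_{i+1}$ for $i\ge 1$ (so ${\mathcal H}_0=F[X_0^{\pm1}]$). Let ${\mathcal H}_n^R$ be its subalgebra generated by $T_0,\dots,T_{n-1},X_1^{\pm1},\dots,X_n^{\pm1}$, and ${\mathcal H}_n^A\subseteq{\mathcal H}_n^R$ the subalgebra (affine Hecke algebra of type $A$) generated by $T_1,\dots,T_{n-1},X_1^{\pm1},\dots,X_n^{\pm1}$.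 For $0\ne\mu\in F$ put $I_\mu^+=\{\mu q^{2i}\mid i\in{\mathbb Z}\}$ and $I_\mu=I_\mu^+\cup I_{\mu^{-1}}^+$. Let $\operatorname{Rep}_\mu{\mathcal H}_n^A$ be the category of finite-dimensional left ${\mathcal H}_n^A$-modules on which all eigenvalues of $X_1,\dots,X_n$ lie in $I_\mu^+$, and $\operatorname{Rep}_\mu{\mathcal H}_n$ the category of finite-dimensional left ${\mathcal H}_n^R$-modules on which all eigenvalues of $X_1,\dots,X_n$ lie in $I_\mu$. Let $0\neq\lambda\in F$ and suppose that $p^2,\,q,\,-q,\,1,\,-1\notin I_\lambda$. Then for every irreducible module $N$ in $\operatorname{Rep}_{\lambda^{-1}}{\mathcal H}_n^A$ the induced module $\operatorname{ind}_{{\mathcal H}_n^A}^{{\mathcal H}_n^R}N={\mathcal H}_n^R\otimes_{{\mathcal H}_n^A}N$ belongs to $\operatorname{Rep}_\lambda{\mathcal H}_n$ and is irreducible. Moreover, $N\mapsto\operatorname{ind}_{{\mathcal H}_n^A}^{{\mathcal H}_n^R}N$ induces a bijection from the set of isomorphism classes of irreducible modules in $\operatorname{Rep}_{\lambda^{-1}}{\mathcal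 H}_n^A$ to the set of isomorphism classes of irreducible modules in $\operatorname{Rep}_\lambda{\mathcal H}_n$. -/

import Mathlib

open scoped TensorProduct

universe u v w

noncomputable section

namespace AffineHecke


/-- Generators of the affine Hecke algebra of type `B_n`: the lattice generators
`X_0, …, X_n`, their inverses, and `T_0, …, T_{n-1}`. -/
inductive Gen (n : ℕ) : Type
  | X (i : Fin (n + 1))
  | Xinv (i : Fin (n + 1))
  | T (i : Fin n)

section Algebras

variable {F : Type u} [Field F]

/-- Shorthand for the free generators. -/
def fX (F : Type u) [Field F] {n : ℕ} (i : Fin (n + 1)) : FreeAlgebra F (Gen n) :=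
  FreeAlgebra.ι F (Gen.X i)

def fXinv (F : Type u) [Field F] {n : ℕ} (i : Fin (n + 1)) : FreeAlgebra F (Gen n) :=
  FreeAlgebra.ι F (Gen.Xinv i)

def fT (F : Type u) [Field F] {n : ℕ} (i : Fin n) : FreeAlgebra F (Gen n) :=
  FreeAlgebra.ι F (Gen.T i)

/-- Defining relations. For `i : Fin n`, `i.castSucc` is the lattice index `i` and `i.succ` is
the lattice index `i + 1`. -/
inductive Rel (p q : F) (n : ℕ) : FreeAlgebra F (Gen n) → FreeAlgebra F (Gen n) → Prop
  | mul_inv (i : Fin (n + 1)) : Rel p q n (fX F i * fXinv F i) 1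
  | inv_mul (i : Fin (n + 1)) : Rel p q n (fXinv F i * fX F i) 1
  | lattice_comm (i j : Fin (n + 1)) : Rel p q n (fX F i * fX F j) (fX F j * fX F i)
  | quad_zero (i : Fin n) (hi : i.val = 0) :
      Rel p q n ((fT F i - algebraMap F _ p) * (fT F i + algebraMap F _ p⁻¹)) 0
  | quad (i : Fin n) (hi : 1 ≤ i.val) :
      Rel p q n ((fT F i - algebraMap F _ q) * (fT F i + algebraMap F _ q⁻¹)) 0
  | braid (i j : Fin n) (hi : 1 ≤ i.val) (hj : j.val = i.val + 1) :
      Rel p q n (fT F i * fT F j * fT F i) (fT F j * fT F i * fT F j)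
  | far_comm (i j : Fin n) (hij : i.val + 1 < j.val) :
      Rel p q n (fT F i * fT F j) (fT F j * fT F i)
  | braid_zero (i j : Fin n) (hi : i.val = 0) (hj : j.val = 1) :
      Rel p q n (fT F j * fT F i * fT F j * fT F i) (fT F i * fT F j * fT F i * fT F j)
  | mixed_zero (i : Fin n) (hi : i.val = 0) :
      Rel p q n (fT F i * fX F i.castSucc * fT F i) (fX F i.castSucc * fX F i.succ)
  | mixed_comm (i : Fin n) (j : Fin (n + 1)) (h₁ : j ≠ i.castSucc) (h₂ : j ≠ i.succ) :
      Rel p q n (fT F i * fX F j) (fX F j * fT F i)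
  | mixed (i : Fin n) (hi : 1 ≤ i.val) :
      Rel p q n (fT F i * fX F i.castSucc * fT F i) (fX F i.succ)

/-- The affine Hecke algebra `H_n` of type `B_n` with parameters `p` and `q`, for the weight
lattice with basis `X_0, …, X_n`; for `n = 0` it is `F[X_0^{±1}]`. -/
def H (p q : F) (n : ℕ) : Type u := RingQuot (Rel p q n)

instance (p q : F) (n : ℕ) : Ring (H p q n) := inferInstanceAs (Ring (RingQuot (Rel p q n)))

instance (p q : F) (n : ℕ) : Algebra F (H p q n) :=
  inferInstanceAs (Algebra F (RingQuot (Rel p q n)))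

/-- The quotient map from the free algebra. -/
def mk (p q : F) (n : ℕ) : FreeAlgebra F (Gen n) →ₐ[F] H p q n :=
  RingQuot.mkAlgHom F (Rel p q n)

def X (p q : F) {n : ℕ} (i : Fin (n + 1)) : H p q n := mk p q n (fX F i)

def Xinv (p q : F) {n : ℕ} (i : Fin (n + 1)) : H p q n := mk p q n (fXinv F i)

def T (p q : F) {n : ℕ} (i : Fin n) : H p q n := mk p q n (fT F i)

/-- The subalgebra `H_n^R` generated by `T_0, …, T_{n-1}` and `X_1^{±1}, …, X_n^{±1}`. -/
def HR (p q : F) (n : ℕ) : Subalgebra F (H p q n) :=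
  Algebra.adjoin F
    ({h | ∃ i : Fin n, h = T p q i} ∪
      {h | ∃ i : Fin n, h = X p q i.succ ∨ h = Xinv p q i.succ})

/-- The type `A` subalgebra `H_n^A` generated by `T_1, …, T_{n-1}` and
`X_1^{±1}, …, X_n^{±1}`. -/
def HA (p q : F) (n : ℕ) : Subalgebra F (H p q n) :=
  Algebra.adjoin F
    ({h | ∃ i : Fin n, 1 ≤ i.val ∧ h = T p q i} ∪
      {h | ∃ i : Fin n, h = X p q i.succ ∨ h = Xinv p q i.succ})

theorem HA_le_HR (p q : F) (n : ℕ) : HA p q n ≤ HR p q n := by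
  refine Algebra.adjoin_mono ?_
  rintro h (⟨i, -, hi⟩ | hh)
  · exact Or.inl ⟨i, hi⟩
  · exact Or.inr hh

/-- The inclusion of `H_n^A` into `H_n^R`. -/
def incl (p q : F) (n : ℕ) : HA p q n →ₐ[F] HR p q n :=
  Subalgebra.inclusion (HA_le_HR p q n)

/-- `XA p q i` is `X_{i+1}`, for `0 ≤ i < n`, as an element of `H_n^A`. -/
def XA (p q : F) {n : ℕ} (i : Fin n) : HA p q n :=
  ⟨X p q i.succ, Algebra.subset_adjoin (Or.inr ⟨i, Or.inl rfl⟩)⟩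

/-- `XR p q i` is `X_{i+1}`, for `0 ≤ i < n`, as an element of `H_n^R`. -/
def XR (p q : F) {n : ℕ} (i : Fin n) : HR p q n :=
  ⟨X p q i.succ, Algebra.subset_adjoin (Or.inr ⟨i, Or.inl rfl⟩)⟩

end Algebras

section Induction

variable {F : Type u} [Field F] {A : Type v} [Ring A] [Algebra F A] {B : Type v} [Ring B]
  [Algebra F B]

/-- The `A`-submodule of `A ⊗[F] N` of relations `a b ⊗ x = a ⊗ b x`, for `b` in `B`. -/
def indRel (f : B →ₐ[F] A) (N : Type w) [AddCommGroup N] [Module F N] [Module B N] :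
    Submodule A (A ⊗[F] N) :=
  Submodule.span A {t | ∃ (a : A) (b : B) (x : N), t = (a * f b) ⊗ₜ[F] x - a ⊗ₜ[F] (b • x)}

/-- The induced module `ind_B^A N = A ⊗_B N` along `f : B → A`, as a left `A`-module. -/
abbrev Ind (f : B →ₐ[F] A) (N : Type w) [AddCommGroup N] [Module F N] [Module B N] :
    Type (max v w) :=
  (A ⊗[F] N) ⧸ indRel f N

end Induction

section Categories

variable {F : Type u} [Field F]

/-- `I_λ^+ = {λ q^{2i} | i ∈ ℤ}`. -/
def Iplus (q lam : F) : Set F := {a | ∃ i : ℤ, a = lam * q ^ (2 * i)}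

/-- `I_λ = {λ q^{2i}, λ⁻¹ q^{2i} | i ∈ ℤ}`. -/
def I (q lam : F) : Set F := {a | ∃ i : ℤ, a = lam * q ^ (2 * i) ∨ a = lam⁻¹ * q ^ (2 * i)}

/-- `N` is an object of `Rep_λ H_n^A`: it is finite-dimensional and all eigenvalues of
`X_1, …, X_n` on `N` lie in `I_λ^+`. -/
def InRepA (p q : F) (n : ℕ) (lam : F) (N : Type v) [AddCommGroup N] [Module F N]
    [Module (HA p q n) N] [IsScalarTower F (HA p q n) N] : Prop :=
  FiniteDimensional F N ∧
    ∀ (i : Fin n) (a : F), (Algebra.lsmul F F N (XA p q i)).HasEigenvalue a → a ∈ Iplus q lam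

/-- `M` is an object of `Rep_λ H_n`: it is a finite-dimensional `H_n^R`-module and all
eigenvalues of `X_1, …, X_n` on `M` lie in `I_λ`. -/
def InRepR (p q : F) (n : ℕ) (lam : F) (M : Type v) [AddCommGroup M] [Module F M]
    [Module (HR p q n) M] [IsScalarTower F (HR p q n) M] : Prop :=
  FiniteDimensional F M ∧
    ∀ (i : Fin n) (a : F), (Algebra.lsmul F F M (XR p q i)).HasEigenvalue a → a ∈ I q lam

end Categories

end AffineHecke

end

set_option linter.unusedSectionVars false

/-! Write `I⁺` for `Iplus q lam⁻¹`. Since `1`, `-1`, `q`, `-q` are not in `I q lam`, no product of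
two elements of `I⁺` is an even power of `q` (`Generic.mul_ne_zpow`); hence `I q lam` is the
disjoint union of `I⁺` and the set of inverses of `I⁺`. Every lattice eigenvalue on a module in
`Rep_λ` thus carries a sign: positive if it lies in `I⁺`, negative if its inverse does.

Two facts carry the theorem. (a) For `N` in `Rep_{λ⁻¹} H_n^A` the map `N → Ind N` is injective, and
its image contains every joint eigenvector of the lattice with all signs positive (`indι_injective`,
`mem_range_indι`). (b) Every nonzero module in `Rep_λ` contains such a joint eigenvector
(`exists_minus_eigenvector`): the intertwiner `T_0 - d` inverts the first eigenvalue, `T_j - d`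
exchanges two neighbouring ones, and neither kills the vector because `p ^ 2` is not in `I q lam`
and products from `I⁺` avoid `q ^ 2` and its inverse.

If `N` is simple and `P ≠ 0` is a submodule of `Ind N`, then (b) and (a) make `P` meet `N`, so `P`
contains `N` and is everything. An isomorphism of induced modules carries a positive joint
eigenvector of `N` into the copy of `N'`, and simplicity gives `N ≃ N'`. For a simple `M`, the
`H_n^A`-module generated by a positive joint eigenvector has lattice eigenvalues in `I⁺` only,
because the coefficients of `∏ (b - X_j)` are central in `H_n^A`; a simple submodule `N` of it gives
a nonzero map `Ind N → M` between simple modules.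

Fact (a) needs the exact size of `Ind N`, which is found without a basis of the Hecke algebra.
Above, a filtration along coset representatives shows `dim Ind N ≤ 2 ^ n * dim N`
(`finrank_ind_le`). Below, the algebra acts by explicit operators on the functions from sign
patterns to `N` (`SignSystem.rep`): where two signs differ, `T_j` acts by a two by two matrix with
denominator `Z_j - Z_i`, and `T_0` by one with denominator `Z_0 - 1`, where `Z_k` stands for `Z ε
k`; these are invertible by genericity. The functions supported on the trivial pattern form a copy
of `N` and generate everything (`SignSystem.eq_top_of_stable`), so `Ind N` maps onto this model and,
by dimension, is isomorphic to it (`exists_ind_equiv`). -/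

noncomputable section

namespace AffineHecke

/-! ### Relations in `H_n` and their Bernstein form -/

section Relations

variable {F : Type u} [Field F] (p q : F) (n : ℕ)

/-- The parameter of the `i`-th quadratic relation. -/
def par (i : ℕ) : F := if i = 0 then p else q

/-- The coefficient `p - p⁻¹` or `q - q⁻¹` of the `i`-th quadratic relation. -/
def gap (i : ℕ) : F := par p q i - (par p q i)⁻¹

variable {p q n}

theorem par_ne_zero (hp : p ≠ 0) (hq : q ≠ 0) (i : ℕ) : par p q i ≠ 0 := by
  unfold par; split_ifs <;> assumption

theorem mk_rel {a b : FreeAlgebra F (Gen n)} (h : Rel p q n a b) : mk p q n a = mk p q n b :=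
  RingQuot.mkAlgHom_rel F h

theorem X_mul_Xinv (i : Fin (n + 1)) : X p q i * Xinv p q i = 1 := by
  simpa [X, Xinv] using mk_rel (Rel.mul_inv (p := p) (q := q) i)

theorem Xinv_mul_X (i : Fin (n + 1)) : Xinv p q i * X p q i = 1 := by
  simpa [X, Xinv] using mk_rel (Rel.inv_mul (p := p) (q := q) i)

theorem X_comm (i j : Fin (n + 1)) : X p q i * X p q j = X p q j * X p q i := by
  simpa [X] using mk_rel (Rel.lattice_comm (p := p) (q := q) i j)

theorem sq_of_quad {A : Type*} [Ring A] [Algebra F A] {t : F} (ht : t ≠ 0) {a : A}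
    (h : (a - algebraMap F A t) * (a + algebraMap F A t⁻¹) = 0) :
    a * a = (t - t⁻¹) • a + 1 := by
  have h1 : algebraMap F A t * algebraMap F A t⁻¹ = 1 := by
    rw [← map_mul, mul_inv_cancel₀ ht, map_one]
  have h2 : a * algebraMap F A t⁻¹ = t⁻¹ • a := by
    rw [← Algebra.commutes, Algebra.smul_def]
  rw [sub_mul, mul_add, mul_add, h1, h2, ← Algebra.smul_def] at h
  rw [sub_smul]
  linear_combination (norm := noncomm_ring) h

theorem T_sq (hp : p ≠ 0) (hq : q ≠ 0) (i : Fin n) :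
    T p q i * T p q i = gap p q i • T p q i + 1 := by
  refine sq_of_quad (par_ne_zero hp hq i) ?_
  by_cases hi : i.val = 0
  · simpa [T, par, hi] using mk_rel (Rel.quad_zero (p := p) (q := q) i hi)
  · simpa [T, par, hi] using mk_rel (Rel.quad (p := p) (q := q) i (by omega))

theorem T_braid (i j : Fin n) (hi : 1 ≤ i.val) (hj : j.val = i.val + 1) :
    T p q i * T p q j * T p q i = T p q j * T p q i * T p q j := by
  simpa [T] using mk_rel (Rel.braid (p := p) (q := q) i j hi hj)

theorem T_far (i j : Fin n) (hij : i.val + 1 < j.val) :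
    T p q i * T p q j = T p q j * T p q i := by
  simpa [T] using mk_rel (Rel.far_comm (p := p) (q := q) i j hij)

theorem T_braid_zero (i j : Fin n) (hi : i.val = 0) (hj : j.val = 1) :
    T p q j * T p q i * T p q j * T p q i = T p q i * T p q j * T p q i * T p q j := by
  simpa [T] using mk_rel (Rel.braid_zero (p := p) (q := q) i j hi hj)

theorem T_X_of_ne (i : Fin n) (j : Fin (n + 1)) (h₁ : j ≠ i.castSucc) (h₂ : j ≠ i.succ) :
    T p q i * X p q j = X p q j * T p q i := by
  simpa [T, X] using mk_rel (Rel.mixed_comm (p := p) (q := q) i j h₁ h₂)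

theorem T_X_T (i : Fin n) (hi : 1 ≤ i.val) :
    T p q i * X p q i.castSucc * T p q i = X p q i.succ := by
  simpa [T, X] using mk_rel (Rel.mixed (p := p) (q := q) i hi)

theorem T_X_T_zero (i : Fin n) (hi : i.val = 0) :
    T p q i * X p q i.castSucc * T p q i = X p q i.castSucc * X p q i.succ := by
  simpa [T, X] using mk_rel (Rel.mixed_zero (p := p) (q := q) i hi)

theorem T_Xinv_of_ne (i : Fin n) (j : Fin (n + 1)) (h₁ : j ≠ i.castSucc) (h₂ : j ≠ i.succ) :
    T p q i * Xinv p q j = Xinv p q j * T p q i := by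
  have h := congrArg (fun a => Xinv p q j * a * Xinv p q j) (T_X_of_ne (p := p) (q := q) i j h₁ h₂)
  simp only [mul_assoc, X_mul_Xinv, mul_one] at h
  rw [h, ← mul_assoc, Xinv_mul_X, one_mul]

/-- Commutation of a Hecke generator with a pair of lattice elements which it exchanges. -/
theorem bernstein_left {A : Type*} [Ring A] [Algebra F A] {c : F} {t U V : A}
    (hsq : t * t = c • t + 1) (h : t * U * t = V) : t * U = V * t - c • V := by
  rw [← h]
  have : t * U * t * t = t * U * (c • t + 1) := by rw [mul_assoc, hsq]
  rw [this, mul_add, mul_one, mul_smul_comm, add_sub_cancel_left]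

theorem bernstein_right {A : Type*} [Ring A] [Algebra F A] {c : F} {t U V : A}
    (hsq : t * t = c • t + 1) (h : t * U * t = V) : t * V = U * t + c • V := by
  rw [← h, ← mul_assoc, ← mul_assoc, hsq, add_mul, add_mul, one_mul, smul_mul_assoc,
    smul_mul_assoc, add_comm]

/-- The case of `T_0`, with `U = X_0` and `V = X_1`. Computing `t * (U * V)` by both of the previous
lemmas and cancelling `U` leaves a relation free of `X_0`, which is what makes it available inside
`H_n^R`. -/
theorem bernstein_zero {A : Type*} [Ring A] [Algebra F A] {c : F} {t U Ui V Vi : A}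
    (hsq : t * t = c • t + 1) (h : t * U * t = U * V) (hU : Ui * U = 1) (hV : Vi * V = 1) :
    t * V = Vi * t + c • (V + 1) := by
  have h1 := bernstein_left hsq h
  have h2 := bernstein_right hsq h
  have h3 : t * (U * V) = U * (V * t * V - c • (V * V)) := by
    rw [← mul_assoc, h1, sub_mul, mul_sub, smul_mul_assoc, mul_smul_comm]
    simp only [mul_assoc]
  have h4 : V * t * V - c • (V * V) = t + c • V := by
    have := h3.symm.trans h2
    have h5 := congrArg (Ui * ·) this
    simpa [mul_add, ← mul_assoc, hU] using h5
  have h6 := congrArg (Vi * ·) h4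
  simp only [mul_sub, mul_add, mul_smul_comm, ← mul_assoc, hV, one_mul] at h6
  rw [smul_add]
  linear_combination (norm := noncomm_ring) h6

end Relations

/-! ### The relations inside `H_n^R` and `H_n^A` -/

section Subalgebras

variable {F : Type u} [Field F] (p q : F) {n : ℕ}

/-- `T_i` as an element of `H_n^R`. -/
def TR (i : Fin n) : HR p q n :=
  ⟨T p q i, Algebra.subset_adjoin (Or.inl ⟨i, rfl⟩)⟩

/-- `X_{i+1}⁻¹` as an element of `H_n^R`. -/
def XRinv (i : Fin n) : HR p q n :=
  ⟨Xinv p q i.succ, Algebra.subset_adjoin (Or.inr ⟨i, Or.inr rfl⟩)⟩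

/-- `T_i`, for `i ≥ 1`, as an element of `H_n^A`. -/
def TA (i : Fin n) (hi : 1 ≤ i.val) : HA p q n :=
  ⟨T p q i, Algebra.subset_adjoin (Or.inl ⟨i, hi, rfl⟩)⟩

/-- `X_{i+1}⁻¹` as an element of `H_n^A`. -/
def XAinv (i : Fin n) : HA p q n :=
  ⟨Xinv p q i.succ, Algebra.subset_adjoin (Or.inr ⟨i, Or.inr rfl⟩)⟩

variable {p q}

@[simp] theorem incl_XA (i : Fin n) : incl p q n (XA p q i) = XR p q i := rfl
@[simp] theorem incl_XAinv (i : Fin n) : incl p q n (XAinv p q i) = XRinv p q i := rfl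
@[simp] theorem incl_TA (i : Fin n) (hi : 1 ≤ i.val) : incl p q n (TA p q i hi) = TR p q i := rfl

theorem incl_injective : Function.Injective (incl p q n) :=
  Subalgebra.inclusion_injective _

theorem XR_mul_XRinv (i : Fin n) : XR p q i * XRinv p q i = 1 := Subtype.ext (X_mul_Xinv _)
theorem XRinv_mul_XR (i : Fin n) : XRinv p q i * XR p q i = 1 := Subtype.ext (Xinv_mul_X _)
theorem XA_mul_XAinv (i : Fin n) : XA p q i * XAinv p q i = 1 := Subtype.ext (X_mul_Xinv _)
theorem XAinv_mul_XA (i : Fin n) : XAinv p q i * XA p q i = 1 := Subtype.ext (Xinv_mul_X _)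

theorem XR_comm (i j : Fin n) : XR p q i * XR p q j = XR p q j * XR p q i :=
  Subtype.ext (X_comm _ _)

theorem XA_comm (i j : Fin n) : XA p q i * XA p q j = XA p q j * XA p q i :=
  Subtype.ext (X_comm _ _)

theorem TR_sq (hp : p ≠ 0) (hq : q ≠ 0) (i : Fin n) :
    TR p q i * TR p q i = gap p q i • TR p q i + 1 := Subtype.ext (T_sq hp hq i)

theorem TR_braid (i j : Fin n) (hi : 1 ≤ i.val) (hj : j.val = i.val + 1) :
    TR p q i * TR p q j * TR p q i = TR p q j * TR p q i * TR p q j :=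
  Subtype.ext (T_braid i j hi hj)

theorem TR_far (i j : Fin n) (hij : i.val + 1 < j.val) :
    TR p q i * TR p q j = TR p q j * TR p q i := Subtype.ext (T_far i j hij)

theorem TR_braid_zero (i j : Fin n) (hi : i.val = 0) (hj : j.val = 1) :
    TR p q j * TR p q i * TR p q j * TR p q i = TR p q i * TR p q j * TR p q i * TR p q j :=
  Subtype.ext (T_braid_zero i j hi hj)

/-- `T_0 X_1 = X_1⁻¹ T_0 + (p - p⁻¹)(X_1 + 1)`. -/
theorem TR_zero_XR (hp : p ≠ 0) (hq : q ≠ 0) (i : Fin n) (hi : i.val = 0) :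
    TR p q i * XR p q i = XRinv p q i * TR p q i + gap p q 0 • (XR p q i + 1) := by
  have := T_sq hp hq i
  rw [hi] at this
  exact Subtype.ext (bernstein_zero this (T_X_T_zero i hi) (Xinv_mul_X _) (Xinv_mul_X _))

theorem TR_XR_left (hp : p ≠ 0) (hq : q ≠ 0) (i j : Fin n) (hij : i.val = j.val + 1) :
    TR p q i * XR p q j = XR p q i * TR p q i - gap p q 1 • XR p q i := by
  have h := T_sq hp hq i
  have hg : gap p q i = gap p q 1 := by simp [gap, par, hij]
  rw [hg] at h
  have hc : i.castSucc = j.succ := Fin.ext (by simp [hij])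
  have := T_X_T (p := p) (q := q) i (by omega)
  rw [hc] at this
  exact Subtype.ext (bernstein_left h this)

theorem TR_XR_right (hp : p ≠ 0) (hq : q ≠ 0) (i j : Fin n) (hij : i.val = j.val + 1) :
    TR p q i * XR p q i = XR p q j * TR p q i + gap p q 1 • XR p q i := by
  have h := T_sq hp hq i
  have hg : gap p q i = gap p q 1 := by simp [gap, par, hij]
  rw [hg] at h
  have hc : i.castSucc = j.succ := Fin.ext (by simp [hij])
  have := T_X_T (p := p) (q := q) i (by omega)
  rw [hc] at this
  exact Subtype.ext (bernstein_right h this)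

theorem TR_XR_of_ne (i j : Fin n) (h₁ : j ≠ i) (h₂ : i.val ≠ j.val + 1) :
    TR p q i * XR p q j = XR p q j * TR p q i :=
  Subtype.ext (T_X_of_ne i j.succ (by simp [Fin.ext_iff]; omega) (by simpa using h₁))

theorem TR_XRinv_of_ne (i j : Fin n) (h₁ : j ≠ i) (h₂ : i.val ≠ j.val + 1) :
    TR p q i * XRinv p q j = XRinv p q j * TR p q i :=
  Subtype.ext (T_Xinv_of_ne i j.succ (by simp [Fin.ext_iff]; omega) (by simpa using h₁))

theorem TR_zero_XRinv (hp : p ≠ 0) (hq : q ≠ 0) (i : Fin n) (hi : i.val = 0) :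
    TR p q i * XRinv p q i = XR p q i * TR p q i - gap p q 0 • (XR p q i + 1) := by
  have h := congrArg (fun a => XR p q i * a * XRinv p q i) (TR_zero_XR hp hq i hi)
  have h₁ := XR_mul_XRinv (p := p) (q := q) i
  simp only [mul_add, add_mul, mul_smul_comm, smul_mul_assoc, mul_assoc, h₁, mul_one] at h
  rw [← mul_assoc (XR p q i) (XRinv p q i), h₁, one_mul] at h
  rw [h, smul_add, add_sub_assoc, sub_self, add_zero]

theorem TR_XRinv_left (hp : p ≠ 0) (hq : q ≠ 0) (i j : Fin n) (hij : i.val = j.val + 1) :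
    TR p q i * XRinv p q j = XRinv p q i * TR p q i + gap p q 1 • XRinv p q j := by
  have h := congrArg (fun a => XRinv p q i * a * XRinv p q j) (TR_XR_left hp hq i j hij)
  have h₁ := XR_mul_XRinv (p := p) (q := q) j
  have h₂ := XRinv_mul_XR (p := p) (q := q) i
  simp only [mul_sub, sub_mul, mul_smul_comm, smul_mul_assoc, mul_assoc, h₁, mul_one] at h
  simp only [← mul_assoc, h₂, one_mul] at h
  rw [h, sub_add_cancel]

theorem TR_XRinv_right (hp : p ≠ 0) (hq : q ≠ 0) (i j : Fin n) (hij : i.val = j.val + 1) :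
    TR p q i * XRinv p q i = XRinv p q j * TR p q i - gap p q 1 • XRinv p q j := by
  have h := congrArg (fun a => XRinv p q j * a * XRinv p q i) (TR_XR_right hp hq i j hij)
  have h₁ := XR_mul_XRinv (p := p) (q := q) i
  have h₂ := XRinv_mul_XR (p := p) (q := q) j
  simp only [mul_add, add_mul, mul_smul_comm, smul_mul_assoc, mul_assoc, h₁, mul_one] at h
  simp only [← mul_assoc, h₂, one_mul] at h
  rw [h, add_sub_cancel_right]

end Subalgebras

/-! ### Induction along words in the generators -/

section Generation

variable {F : Type u} [Field F] {p q : F} {n : ℕ}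

/-- Induction on `H_n^R` through left multiplication by generators. -/
theorem HR_induction {P : HR p q n → Prop} (hone : P 1)
    (hadd : ∀ a b, P a → P b → P (a + b)) (hsmul : ∀ (r : F) a, P a → P (r • a))
    (hT : ∀ i a, P a → P (TR p q i * a)) (hX : ∀ i a, P a → P (XR p q i * a))
    (hXinv : ∀ i a, P a → P (XRinv p q i * a)) (a : HR p q n) : P a := by
  -- Left multiplication by an element of the subalgebra preserves `P`; in this form the product
  -- case of the adjoin induction is just composition.
  suffices h : ∀ (x : H p q n) (hx : x ∈ HR p q n), ∀ b : HR p q n, P b → P (⟨x, hx⟩ * b) by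
    simpa using h a.1 a.2 1 hone
  intro x hx
  induction hx using Algebra.adjoin_induction with
  | mem x hx =>
    intro b hb
    rcases hx with ⟨i, rfl⟩ | ⟨i, rfl | rfl⟩
    · exact hT i b hb
    · exact hX i b hb
    · exact hXinv i b hb
  | algebraMap r =>
    intro b hb
    have : (⟨algebraMap F (H p q n) r, (HR p q n).algebraMap_mem r⟩ : HR p q n) * b = r • b := by
      rw [Algebra.smul_def]; rfl
    rw [this]; exact hsmul r b hb
  | add x y hx hy ihx ihy =>
    intro b hb
    have : (⟨x + y, (HR p q n).add_mem hx hy⟩ : HR p q n) * b = ⟨x, hx⟩ * b + ⟨y, hy⟩ * b := by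
      rw [← add_mul]; rfl
    rw [this]; exact hadd _ _ (ihx b hb) (ihy b hb)
  | mul x y hx hy ihx ihy =>
    intro b hb
    have : (⟨x * y, (HR p q n).mul_mem hx hy⟩ : HR p q n) * b = ⟨x, hx⟩ * (⟨y, hy⟩ * b) := by
      rw [← mul_assoc]; rfl
    rw [this]; exact ihx _ (ihy b hb)

/-- Induction on `H_n^A` through left multiplication by generators. -/
theorem HA_induction {P : HA p q n → Prop} (hone : P 1)
    (hadd : ∀ a b, P a → P b → P (a + b)) (hsmul : ∀ (r : F) a, P a → P (r • a))
    (hT : ∀ i hi a, P a → P (TA p q i hi * a)) (hX : ∀ i a, P a → P (XA p q i * a))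
    (hXinv : ∀ i a, P a → P (XAinv p q i * a)) (a : HA p q n) : P a := by
  suffices h : ∀ (x : H p q n) (hx : x ∈ HA p q n), ∀ b : HA p q n, P b → P (⟨x, hx⟩ * b) by
    simpa using h a.1 a.2 1 hone
  intro x hx
  induction hx using Algebra.adjoin_induction with
  | mem x hx =>
    intro b hb
    rcases hx with ⟨i, hi, rfl⟩ | ⟨i, rfl | rfl⟩
    · exact hT i hi b hb
    · exact hX i b hb
    · exact hXinv i b hb
  | algebraMap r =>
    intro b hb
    have : (⟨algebraMap F (H p q n) r, (HA p q n).algebraMap_mem r⟩ : HA p q n) * b = r • b := by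
      rw [Algebra.smul_def]; rfl
    rw [this]; exact hsmul r b hb
  | add x y hx hy ihx ihy =>
    intro b hb
    have : (⟨x + y, (HA p q n).add_mem hx hy⟩ : HA p q n) * b = ⟨x, hx⟩ * b + ⟨y, hy⟩ * b := by
      rw [← add_mul]; rfl
    rw [this]; exact hadd _ _ (ihx b hb) (ihy b hb)
  | mul x y hx hy ihx ihy =>
    intro b hb
    have : (⟨x * y, (HA p q n).mul_mem hx hy⟩ : HA p q n) * b = ⟨x, hx⟩ * (⟨y, hy⟩ * b) := by
      rw [← mul_assoc]; rfl
    rw [this]; exact ihx _ (ihy b hb)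

end Generation

/-! ### Upper bound: a filtration along coset representatives of type `A` in type `B` -/

section CosetFiltration

variable {F A M : Type*} [Field F] [Ring A] [Algebra F A] [AddCommGroup M] [Module F M]
  [Module A M] [IsScalarTower F A M]

/-- The braid relations of type `B_n`, and quadratic relations, for `T 0, …, T (n - 1)`. -/
structure TypeBRelations (F : Type*) {A : Type*} [Field F] [Ring A] [Algebra F A] (n : ℕ)
    (T : ℕ → A) : Prop where
  sq : ∀ i < n, ∃ c : F, T i * T i = c • T i + 1
  braid : ∀ i, 1 ≤ i → i + 1 < n → T i * T (i + 1) * T i = T (i + 1) * T i * T (i + 1)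
  far : ∀ i j, i + 1 < j → j < n → T i * T j = T j * T i
  braid_zero : 1 < n → T 1 * T 0 * T 1 * T 0 = T 0 * T 1 * T 0 * T 1

/-- The coset representative `T_{k-1} ⋯ T_1 T_0`. -/
def cosetRep (T : ℕ → A) : ℕ → A
  | 0 => 1
  | k + 1 => T k * cosetRep T k

/-- The increasing filtration `L_0 = L ⊆ L_1 ⊆ ⋯ ⊆ L_n` with
`L_{m+1} = L_m + T_{n-m-1} ⋯ T_0 L_m`. -/
def cosetFiltration (T : ℕ → A) (n : ℕ) (L : Submodule F M) : ℕ → Submodule F M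
  | 0 => L
  | m + 1 => cosetFiltration T n L m ⊔
      (cosetFiltration T n L m).map (Algebra.lsmul F F M (cosetRep T (n - m)))

namespace TypeBRelations

variable {n : ℕ} {T : ℕ → A} (h : TypeBRelations F n T)
include h

theorem cosetRep_comm {k i : ℕ} (hki : k < i) (hi : i < n) :
    T i * cosetRep T k = cosetRep T k * T i := by
  induction k with
  | zero => simp [cosetRep]
  | succ k ih =>
    rw [cosetRep, ← mul_assoc, ← h.far k i (by omega) hi, mul_assoc, ih (by omega), mul_assoc]

/-- `T_i` commutes with the leading factors until it meets `T_{i+1} T_i`; the braid relation turns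
it into `T_{i+1}`, which commutes with the rest. -/
theorem mul_cosetRep_of_lt {k i : ℕ} (hi : 1 ≤ i) (hik : i + 1 < k) (hk : k ≤ n) :
    T i * cosetRep T k = cosetRep T k * T (i + 1) := by
  induction k with
  | zero => omega
  | succ k ih =>
    rcases Nat.lt_or_ge (i + 1) k with hlt | hge
    · rw [cosetRep, ← mul_assoc, h.far i k hlt (by omega), mul_assoc, ih hlt (by omega), mul_assoc]
    · obtain rfl : k = i + 1 := by omega
      rw [cosetRep, cosetRep, ← mul_assoc, ← mul_assoc, h.braid i hi (by omega), mul_assoc,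
        h.cosetRep_comm (by omega) (by omega)]
      simp only [mul_assoc]

/-- For `k = 1` this is the braid relation of length four; the ordinary braid relations raise `k`.
It rewrites a product of two representatives of equal length as an admissible one, with decreasing
indices to the right, times a type `A` generator. -/
theorem cosetRep_succ_mul_self {k : ℕ} (hk : 1 ≤ k) (hkn : k < n) :
    cosetRep T (k + 1) * cosetRep T (k + 1) = cosetRep T k * cosetRep T (k + 1) * T 1 := by
  induction k with
  | zero => omega
  | succ k ih =>
    rcases Nat.eq_zero_or_pos k with rfl | hk'
    · simpa [cosetRep, mul_assoc] using h.braid_zero hkn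
    · have h1 := h.cosetRep_comm (k := k) (i := k + 1) (by omega) hkn
      have h2 := h.braid k hk' hkn
      have h3 := ih hk' (by omega)
      calc cosetRep T (k + 1 + 1) * cosetRep T (k + 1 + 1)
          = T (k + 1) * T k * (cosetRep T k * T (k + 1)) * T k * cosetRep T k := by
            simp only [cosetRep, mul_assoc]
        _ = T (k + 1) * T k * T (k + 1) * (cosetRep T k * (T k * cosetRep T k)) := by
            rw [← h1]; simp only [mul_assoc]
        _ = T k * T (k + 1) * (cosetRep T (k + 1) * cosetRep T (k + 1)) := by
            rw [← h2]; simp only [cosetRep, mul_assoc]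
        _ = T k * (T (k + 1) * cosetRep T k) * cosetRep T (k + 1) * T 1 := by
            rw [h3]; simp only [mul_assoc]
        _ = _ := by
            rw [h1]; simp only [cosetRep, mul_assoc]

/-- Stability of the filtration under the generators which fix its stage. -/
theorem smul_mem_cosetFiltration {L : Submodule F M}
    (hL : ∀ i, 1 ≤ i → i < n → ∀ v ∈ L, T i • v ∈ L) (m : ℕ) (hm : m ≤ n) :
    ∀ i, 1 ≤ i → i < n → i + m ≠ n → ∀ v ∈ cosetFiltration T n L m,
      T i • v ∈ cosetFiltration T n L m := by
  induction m using Nat.strong_induction_on with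
  | _ m ih =>
  rcases m with _ | m
  · intro i hi hin _ v hv; exact hL i hi hin v hv
  intro i hi hin him v hv
  obtain ⟨k, hk⟩ : ∃ k, n = k + m := ⟨n - m, by omega⟩
  have hkm : n - m = k := by omega
  have hS := ih m (by omega) (by omega)
  obtain ⟨v₁, hv₁, w, hw, rfl⟩ := Submodule.mem_sup.1 hv
  obtain ⟨v₂, hv₂, rfl⟩ := hw
  have hin₁ : ∀ x ∈ cosetFiltration T n L m, x ∈ cosetFiltration T n L (m + 1) :=
    fun x hx => Submodule.mem_sup_left hx
  have hin₂ : ∀ x ∈ cosetFiltration T n L m,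
      cosetRep T k • x ∈ cosetFiltration T n L (m + 1) :=
    fun x hx => Submodule.mem_sup_right ⟨x, hx, by rw [hkm]; rfl⟩
  simp only [Algebra.lsmul_coe, hkm] at *
  rw [smul_add]
  -- The stage `m + 1` adds `T_{k-1} ⋯ T_0` times the stage `m`. The excluded index there is `k -
  -- 1`, so `i < k` means `i + 1 < k`.
  rcases lt_trichotomy i k with hik | rfl | hik
  · refine add_mem (hin₁ _ (hS i hi hin (by omega) _ hv₁)) ?_
    rw [smul_smul, h.mul_cosetRep_of_lt hi (by omega) (by omega), mul_smul]
    exact hin₂ _ (hS (i + 1) (by omega) (by omega) (by omega) _ hv₂)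
  -- Here `i = k` is the one generator that need not preserve the previous stage, so both summands
  -- are expanded one stage further down. The quadratic relation (`key`) and
  -- `cosetRep_succ_mul_self` handle the new terms.
  · obtain ⟨m, rfl⟩ : ∃ m', m = m' + 1 := ⟨m - 1, by omega⟩
    have hS' := ih m (by omega) (by omega)
    have him' : n - m = i + 1 := by omega
    have hin₃ : ∀ x ∈ cosetFiltration T n L m, x ∈ cosetFiltration T n L (m + 1) :=
      fun x hx => Submodule.mem_sup_left hx
    have hin₄ : ∀ x ∈ cosetFiltration T n L m,
        cosetRep T (i + 1) • x ∈ cosetFiltration T n L (m + 1) :=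
      fun x hx => Submodule.mem_sup_right ⟨x, hx, by rw [him']; rfl⟩
    have key : ∀ x ∈ cosetFiltration T n L m,
        T i • cosetRep T (i + 1) • x ∈ cosetFiltration T n L (m + 1 + 1) := by
      intro x hx
      obtain ⟨c, hc⟩ := h.sq i hin
      rw [smul_smul, cosetRep, ← mul_assoc, hc, add_mul, one_mul, add_smul, smul_mul_assoc,
        smul_assoc]
      exact add_mem (Submodule.smul_mem _ _ (hin₁ _ (hin₄ _ hx))) (hin₂ _ (hin₃ _ hx))
    refine add_mem ?_ ?_
    · obtain ⟨x, hx, w, ⟨y, hy, rfl⟩, rfl⟩ := Submodule.mem_sup.1 hv₁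
      simp only [Algebra.lsmul_coe, him']
      rw [smul_add]
      exact add_mem (hin₁ _ (hin₃ _ (hS' i hi hin (by omega) _ hx))) (key y hy)
    · obtain ⟨x, hx, w, ⟨y, hy, rfl⟩, rfl⟩ := Submodule.mem_sup.1 hv₂
      simp only [Algebra.lsmul_coe, him']
      rw [smul_smul]
      change cosetRep T (i + 1) • _ ∈ _
      rw [smul_add]
      refine add_mem (hin₁ _ (hin₄ _ hx)) ?_
      rw [smul_smul, h.cosetRep_succ_mul_self hi hin, mul_smul, mul_smul]
      exact hin₂ _ (hin₄ _ (hS' 1 le_rfl (by omega) (by omega) _ hy))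
  · refine add_mem (hin₁ _ (hS i hi hin (by omega) _ hv₁)) ?_
    rw [smul_smul, h.cosetRep_comm hik hin, mul_smul]
    exact hin₂ _ (hS i hi hin (by omega) _ hv₂)

theorem smul_mem_cosetFiltration_top {L : Submodule F M}
    (hL : ∀ i, 1 ≤ i → i < n → ∀ v ∈ L, T i • v ∈ L) (i : ℕ) (hi : i < n) (v : M)
    (hv : v ∈ cosetFiltration T n L n) : T i • v ∈ cosetFiltration T n L n := by
  rcases Nat.eq_zero_or_pos i with rfl | hi'
  · obtain ⟨m, rfl⟩ : ∃ m, n = m + 1 := ⟨n - 1, by omega⟩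
    obtain ⟨x, hx, w, ⟨y, hy, rfl⟩, rfl⟩ := Submodule.mem_sup.1 hv
    have hm : m + 1 - m = 0 + 1 := by omega
    have hin : ∀ x ∈ cosetFiltration T (m + 1) L m,
        T 0 • x ∈ cosetFiltration T (m + 1) L (m + 1) :=
      fun x hx => Submodule.mem_sup_right ⟨x, hx, by rw [hm]; simp [cosetRep]⟩
    obtain ⟨c, hc⟩ := h.sq 0 hi
    simp only [Algebra.lsmul_coe, hm, cosetRep, mul_one]
    rw [smul_add, smul_smul, hc, add_smul, one_smul, smul_assoc]
    exact add_mem (hin _ hx) (add_mem (Submodule.smul_mem _ _ (hin _ hy))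
      (Submodule.mem_sup_left hy))
  · exact h.smul_mem_cosetFiltration hL n le_rfl i hi' hi (by omega) v hv

end TypeBRelations

/-- Minimality of the filtration; it serves to transfer to the top stage whatever is preserved by
the `T_i` and holds on `L`. -/
theorem cosetFiltration_le_of_stable {n : ℕ} {T : ℕ → A} {L P : Submodule F M} (hLP : L ≤ P)
    (hP : ∀ i < n, ∀ v ∈ P, T i • v ∈ P) (m : ℕ) :
    cosetFiltration T n L m ≤ P := by
  have hrep : ∀ k ≤ n, ∀ v ∈ P, cosetRep T k • v ∈ P := by
    intro k
    induction k with
    | zero => intro _ v hv; simpa [cosetRep] using hv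
    | succ k ih =>
      intro hk v hv
      rw [cosetRep, mul_smul]
      exact hP k (by omega) _ (ih (by omega) v hv)
  induction m with
  | zero => exact hLP
  | succ m ih =>
    refine sup_le ih ?_
    rintro _ ⟨v, hv, rfl⟩
    exact hrep _ (Nat.sub_le _ _) v (ih hv)

theorem le_cosetFiltration (T : ℕ → A) (n : ℕ) (L : Submodule F M) (m : ℕ) :
    L ≤ cosetFiltration T n L m := by
  induction m with
  | zero => exact le_rfl
  | succ m ih => exact ih.trans le_sup_left

theorem finite_cosetFiltration (T : ℕ → A) (n : ℕ) (L : Submodule F M) [FiniteDimensional F L]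
    (m : ℕ) : FiniteDimensional F (cosetFiltration T n L m) := by
  induction m with
  | zero => assumption
  | succ m ih => rw [cosetFiltration]; infer_instance

theorem finrank_cosetFiltration_le (T : ℕ → A) (n : ℕ) (L : Submodule F M)
    [FiniteDimensional F L] (m : ℕ) :
    Module.finrank F (cosetFiltration T n L m) ≤ 2 ^ m * Module.finrank F L := by
  induction m with
  | zero => rw [cosetFiltration, pow_zero, one_mul]
  | succ m ih =>
    have := finite_cosetFiltration T n L m
    calc _ ≤ Module.finrank F (cosetFiltration T n L m) +
          Module.finrank F ((cosetFiltration T n L m).map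
            (Algebra.lsmul F F M (cosetRep T (n - m)))) :=
          Submodule.finrank_add_le_finrank_add_finrank _ _
      _ ≤ Module.finrank F (cosetFiltration T n L m) +
          Module.finrank F (cosetFiltration T n L m) := by
          gcongr; exact Submodule.finrank_map_le _ _
      _ ≤ _ := by rw [pow_succ]; linarith

end CosetFiltration

/-! ### The span of `H_n^R` on an `H_n^A`-stable subspace has at most `2 ^ n` times its dimension -/

section InductionBound

variable {F : Type u} [Field F] {p q : F} {n : ℕ}

/-- `T_i` as an element of `H_n^R`, with an unbounded index. -/
def TN (p q : F) (n : ℕ) (i : ℕ) : HR p q n := if h : i < n then TR p q ⟨i, h⟩ else 0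

theorem TN_eq (i : Fin n) : TN p q n i = TR p q i := by simp [TN]

theorem TN_relations (hp : p ≠ 0) (hq : q ≠ 0) : TypeBRelations F n (TN p q n) where
  sq i hi := ⟨gap p q i, by simpa [TN, hi] using TR_sq hp hq ⟨i, hi⟩⟩
  braid i hi hin := by
    simpa [TN, hin, (by omega : i < n)] using
      TR_braid (p := p) (q := q) ⟨i, by omega⟩ ⟨i + 1, hin⟩ hi rfl
  far i j hij hj := by
    simpa [TN, hj, (by omega : i < n)] using
      TR_far (p := p) (q := q) ⟨i, by omega⟩ ⟨j, hj⟩ hij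
  braid_zero hn := by
    simpa [TN, hn, (by omega : 0 < n)] using
      TR_braid_zero (p := p) (q := q) ⟨0, by omega⟩ ⟨1, hn⟩ rfl rfl

variable {M : Type*} [AddCommGroup M] [Module F M] [Module (HR p q n) M]
  [IsScalarTower F (HR p q n) M]

/-- The vectors of `P` which all lattice elements map into `P` form a subspace. -/
def latticeCore (P : Submodule F M) : Submodule F M where
  carrier := {v | v ∈ P ∧ ∀ j : Fin n, XR p q j • v ∈ P ∧ XRinv p q j • v ∈ P}
  zero_mem' := ⟨P.zero_mem, fun j => by simp⟩
  add_mem' := fun {a b} ha hb => ⟨add_mem ha.1 hb.1, fun j => by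
    rw [smul_add, smul_add]
    exact ⟨add_mem (ha.2 j).1 (hb.2 j).1, add_mem (ha.2 j).2 (hb.2 j).2⟩⟩
  smul_mem' := fun r a ha => ⟨P.smul_mem r ha.1, fun j => by
    rw [smul_algebra_smul_comm, smul_algebra_smul_comm]
    exact ⟨P.smul_mem r (ha.2 j).1, P.smul_mem r (ha.2 j).2⟩⟩

/-- By the Bernstein relations a lattice generator applied to `T_i • v` is `T_i` applied to a
lattice generator times `v`, up to lattice terms and multiples of `v`; all of these lie in `P`. -/
theorem TR_smul_mem_latticeCore (hp : p ≠ 0) (hq : q ≠ 0) {P : Submodule F M}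
    (hP : ∀ i : Fin n, ∀ v ∈ P, TR p q i • v ∈ P) (i : Fin n) (v : M)
    (hv : v ∈ latticeCore (p := p) (q := q) (n := n) P) :
    TR p q i • v ∈ latticeCore (p := p) (q := q) (n := n) P := by
  refine ⟨hP i v hv.1, fun j => ?_⟩
  have hX : ∀ j : Fin n, XR p q j • v ∈ P := fun j => (hv.2 j).1
  have hY : ∀ j : Fin n, XRinv p q j • v ∈ P := fun j => (hv.2 j).2
  by_cases hji : j = i
  · subst hji
    rcases Nat.eq_zero_or_pos j.val with h0 | h0
    · have h₁ := TR_zero_XR hp hq j h0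
      have h₂ := TR_zero_XRinv hp hq j h0
      constructor
      · rw [smul_smul, sub_eq_iff_eq_add.1 h₂.symm, add_smul, mul_smul, smul_assoc, add_smul,
          one_smul]
        exact add_mem (hP _ _ (hY j)) (P.smul_mem _ (add_mem (hX j) hv.1))
      · rw [smul_smul, ← sub_eq_iff_eq_add.2 h₁, sub_smul, mul_smul, smul_assoc, add_smul, one_smul]
        exact sub_mem (hP _ _ (hX j)) (P.smul_mem _ (add_mem (hX j) hv.1))
    · have hij : j.val = (⟨j.val - 1, by omega⟩ : Fin n).val + 1 := by simp; omega
      have h₁ := TR_XR_left hp hq j _ hij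
      have h₂ := TR_XRinv_left hp hq j _ hij
      constructor
      · rw [smul_smul, sub_eq_iff_eq_add.1 h₁.symm, add_smul, mul_smul, smul_assoc]
        exact add_mem (hP _ _ (hX _)) (P.smul_mem _ (hX _))
      · rw [smul_smul, ← sub_eq_iff_eq_add.2 h₂, sub_smul, mul_smul, smul_assoc]
        exact sub_mem (hP _ _ (hY _)) (P.smul_mem _ (hY _))
  · by_cases hij : i.val = j.val + 1
    · have h₁ := TR_XR_right hp hq i j hij
      have h₂ := TR_XRinv_right hp hq i j hij
      constructor
      · rw [smul_smul, ← sub_eq_iff_eq_add.2 h₁, sub_smul, mul_smul, smul_assoc]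
        exact sub_mem (hP _ _ (hX _)) (P.smul_mem _ (hX _))
      · rw [smul_smul, sub_eq_iff_eq_add.1 h₂.symm, add_smul, mul_smul, smul_assoc]
        exact add_mem (hP _ _ (hY _)) (P.smul_mem _ (hY _))
    · rw [smul_smul, ← TR_XR_of_ne i j hji hij, smul_smul, ← TR_XRinv_of_ne i j hji hij, mul_smul,
        mul_smul]
      exact ⟨hP _ _ (hX _), hP _ _ (hY _)⟩

theorem exists_smul_stable_span (hp : p ≠ 0) (hq : q ≠ 0) (L : Submodule F M)
    [FiniteDimensional F L]
    (hT : ∀ i : Fin n, 1 ≤ i.val → ∀ v ∈ L, TR p q i • v ∈ L)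
    (hX : ∀ i : Fin n, ∀ v ∈ L, XR p q i • v ∈ L)
    (hXinv : ∀ i : Fin n, ∀ v ∈ L, XRinv p q i • v ∈ L) :
    ∃ P : Submodule F M, L ≤ P ∧ (∀ a : HR p q n, ∀ v ∈ P, a • v ∈ P) ∧ FiniteDimensional F P ∧
      Module.finrank F P ≤ 2 ^ n * Module.finrank F L := by
  have hrel := TN_relations (n := n) hp hq
  have hTN : ∀ i, 1 ≤ i → i < n → ∀ v ∈ L, TN p q n i • v ∈ L := by
    intro i hi hin v hv
    rw [show i = (⟨i, hin⟩ : Fin n).val from rfl, TN_eq]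
    exact hT _ hi v hv
  set P := cosetFiltration (TN p q n) n L n with hPdef
  have hPT : ∀ i : Fin n, ∀ v ∈ P, TR p q i • v ∈ P := by
    intro i v hv
    rw [← TN_eq]
    exact hrel.smul_mem_cosetFiltration_top hTN i i.2 v hv
  -- `P` is built with the `T_i` alone. Its lattice core contains `L` and is stable under the `T_i`,
  -- so by minimality it contains `P`: the lattice preserves `P` as well.
  have hcore : P ≤ latticeCore (p := p) (q := q) (n := n) P := by
    refine cosetFiltration_le_of_stable ?_ ?_ n
    · intro v hv
      exact ⟨le_cosetFiltration _ _ _ _ hv, fun j =>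
        ⟨le_cosetFiltration _ _ _ _ (hX j v hv), le_cosetFiltration _ _ _ _ (hXinv j v hv)⟩⟩
    · intro i hi v hv
      rw [show i = (⟨i, hi⟩ : Fin n).val from rfl, TN_eq]
      exact TR_smul_mem_latticeCore hp hq hPT _ v hv
  refine ⟨P, le_cosetFiltration _ _ _ _, ?_, finite_cosetFiltration _ _ _ _,
    finrank_cosetFiltration_le _ _ _ _⟩
  intro a
  induction a using HR_induction with
  | hone => intro v hv; simpa using hv
  | hadd a b ha hb => intro v hv; rw [add_smul]; exact add_mem (ha v hv) (hb v hv)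
  | hsmul r a ha => intro v hv; rw [smul_assoc]; exact P.smul_mem r (ha v hv)
  | hT i a ha => intro v hv; rw [mul_smul]; exact hPT i _ (ha v hv)
  | hX i a ha => intro v hv; rw [mul_smul]; exact ((hcore (ha v hv)).2 i).1
  | hXinv i a ha => intro v hv; rw [mul_smul]; exact ((hcore (ha v hv)).2 i).2

end InductionBound

/-! ### Braid relations on blocks of sign patterns, as polynomial identities -/

section BlockIdentities

variable {K N : Type*} [CommRing K] [AddCommGroup N] [Module K N]

/-- The rows of the braid relation on a block in which one of three neighbouring positions has a
sign different from the other two. -/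
theorem braid_block_row_one (t : N →+ N) (q r c x y : K) (hc : c = q - r) (hqr : q * r = 1)
    (htq : ∀ v, t (q • v) = q • t v)
    (hsq : ∀ v, t (t v) = c • t v + v)
    (hx : ∀ v, t (x • v) = y • t v + (x * (c - y)) • v)
    (hy : ∀ v, t (y • v) = x • t v - (x * (c - y)) • v) (v₁ v₂ v₃ : N) :
    t (y • t v₁ + (q - y) • (x • v₂ + (q - x) • v₃)) =
      y • t (y • v₁ + (q - y) • v₂) +
        (q - y) • (x • ((c - y) • v₂ + (q - (c - y)) • v₁) + (q - x) • t v₃) := by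
  subst hc
  simp only [map_add, map_sub, smul_add, smul_sub, sub_smul, htq, hsq, hx, hy, mul_smul]
  match_scalars <;> grind

/-- The rules for `t` past `q`, `r`, `x`, `y` move `t` to the vectors, after which coefficients are
compared in the commutative ring `K`. The same method proves all the rows. -/
theorem braid_block_row_two (t : N →+ N) (q r c x y : K) (hc : c = q - r)
    (htq : ∀ v, t (q • v) = q • t v) (htr : ∀ v, t (r • v) = r • t v)
    (hx : ∀ v, t (x • v) = y • t v + (x * (c - y)) • v)
    (hy : ∀ v, t (y • v) = x • t v - (x * (c - y)) • v) (v₁ v₂ v₃ : N) :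
    x • ((c - y) • (x • v₂ + (q - x) • v₃) + (q - (c - y)) • t v₁) +
      (q - x) • t ((c - x) • v₃ + (q - (c - x)) • v₂) =
      (c - y) • (x • ((c - y) • v₂ + (q - (c - y)) • v₁) + (q - x) • t v₃) +
        (q - (c - y)) • t (y • v₁ + (q - y) • v₂) := by
  subst hc
  simp only [map_add, map_sub, smul_add, smul_sub, sub_smul, htq, htr, hx, hy, mul_smul]
  match_scalars <;> grind

theorem braid_block_row_three (t : N →+ N) (q r c x y : K) (hc : c = q - r) (hqr : q * r = 1)
    (htq : ∀ v, t (q • v) = q • t v) (htr : ∀ v, t (r • v) = r • t v)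
    (hsq : ∀ v, t (t v) = c • t v + v)
    (hx : ∀ v, t (x • v) = y • t v + (x * (c - y)) • v)
    (hy : ∀ v, t (y • v) = x • t v - (x * (c - y)) • v) (v₁ v₂ v₃ : N) :
    (c - x) • t ((c - x) • v₃ + (q - (c - x)) • v₂) +
      (q - (c - x)) • ((c - y) • (x • v₂ + (q - x) • v₃) + (q - (c - y)) • t v₁) =
      t ((c - x) • t v₃ + (q - (c - x)) • ((c - y) • v₂ + (q - (c - y)) • v₁)) := by
  subst hc
  simp only [map_add, map_sub, smul_add, smul_sub, sub_smul, htq, htr, hsq, hx, hy, mul_smul]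
  match_scalars <;> grind

/-- The rows of the braid relation of length four on a block of four sign patterns. -/
theorem braid_zero_block_row_one (t : N →+ N) (p s a q r c x e₁ e₂ y₁ y₂ : K)
    (ha : a = p - s) (hps : p * s = 1) (hc : c = q - r) (hqr : q * r = 1)
    (htp : ∀ v, t (p • v) = p • t v) (hts : ∀ v, t (s • v) = s • t v)
    (htq : ∀ v, t (q • v) = q • t v) (htr : ∀ v, t (r • v) = r • t v)
    (htx : ∀ v, t (x • v) = x • t v) (hsq : ∀ v, t (t v) = c • t v + v)
    (h₁ : ∀ v, t (e₁ • v) = e₂ • t v + (c * e₁ * (1 + e₂)) • v)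
    (h₂ : ∀ v, t (e₂ • v) = e₁ • t v - (c * e₁ * (1 + e₂)) • v)
    (hx : x * (1 + e₁ + e₂) = c * (1 + e₁) * (1 + e₂))
    (hy₁ : y₁ = a * (1 + e₁)) (hy₂ : y₂ = a * (1 + e₂)) (v₁ v₂ v₃ v₄ : N) :
    (t (y₁ • (t (y₁ • v₁ + (p - y₁) • v₂)) + (p - y₁) • (x • ((a - y₁) • v₂ + (p - (a - y₁))
      • v₁) + (q - x) • (y₂ • v₃ + (p - y₂) • v₄)))) =
      (y₁ • (t (y₁ • (t v₁) + (p - y₁) • (x • v₂ + (q - x) • v₃))) + (p - y₁) • (x • ((a - y₁)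
      • (x • v₂ + (q - x) • v₃) + (p - (a - y₁)) • (t v₁)) + (q - x) • (y₂ • ((c - x) • v₃ +
      (q - (c - x)) • v₂) + (p - y₂) • (t v₄)))) := by
  subst ha hc hy₁ hy₂
  simp only [map_add, map_sub, smul_add, smul_sub, sub_smul, add_smul, mul_add, mul_one,
    htp, hts, htq, htr, htx, hsq, h₁, h₂, mul_smul]
  match_scalars <;> grind

/-- Two rows suffice: the other two patterns of a block are the first two of the block started at
the fourth pattern. In the application `e₁`, `e₂` are the inverses of `Y₁ - 1`, `Y₂ - 1`, which
turns the rational coefficients into polynomials; `hx` is `x * (Y₁ * Y₂ - 1) = c * Y₁ * Y₂` in these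
terms. -/
theorem braid_zero_block_row_two (t : N →+ N) (p s a q r c x e₁ e₂ y₁ y₂ : K)
    (ha : a = p - s) (hps : p * s = 1) (hc : c = q - r) (hqr : q * r = 1)
    (htp : ∀ v, t (p • v) = p • t v) (hts : ∀ v, t (s • v) = s • t v)
    (htq : ∀ v, t (q • v) = q • t v)
    (htx : ∀ v, t (x • v) = x • t v) (hsq : ∀ v, t (t v) = c • t v + v)
    (h₁ : ∀ v, t (e₁ • v) = e₂ • t v + (c * e₁ * (1 + e₂)) • v)
    (h₂ : ∀ v, t (e₂ • v) = e₁ • t v - (c * e₁ * (1 + e₂)) • v)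
    (hx : x * (1 + e₁ + e₂) = c * (1 + e₁) * (1 + e₂))
    (hy₁ : y₁ = a * (1 + e₁)) (hy₂ : y₂ = a * (1 + e₂)) (v₁ v₂ v₃ v₄ : N) :
    (x • ((a - y₁) • (x • ((a - y₁) • v₂ + (p - (a - y₁)) • v₁) + (q - x) • (y₂ • v₃ + (p -
      y₂) • v₄)) + (p - (a - y₁)) • (t (y₁ • v₁ + (p - y₁) • v₂))) + (q - x) • (y₂ • ((c - x)
      • (y₂ • v₃ + (p - y₂) • v₄) + (q - (c - x)) • ((a - y₁) • v₂ + (p - (a - y₁)) • v₁)) +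
      (p - y₂) • (t ((a - y₂) • v₄ + (p - (a - y₂)) • v₃)))) =
      ((a - y₁) • (x • ((a - y₁) • (x • v₂ + (q - x) • v₃) + (p - (a - y₁)) • (t v₁)) + (q -
      x) • (y₂ • ((c - x) • v₃ + (q - (c - x)) • v₂) + (p - y₂) • (t v₄))) + (p - (a - y₁)) •
      (t (y₁ • (t v₁) + (p - y₁) • (x • v₂ + (q - x) • v₃)))) := by
  subst ha hc hy₁ hy₂
  simp only [map_add, map_sub, smul_add, smul_sub, sub_smul, add_smul, mul_add, mul_one,
    htp, hts, htq, htx, hsq, h₁, h₂, mul_smul]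
  match_scalars <;> grind

end BlockIdentities

/-! ### The explicit model: operators on functions from sign patterns to `N` -/

section SignSystems

/-- Change the sign at one position. -/
def flip {n : ℕ} (i : Fin n) (ε : Fin n → Bool) : Fin n → Bool := Function.update ε i (!ε i)

/-- Exchange the signs at two positions. -/
def exch {n : ℕ} (i j : Fin n) (ε : Fin n → Bool) : Fin n → Bool := ε ∘ Equiv.swap i j

@[simp] theorem flip_flip {n : ℕ} (i : Fin n) (ε : Fin n → Bool) : flip i (flip i ε) = ε := by
  simp [flip]

@[simp] theorem flip_self {n : ℕ} (i : Fin n) (ε : Fin n → Bool) : flip i ε i = !ε i := by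
  simp [flip]

theorem flip_of_ne {n : ℕ} {i k : Fin n} (h : k ≠ i) (ε : Fin n → Bool) : flip i ε k = ε k := by
  simp [flip, h]

@[simp] theorem exch_exch {n : ℕ} (i j : Fin n) (ε : Fin n → Bool) :
    exch i j (exch i j ε) = ε := by
  funext k; simp [exch]

@[simp] theorem exch_left {n : ℕ} (i j : Fin n) (ε : Fin n → Bool) : exch i j ε i = ε j := by
  simp [exch]

@[simp] theorem exch_right {n : ℕ} (i j : Fin n) (ε : Fin n → Bool) : exch i j ε j = ε i := by
  simp [exch]

theorem exch_of_ne {n : ℕ} {i j k : Fin n} (hi : k ≠ i) (hj : k ≠ j) (ε : Fin n → Bool) :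
    exch i j ε k = ε k := by
  simp [exch, Equiv.swap_apply_of_ne_of_ne hi hj]

theorem exch_flip_comm {n : ℕ} {i k l : Fin n} (hk : k ≠ i) (hl : l ≠ i) (ε : Fin n → Bool) :
    exch k l (flip i ε) = flip i (exch k l ε) := by
  funext m
  by_cases hm : m = i
  · subst hm; simp [exch, Equiv.swap_apply_of_ne_of_ne hk.symm hl.symm]
  · have : Equiv.swap k l m ≠ i := by
      rw [Equiv.swap_apply_def]; split_ifs <;> assumption
    simp [exch, flip, hm, this]

theorem exch_exch_comm {n : ℕ} {i j k l : Fin n} (hki : k ≠ i) (hkj : k ≠ j) (hli : l ≠ i)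
    (hlj : l ≠ j) (ε : Fin n → Bool) :
    exch k l (exch i j ε) = exch i j (exch k l ε) := by
  funext m
  simp only [exch, Function.comp_apply, Equiv.swap_apply_def]
  congr 1
  split_ifs <;> simp_all

/-- Data on a vector space `N` from which a module over the affine Hecke algebra of type `B_n` on
the functions from sign patterns to `N` is built. For each pattern `ε`, the element `Z ε k`
describes the action of `X_{k+1}` on the component of `ε`, and, if the signs at positions `j - 1`
and `j` agree, `t ε j` describes the action of `T_j`. -/
structure SignSystem (F : Type*) [Field F] (K N : Type*) [CommRing K] [Algebra F K]
    [AddCommGroup N] [Module F N] [Module K N] (q : F) (n : ℕ) where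
  Z : (Fin n → Bool) → Fin n → Kˣ
  t : (Fin n → Bool) → Fin n → N →ₗ[F] N
  Z_exch : ∀ ε (i j : Fin n), j.val = i.val + 1 → ε i ≠ ε j → ∀ k,
    Z (exch i j ε) k = Z ε (Equiv.swap i j k)
  Z_flip_self : ∀ ε (i : Fin n), i.val = 0 → Z (flip i ε) i = (Z ε i)⁻¹
  Z_flip : ∀ ε (i : Fin n), i.val = 0 → ∀ k, k ≠ i → Z (flip i ε) k = Z ε k
  t_sq : ∀ ε (i j : Fin n), j.val = i.val + 1 → ε i = ε j → ∀ v,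
    t ε j (t ε j v) = (q - q⁻¹) • t ε j v + v
  t_Z_left : ∀ ε (i j : Fin n), j.val = i.val + 1 → ε i = ε j → ∀ v,
    t ε j ((Z ε i : K) • v) = (Z ε j : K) • t ε j v - (q - q⁻¹) • (Z ε j : K) • v
  t_Z_right : ∀ ε (i j : Fin n), j.val = i.val + 1 → ε i = ε j → ∀ v,
    t ε j ((Z ε j : K) • v) = (Z ε i : K) • t ε j v + (q - q⁻¹) • (Z ε j : K) • v
  t_Z_of_ne : ∀ ε (i j : Fin n), j.val = i.val + 1 → ε i = ε j → ∀ k, k ≠ i → k ≠ j → ∀ v,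
    t ε j ((Z ε k : K) • v) = (Z ε k : K) • t ε j v
  t_braid : ∀ ε (i j k : Fin n), j.val = i.val + 1 → k.val = j.val + 1 → ε i = ε j → ε j = ε k →
    ∀ v, t ε j (t ε k (t ε j v)) = t ε k (t ε j (t ε k v))
  t_far : ∀ ε (i j k l : Fin n), j.val = i.val + 1 → l.val = k.val + 1 → j < k → ε i = ε j →
    ε k = ε l → ∀ v, t ε j (t ε l v) = t ε l (t ε j v)
  t_exch : ∀ ε (i j k l : Fin n), j.val = i.val + 1 → l.val = k.val + 1 → j < k ∨ l < i →
    ε i ≠ ε j → t (exch i j ε) l = t ε l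
  t_flip : ∀ ε (i l : Fin n), i.val = 0 → 2 ≤ l.val → t (flip i ε) l = t ε l
  t_exch_exch : ∀ ε (i j k : Fin n), j.val = i.val + 1 → k.val = j.val + 1 → ε i = ε j →
    ε j ≠ ε k → t (exch i j (exch j k ε)) k = t ε j
  t_flip_exch_flip : ∀ ε (i j : Fin n), i.val = 0 → j.val = 1 → ε i = ε j →
    t (flip i (exch i j (flip i ε))) j = t ε j
  isUnit_sub : ∀ ε (i j : Fin n), j.val = i.val + 1 → ε i ≠ ε j →
    IsUnit ((Z ε j : K) - (Z ε i : K))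
  isUnit_sub_one : ∀ ε (i : Fin n), i.val = 0 → IsUnit ((Z ε i : K) - 1)

namespace SignSystem

variable {F : Type*} [Field F] {K N : Type*} [CommRing K] [Algebra F K]
    [AddCommGroup N] [Module F N] [Module K N] [IsScalarTower F K N] {p q : F} {n : ℕ}
    (S : SignSystem F K N q n)

/-- The diagonal coefficient of `T_j` where the signs at positions `i = j - 1` and `j` differ. -/
def diag (ε : Fin n → Bool) (i j : Fin n) : K :=
  algebraMap F K (q - q⁻¹) * S.Z ε j * Ring.inverse ((S.Z ε j : K) - S.Z ε i)

/-- The diagonal coefficient of `T_0`. -/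
def diagZero (p : F) (ε : Fin n → Bool) (i : Fin n) : K :=
  algebraMap F K (p - p⁻¹) * S.Z ε i * Ring.inverse ((S.Z ε i : K) - 1)

/-- The action of `X_{k+1}`. -/
def opX (k : Fin n) : ((Fin n → Bool) → N) →ₗ[F] ((Fin n → Bool) → N) where
  toFun f ε := (S.Z ε k : K) • f ε
  map_add' f g := by ext ε; simp
  map_smul' r f := by ext ε; simp [smul_algebra_smul_comm]

/-- The action of `X_{k+1}⁻¹`. -/
def opXinv (k : Fin n) : ((Fin n → Bool) → N) →ₗ[F] ((Fin n → Bool) → N) where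
  toFun f ε := (((S.Z ε k)⁻¹ : Kˣ) : K) • f ε
  map_add' f g := by ext ε; simp
  map_smul' r f := by ext ε; simp only [Pi.smul_apply, smul_algebra_smul_comm, RingHom.id_apply]

/-- The element through which `X_0` acts on the component of `ε`. -/
def minuscule (ε : Fin n → Bool) : Kˣ := ∏ k with ε k = true, (S.Z ε k)⁻¹

/-- The action of `X_0`. -/
def opMin : ((Fin n → Bool) → N) →ₗ[F] ((Fin n → Bool) → N) where
  toFun f ε := (S.minuscule ε : K) • f ε
  map_add' f g := by ext ε; simp
  map_smul' r f := by ext ε; simp [smul_algebra_smul_comm]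

/-- The action of `X_0⁻¹`. -/
def opMinInv : ((Fin n → Bool) → N) →ₗ[F] ((Fin n → Bool) → N) where
  toFun f ε := (((S.minuscule ε)⁻¹ : Kˣ) : K) • f ε
  map_add' f g := by ext ε; simp
  map_smul' r f := by ext ε; simp only [Pi.smul_apply, smul_algebra_smul_comm, RingHom.id_apply]

/-- The action of `T_j`, for `j = i + 1`. -/
def opSwap (i j : Fin n) : ((Fin n → Bool) → N) →ₗ[F] ((Fin n → Bool) → N) where
  toFun f ε := if ε i = ε j then S.t ε j (f ε) else
    S.diag ε i j • f ε + (algebraMap F K q - S.diag ε i j) • f (exch i j ε)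
  map_add' f g := by
    ext ε
    by_cases h : ε i = ε j
    · simp [h]
    · simp only [h, if_false, Pi.add_apply, smul_add]; abel
  map_smul' r f := by
    ext ε
    by_cases h : ε i = ε j
    · simp [h]
    · simp only [h, if_false, Pi.smul_apply, smul_add, smul_algebra_smul_comm, RingHom.id_apply]

/-- The action of `T_0`, for `i = 0`. -/
def opFlip (p : F) (i : Fin n) : ((Fin n → Bool) → N) →ₗ[F] ((Fin n → Bool) → N) where
  toFun f ε :=
    S.diagZero p ε i • f ε + (algebraMap F K p - S.diagZero p ε i) • f (flip i ε)
  map_add' f g := by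
    ext ε
    simp only [Pi.add_apply, smul_add]; abel
  map_smul' r f := by
    ext ε
    simp only [Pi.smul_apply, smul_add, smul_algebra_smul_comm, RingHom.id_apply]

theorem opX_apply (k : Fin n) (f : (Fin n → Bool) → N) (ε : Fin n → Bool) :
    S.opX k f ε = (S.Z ε k : K) • f ε := rfl

theorem opXinv_apply (k : Fin n) (f : (Fin n → Bool) → N) (ε : Fin n → Bool) :
    S.opXinv k f ε = (((S.Z ε k)⁻¹ : Kˣ) : K) • f ε := rfl

theorem opMin_apply (f : (Fin n → Bool) → N) (ε : Fin n → Bool) :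
    S.opMin f ε = (S.minuscule ε : K) • f ε := rfl

theorem opMinInv_apply (f : (Fin n → Bool) → N) (ε : Fin n → Bool) :
    S.opMinInv f ε = (((S.minuscule ε)⁻¹ : Kˣ) : K) • f ε := rfl

theorem opSwap_of_eq {i j : Fin n} {ε : Fin n → Bool} (h : ε i = ε j)
    (f : (Fin n → Bool) → N) : S.opSwap i j f ε = S.t ε j (f ε) := if_pos h

theorem opSwap_of_ne {i j : Fin n} {ε : Fin n → Bool} (h : ε i ≠ ε j)
    (f : (Fin n → Bool) → N) : S.opSwap i j f ε =
      S.diag ε i j • f ε + (algebraMap F K q - S.diag ε i j) • f (exch i j ε) := if_neg h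

theorem opFlip_apply (i : Fin n) (f : (Fin n → Bool) → N) (ε : Fin n → Bool) :
    S.opFlip p i f ε =
      S.diagZero p ε i • f ε + (algebraMap F K p - S.diagZero p ε i) • f (flip i ε) := rfl

theorem diag_mul {ε : Fin n → Bool} {i j : Fin n} (hij : j.val = i.val + 1) (h : ε i ≠ ε j) :
    S.diag ε i j * ((S.Z ε j : K) - S.Z ε i) = algebraMap F K (q - q⁻¹) * S.Z ε j := by
  rw [diag, mul_assoc, Ring.inverse_mul_cancel _ (S.isUnit_sub ε i j hij h), mul_one]

theorem diagZero_mul (ε : Fin n → Bool) {i : Fin n} (hi : i.val = 0) :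
    S.diagZero p ε i * ((S.Z ε i : K) - 1) = algebraMap F K (p - p⁻¹) * S.Z ε i := by
  rw [diagZero, mul_assoc, Ring.inverse_mul_cancel _ (S.isUnit_sub_one ε i hi), mul_one]

theorem Z_exch_left {ε : Fin n → Bool} {i j : Fin n} (hij : j.val = i.val + 1) (h : ε i ≠ ε j) :
    S.Z (exch i j ε) i = S.Z ε j := by
  rw [S.Z_exch ε i j hij h, Equiv.swap_apply_left]

theorem Z_exch_right {ε : Fin n → Bool} {i j : Fin n} (hij : j.val = i.val + 1) (h : ε i ≠ ε j) :
    S.Z (exch i j ε) j = S.Z ε i := by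
  rw [S.Z_exch ε i j hij h, Equiv.swap_apply_right]

theorem Z_exch_of_ne {ε : Fin n → Bool} {i j k : Fin n} (hij : j.val = i.val + 1) (h : ε i ≠ ε j)
    (hki : k ≠ i) (hkj : k ≠ j) : S.Z (exch i j ε) k = S.Z ε k := by
  rw [S.Z_exch ε i j hij h, Equiv.swap_apply_of_ne_of_ne hki hkj]

theorem exch_ne {ε : Fin n → Bool} {i j : Fin n} (h : ε i ≠ ε j) :
    exch i j ε i ≠ exch i j ε j := by
  simpa using h.symm

/-- The two diagonal coefficients add up to `q - q⁻¹`. This is the trace of the two by two block,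
whose determinant is then `-1`; hence the quadratic relation. -/
theorem diag_exch {ε : Fin n → Bool} {i j : Fin n} (hij : j.val = i.val + 1) (h : ε i ≠ ε j) :
    S.diag (exch i j ε) i j = algebraMap F K (q - q⁻¹) - S.diag ε i j := by
  have h₁ := S.diag_mul hij h
  have h₂ := S.diag_mul hij (exch_ne h)
  rw [S.Z_exch_left hij h, S.Z_exch_right hij h] at h₂
  refine (S.isUnit_sub ε i j hij h).mul_right_cancel ?_
  linear_combination -h₂ + h₁

theorem diagZero_flip (ε : Fin n → Bool) {i : Fin n} (hi : i.val = 0) :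
    S.diagZero p (flip i ε) i = algebraMap F K (p - p⁻¹) - S.diagZero p ε i := by
  have h₁ := S.diagZero_mul (p := p) ε hi
  have h₂ := S.diagZero_mul (p := p) (flip i ε) hi
  rw [S.Z_flip_self ε i hi] at h₂
  have h₃ : (((S.Z ε i)⁻¹ : Kˣ) : K) * S.Z ε i = 1 := by simp
  refine (S.isUnit_sub_one ε i hi).mul_right_cancel ?_
  linear_combination -(S.Z ε i : K) * h₂ + h₁ +
    (S.diagZero p (flip i ε) i - algebraMap F K (p - p⁻¹)) * h₃

/-- The maps `t` are only `F`-linear, so commutation with the denominators has to be derived from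
commutation with the lattice elements in them. -/
theorem commute_inverse {t : N →ₗ[F] N} {z : K} (hz : IsUnit z)
    (h : ∀ v, t (z • v) = z • t v) (v : N) : t (Ring.inverse z • v) = Ring.inverse z • t v := by
  have := h (Ring.inverse z • v)
  rw [smul_smul, Ring.mul_inverse_cancel _ hz, one_smul] at this
  rw [this, smul_smul, Ring.inverse_mul_cancel _ hz, one_smul]

theorem commute_algebraMap (t : N →ₗ[F] N) (r : F) (v : N) :
    t (algebraMap F K r • v) = algebraMap F K r • t v := by
  rw [algebraMap_smul, algebraMap_smul, map_smul]

theorem opSwap_sq (hq : q ≠ 0) {i j : Fin n} (hij : j.val = i.val + 1) :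
    S.opSwap i j * S.opSwap i j = (q - q⁻¹) • S.opSwap i j + 1 := by
  refine LinearMap.ext fun f => funext fun ε => ?_
  simp only [Module.End.mul_apply, LinearMap.add_apply, LinearMap.smul_apply, Pi.add_apply,
    Pi.smul_apply, Module.End.one_apply]
  by_cases h : ε i = ε j
  · rw [S.opSwap_of_eq h, S.opSwap_of_eq h, S.t_sq ε i j hij h]
  · rw [S.opSwap_of_ne h, S.opSwap_of_ne (exch_ne h), S.opSwap_of_ne h, exch_exch,
      S.diag_exch hij h, ← algebraMap_smul K (q - q⁻¹), map_sub]
    have : algebraMap F K q * algebraMap F K q⁻¹ = 1 := by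
      rw [← map_mul, mul_inv_cancel₀ hq, map_one]
    match_scalars
    · linear_combination this
    · ring

theorem opFlip_sq (hp : p ≠ 0) {i : Fin n} (hi : i.val = 0) :
    S.opFlip p i * S.opFlip p i = (p - p⁻¹) • S.opFlip p i + 1 := by
  refine LinearMap.ext fun f => funext fun ε => ?_
  simp only [Module.End.mul_apply, LinearMap.add_apply, LinearMap.smul_apply, Pi.add_apply,
    Pi.smul_apply, Module.End.one_apply]
  rw [S.opFlip_apply, S.opFlip_apply, S.opFlip_apply, flip_flip, S.diagZero_flip ε hi,
    ← algebraMap_smul K (p - p⁻¹), map_sub]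
  have : algebraMap F K p * algebraMap F K p⁻¹ = 1 := by
    rw [← map_mul, mul_inv_cancel₀ hp, map_one]
  match_scalars
  · linear_combination this
  · ring

theorem opSwap_opX_opSwap (hq : q ≠ 0) {i j : Fin n} (hij : j.val = i.val + 1) :
    S.opSwap i j * S.opX i * S.opSwap i j = S.opX j := by
  refine LinearMap.ext fun f => funext fun ε => ?_
  simp only [Module.End.mul_apply]
  rw [S.opX_apply]
  by_cases h : ε i = ε j
  · rw [S.opSwap_of_eq h, S.opX_apply, S.opSwap_of_eq h, S.t_Z_left ε i j hij h,
      S.t_sq ε i j hij h, smul_add, smul_algebra_smul_comm]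
    abel
  · rw [S.opSwap_of_ne h, S.opX_apply, S.opX_apply, S.opSwap_of_ne (exch_ne h),
      S.opSwap_of_ne h, exch_exch, S.diag_exch hij h, S.Z_exch_left hij h, map_sub]
    have h₁ : algebraMap F K q * algebraMap F K q⁻¹ = 1 := by
      rw [← map_mul, mul_inv_cancel₀ hq, map_one]
    have h₂ := S.diag_mul hij h
    rw [map_sub] at h₂
    match_scalars
    · linear_combination (-S.diag ε i j) * h₂ + (S.Z ε j : K) * h₁
    · linear_combination (S.diag ε i j - algebraMap F K q) * h₂

/-- `X_0` has to act because `H_n^R` is defined inside `H_n`, so its representation is obtained by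
restriction. The reflection of `T_0` sends `X_0` to `X_0 X_1`; with `X_0` acting as the identity on
the trivial pattern, this rule dictates the product in `minuscule`. -/
theorem minuscule_flip (ε : Fin n → Bool) {i : Fin n} (hi : i.val = 0) :
    S.minuscule (flip i ε) = S.minuscule ε * S.Z ε i := by
  have key : ∀ ε : Fin n → Bool, ε i = false →
      S.minuscule (flip i ε) = S.minuscule ε * S.Z ε i := by
    intro ε h
    have hs : (Finset.univ.filter fun k => flip i ε k = true) =
        insert i (Finset.univ.filter fun k => ε k = true) := by
      ext k
      by_cases hk : k = i
      · subst hk; simp [h]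
      · simp [hk, flip_of_ne hk]
    rw [minuscule, minuscule, hs, Finset.prod_insert (by simp [h]), S.Z_flip_self ε i hi, inv_inv,
      mul_comm]
    congr 1
    refine Finset.prod_congr rfl fun k hk => ?_
    rw [S.Z_flip ε i hi k]
    rintro rfl
    simp [h] at hk
  cases h : ε i
  · exact key ε h
  -- A negative first sign is the previous case read from the flipped pattern.
  · have := key (flip i ε) (by simp [h])
    rw [flip_flip, S.Z_flip_self ε i hi] at this
    rw [this, inv_mul_cancel_right]

theorem minuscule_exch {ε : Fin n → Bool} {i j : Fin n} (hij : j.val = i.val + 1)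
    (h : ε i ≠ ε j) : S.minuscule (exch i j ε) = S.minuscule ε := by
  refine Finset.prod_equiv (Equiv.swap i j) ?_ ?_
  · intro k; rw [Finset.mem_filter_univ, Finset.mem_filter_univ]; rfl
  · intro k _; rw [S.Z_exch ε i j hij h]

theorem t_commute_inv_Z {ε : Fin n → Bool} {i j k : Fin n} (hij : j.val = i.val + 1)
    (h : ε i = ε j) (hki : k ≠ i) (hkj : k ≠ j) (v : N) :
    S.t ε j ((((S.Z ε k)⁻¹ : Kˣ) : K) • v) = (((S.Z ε k)⁻¹ : Kˣ) : K) • S.t ε j v := by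
  rw [← Ring.inverse_unit]
  exact commute_inverse (S.Z ε k).isUnit (S.t_Z_of_ne ε i j hij h k hki hkj) v

theorem t_commute_inv_mul {ε : Fin n → Bool} {i j : Fin n} (hij : j.val = i.val + 1)
    (h : ε i = ε j) (v : N) :
    S.t ε j ((((S.Z ε i * S.Z ε j)⁻¹ : Kˣ) : K) • v) =
      (((S.Z ε i * S.Z ε j)⁻¹ : Kˣ) : K) • S.t ε j v := by
  rw [← Ring.inverse_unit]
  refine commute_inverse (S.Z ε i * S.Z ε j).isUnit (fun v => ?_) v
  rw [Units.val_mul, mul_smul, mul_smul, S.t_Z_left ε i j hij h, S.t_Z_right ε i j hij h,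
    smul_add, smul_algebra_smul_comm (q - q⁻¹) (S.Z ε j : K), add_sub_cancel_right,
    smul_comm]

/-- With equal signs at `i` and `j`, the product contains neither of the two factors or both; in the
latter case they enter through `Z_i Z_j`, which commutes with `t` although neither factor need do
so. -/
theorem t_minuscule {ε : Fin n → Bool} {i j : Fin n} (hij : j.val = i.val + 1)
    (h : ε i = ε j) (v : N) :
    S.t ε j ((S.minuscule ε : K) • v) = (S.minuscule ε : K) • S.t ε j v := by
  have key : ∀ s : Finset (Fin n), i ∉ s → j ∉ s → ∀ v,
      S.t ε j (((∏ k ∈ s, (S.Z ε k)⁻¹ : Kˣ) : K) • v) =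
        ((∏ k ∈ s, (S.Z ε k)⁻¹ : Kˣ) : K) • S.t ε j v := by
    intro s
    induction s using Finset.induction_on with
    | empty => intro _ _ v; simp
    | insert k s hk ih =>
      intro hi hj v
      rw [Finset.mem_insert, not_or] at hi hj
      rw [Finset.prod_insert hk, Units.val_mul, mul_smul, mul_smul,
        S.t_commute_inv_Z hij h (Ne.symm hi.1) (Ne.symm hj.1), ih hi.2 hj.2]
  have hne : i ≠ j := by rintro rfl; omega
  rw [minuscule]
  cases hi : ε i
  · exact key _ (by simp [hi]) (by simp [← h, hi]) v
  · have hs : (Finset.univ.filter fun k => ε k = true) =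
        insert i (insert j ((Finset.univ.filter fun k => ε k = true) \ {i, j})) := by
      ext k
      by_cases hki : k = i
      · subst hki; simp [hi]
      · by_cases hkj : k = j
        · subst hkj; simp [← h, hi]
        · simp [hki, hkj]
    rw [hs, Finset.prod_insert (by simp [hne]), Finset.prod_insert (by simp), ← mul_assoc,
      ← mul_inv, Units.val_mul, mul_smul, mul_smul, S.t_commute_inv_mul hij h,
      key _ (by simp) (by simp)]

theorem opFlip_opMin_opFlip (hp : p ≠ 0) {i : Fin n} (hi : i.val = 0) :
    S.opFlip p i * S.opMin * S.opFlip p i = S.opMin * S.opX i := by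
  refine LinearMap.ext fun f => funext fun ε => ?_
  simp only [Module.End.mul_apply]
  rw [S.opFlip_apply, S.opMin_apply, S.opMin_apply, S.opMin_apply, S.opX_apply, S.opFlip_apply,
    S.opFlip_apply, flip_flip, S.diagZero_flip ε hi, S.minuscule_flip ε hi, map_sub,
    Units.val_mul]
  have h₁ : algebraMap F K p * algebraMap F K p⁻¹ = 1 := by
    rw [← map_mul, mul_inv_cancel₀ hp, map_one]
  have h₂ := S.diagZero_mul (p := p) ε hi
  rw [map_sub] at h₂
  match_scalars
  · linear_combination (S.minuscule ε * S.Z ε i : K) * h₁ - (S.minuscule ε : K) * S.diagZero p ε i * h₂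
  · linear_combination (S.diagZero p ε i - algebraMap F K p) * (S.minuscule ε : K) * h₂

theorem opSwap_opMin {i j : Fin n} (hij : j.val = i.val + 1) :
    S.opSwap i j * S.opMin = S.opMin * S.opSwap i j := by
  refine LinearMap.ext fun f => funext fun ε => ?_
  simp only [Module.End.mul_apply]
  by_cases h : ε i = ε j
  · rw [S.opSwap_of_eq h, S.opMin_apply, S.opMin_apply, S.opSwap_of_eq h, S.t_minuscule hij h]
  · rw [S.opSwap_of_ne h, S.opMin_apply, S.opMin_apply, S.opMin_apply, S.opSwap_of_ne h,
      S.minuscule_exch hij h]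
    module

theorem opSwap_opX_of_ne {i j k : Fin n} (hij : j.val = i.val + 1) (hki : k ≠ i) (hkj : k ≠ j) :
    S.opSwap i j * S.opX k = S.opX k * S.opSwap i j := by
  refine LinearMap.ext fun f => funext fun ε => ?_
  simp only [Module.End.mul_apply]
  by_cases h : ε i = ε j
  · rw [S.opSwap_of_eq h, S.opX_apply, S.opX_apply, S.opSwap_of_eq h,
      S.t_Z_of_ne ε i j hij h k hki hkj]
  · rw [S.opSwap_of_ne h, S.opX_apply, S.opX_apply, S.opX_apply, S.opSwap_of_ne h,
      S.Z_exch_of_ne hij h hki hkj]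
    module

theorem opFlip_opX_of_ne {i k : Fin n} (hi : i.val = 0) (hki : k ≠ i) :
    S.opFlip p i * S.opX k = S.opX k * S.opFlip p i := by
  refine LinearMap.ext fun f => funext fun ε => ?_
  simp only [Module.End.mul_apply]
  rw [S.opFlip_apply, S.opX_apply, S.opX_apply, S.opX_apply, S.opFlip_apply,
    S.Z_flip ε i hi k hki]
  module

end SignSystem

end SignSystems

/-! ### Braid and commutation relations for the model -/

section SignSystemRepresentation

namespace SignSystem

variable {F : Type*} [Field F] {K N : Type*} [CommRing K] [Algebra F K]
    [AddCommGroup N] [Module F N] [Module K N] [IsScalarTower F K N] {p q : F} {n : ℕ}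
    (S : SignSystem F K N q n)

theorem t_diag_of_ne {ε : Fin n → Bool} {i j k l : Fin n} (hij : j.val = i.val + 1)
    (hkl : l.val = k.val + 1) (h : ε i = ε j) (h' : ε k ≠ ε l) (hki : k ≠ i) (hkj : k ≠ j)
    (hli : l ≠ i) (hlj : l ≠ j) (v : N) :
    S.t ε j (S.diag ε k l • v) = S.diag ε k l • S.t ε j v := by
  have hk := S.t_Z_of_ne ε i j hij h k hki hkj
  have hl := S.t_Z_of_ne ε i j hij h l hli hlj
  rw [diag, mul_smul, mul_smul, commute_algebraMap, hl, commute_inverse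
    (S.isUnit_sub ε k l hkl h') (fun v => by rw [sub_smul, sub_smul, map_sub, hk, hl]),
    ← mul_smul, ← mul_smul]

theorem diag_exch_of_ne {ε : Fin n → Bool} {i j k l : Fin n} (hij : j.val = i.val + 1)
    (h : ε i ≠ ε j) (hki : k ≠ i) (hkj : k ≠ j) (hli : l ≠ i) (hlj : l ≠ j) :
    S.diag (exch i j ε) k l = S.diag ε k l := by
  rw [diag, S.Z_exch_of_ne hij h hki hkj, S.Z_exch_of_ne hij h hli hlj, diag]

theorem diag_flip_of_ne {ε : Fin n → Bool} {i k l : Fin n} (hi : i.val = 0)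
    (hki : k ≠ i) (hli : l ≠ i) : S.diag (flip i ε) k l = S.diag ε k l := by
  rw [diag, S.Z_flip ε i hi k hki, S.Z_flip ε i hi l hli, diag]

theorem opSwap_comm {i j k l : Fin n} (hij : j.val = i.val + 1) (hkl : l.val = k.val + 1)
    (hjk : j < k) : S.opSwap i j * S.opSwap k l = S.opSwap k l * S.opSwap i j := by
  have hki : k ≠ i := by rintro rfl; omega
  have hkj : k ≠ j := by rintro rfl; omega
  have hli : l ≠ i := by rintro rfl; omega
  have hlj : l ≠ j := by rintro rfl; omega
  refine LinearMap.ext fun f => funext fun ε => ?_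
  simp only [Module.End.mul_apply]
  have e₁ : exch k l ε i = ε i := exch_of_ne hki.symm hli.symm ε
  have e₂ : exch k l ε j = ε j := exch_of_ne hkj.symm hlj.symm ε
  have e₃ : exch i j ε k = ε k := exch_of_ne hki hkj ε
  have e₄ : exch i j ε l = ε l := exch_of_ne hli hlj ε
  by_cases h : ε i = ε j <;> by_cases h' : ε k = ε l
  · rw [S.opSwap_of_eq h, S.opSwap_of_eq h', S.opSwap_of_eq h', S.opSwap_of_eq h,
      S.t_far ε i j k l hij hkl hjk h h']
  · have h₁ : exch k l ε i = exch k l ε j := by rw [e₁, e₂, h]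
    rw [S.opSwap_of_eq h, S.opSwap_of_ne h', S.opSwap_of_ne h', S.opSwap_of_eq h,
      S.opSwap_of_eq h₁, S.t_exch ε k l i j hkl hij (Or.inr hjk) h', map_add, sub_smul, sub_smul,
      map_sub, commute_algebraMap, S.t_diag_of_ne hij hkl h h' hki hkj hli hlj,
      S.t_diag_of_ne hij hkl h h' hki hkj hli hlj]
  · have h₁ : exch i j ε k = exch i j ε l := by rw [e₃, e₄, h']
    rw [S.opSwap_of_eq h', S.opSwap_of_ne h, S.opSwap_of_ne h, S.opSwap_of_eq h',
      S.opSwap_of_eq h₁, S.t_exch ε i j k l hij hkl (Or.inl hjk) h, map_add, sub_smul, sub_smul,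
      map_sub, commute_algebraMap,
      S.t_diag_of_ne hkl hij h' h hki.symm hli.symm hkj.symm hlj.symm,
      S.t_diag_of_ne hkl hij h' h hki.symm hli.symm hkj.symm hlj.symm]
  · have h₁ : exch i j ε k ≠ exch i j ε l := by rwa [e₃, e₄]
    have h₂ : exch k l ε i ≠ exch k l ε j := by rwa [e₁, e₂]
    rw [S.opSwap_of_ne h, S.opSwap_of_ne h', S.opSwap_of_ne h', S.opSwap_of_ne h,
      S.opSwap_of_ne h₁, S.opSwap_of_ne h₂, S.diag_exch_of_ne hij h hki hkj hli hlj,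
      S.diag_exch_of_ne hkl h' hki.symm hli.symm hkj.symm hlj.symm,
      exch_exch_comm hki hkj hli hlj]
    module

theorem opFlip_opSwap_comm {i k l : Fin n} (hi : i.val = 0) (hkl : l.val = k.val + 1)
    (hk : 1 ≤ k.val) : S.opFlip p i * S.opSwap k l = S.opSwap k l * S.opFlip p i := by
  have hki : k ≠ i := by rintro rfl; omega
  have hli : l ≠ i := by rintro rfl; omega
  refine LinearMap.ext fun f => funext fun ε => ?_
  simp only [Module.End.mul_apply]
  have e₁ : flip i ε k = ε k := flip_of_ne hki ε
  have e₂ : flip i ε l = ε l := flip_of_ne hli ε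
  by_cases h : ε k = ε l
  · have h₁ : flip i ε k = flip i ε l := by rw [e₁, e₂, h]
    have hZ := S.t_Z_of_ne ε k l hkl h i hki.symm hli.symm
    have hd : ∀ v, S.t ε l (S.diagZero p ε i • v) = S.diagZero p ε i • S.t ε l v := by
      intro v
      rw [diagZero, mul_smul, mul_smul, commute_algebraMap, hZ, commute_inverse
        (S.isUnit_sub_one ε i hi) (fun v => by rw [sub_smul, sub_smul, map_sub, hZ, one_smul,
          one_smul]), ← mul_smul, ← mul_smul]
    rw [S.opSwap_of_eq h, S.opFlip_apply, S.opFlip_apply, S.opSwap_of_eq h,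
      S.opSwap_of_eq h₁, S.t_flip ε i l hi (by omega), map_add, sub_smul, sub_smul,
      map_sub, commute_algebraMap, hd, hd]
  · have h₁ : flip i ε k ≠ flip i ε l := by rwa [e₁, e₂]
    have hd : S.diagZero p (exch k l ε) i = S.diagZero p ε i := by
      rw [diagZero, S.Z_exch_of_ne hkl h hki.symm hli.symm, diagZero]
    rw [S.opSwap_of_ne h, S.opFlip_apply, S.opFlip_apply, S.opFlip_apply, S.opSwap_of_ne h,
      S.opSwap_of_ne h₁, S.diag_flip_of_ne hi hki hli, hd, exch_flip_comm hki hli]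
    module

/-- Moving `t` past `x` exchanges `Z₁` and `Z₂`, hence turns `x` into `y`, up to a correction term.
Writing the vector as a denominator times another vector reduces this to the rules for `Z₁`, `Z₂`,
`Z₃`. -/
theorem block_commute {t : N →ₗ[F] N} {Z₁ Z₂ Z₃ c x y : K}
    (htc : ∀ v, t (c • v) = c • t v)
    (h₁ : ∀ v, t (Z₁ • v) = Z₂ • t v - c • Z₂ • v) (h₂ : ∀ v, t (Z₂ • v) = Z₁ • t v + c • Z₂ • v)
    (h₃ : ∀ v, t (Z₃ • v) = Z₃ • t v) (hx : x * (Z₃ - Z₁) = c * Z₃) (hy : y * (Z₃ - Z₂) = c * Z₃)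
    (hu₁ : IsUnit (Z₃ - Z₁)) (hu₂ : IsUnit (Z₃ - Z₂)) :
    (∀ v, t (x • v) = y • t v + (x * (c - y)) • v) ∧
      ∀ v, t (y • v) = x • t v - (x * (c - y)) • v := by
  constructor
  · intro v
    obtain ⟨w, rfl⟩ : ∃ w, v = (Z₃ - Z₁) • w :=
      ⟨Ring.inverse (Z₃ - Z₁) • v, by rw [smul_smul, Ring.mul_inverse_cancel _ hu₁, one_smul]⟩
    rw [smul_smul, hx, mul_smul, htc, h₃, sub_smul, map_sub, h₁, h₃]
    match_scalars
    · linear_combination -hy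
    · linear_combination -(c - y) * hx + c * hy
  · intro v
    obtain ⟨w, rfl⟩ : ∃ w, v = (Z₃ - Z₂) • w :=
      ⟨Ring.inverse (Z₃ - Z₂) • v, by rw [smul_smul, Ring.mul_inverse_cancel _ hu₂, one_smul]⟩
    rw [smul_smul, hy, mul_smul, htc, h₃, sub_smul, map_sub, h₂, h₃]
    match_scalars
    · linear_combination -hx
    · linear_combination -x * hy

/-- The two operators preserve the block of three patterns in which the odd sign is at `k`, `j` or
`i`. By `t_exch_exch` a single map `t` acts at both ends of the block. -/
theorem opSwap_braid_of_eq_ne (hq : q ≠ 0) {i j k : Fin n} (hij : j.val = i.val + 1)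
    (hjk : k.val = j.val + 1) {ε : Fin n → Bool} (h : ε i = ε j) (h' : ε j ≠ ε k)
    (f : (Fin n → Bool) → N) :
    let A := S.opSwap i j
    let B := S.opSwap j k
    let ε₂ := exch j k ε
    let ε₃ := exch i j ε₂
    A (B (A f)) ε = B (A (B f)) ε ∧ A (B (A f)) ε₂ = B (A (B f)) ε₂ ∧
      A (B (A f)) ε₃ = B (A (B f)) ε₃ := by
  intro A B ε₂ ε₃
  have hij' : i ≠ j := by rintro rfl; omega
  have hik' : i ≠ k := by rintro rfl; omega
  have hjk' : j ≠ k := by rintro rfl; omega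
  have e₂i : ε₂ i = ε i := exch_of_ne hij' hik' ε
  have e₂j : ε₂ j = ε k := exch_left j k ε
  have e₂k : ε₂ k = ε j := exch_right j k ε
  have e₃j : ε₃ j = ε i := by rw [← e₂i]; exact exch_right i j ε₂
  have e₃k : ε₃ k = ε j := by rw [← e₂k]; exact exch_of_ne hik'.symm hjk'.symm ε₂
  have hne₂ : ε₂ i ≠ ε₂ j := by rw [e₂i, e₂j, h]; exact h'
  set c : K := algebraMap F K (q - q⁻¹) with hc
  set Q : K := algebraMap F K q with hQ
  set x := S.diag ε₂ i j with hx
  set y := S.diag ε j k with hy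
  have A₁ : ∀ f, A f ε = S.t ε j (f ε) := fun f => S.opSwap_of_eq h f
  have A₂ : ∀ f, A f ε₂ = x • f ε₂ + (Q - x) • f ε₃ := fun f => S.opSwap_of_ne hne₂ f
  have A₃ : ∀ f, A f ε₃ = (c - x) • f ε₃ + (Q - (c - x)) • f ε₂ := fun f => by
    have := S.opSwap_of_ne (exch_ne hne₂) f
    rwa [S.diag_exch hij hne₂, exch_exch] at this
  have B₁ : ∀ f, B f ε = y • f ε + (Q - y) • f ε₂ := fun f => S.opSwap_of_ne h' f
  have B₂ : ∀ f, B f ε₂ = (c - y) • f ε₂ + (Q - (c - y)) • f ε := fun f => by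
    have := S.opSwap_of_ne (exch_ne h') f
    rwa [S.diag_exch hjk h', exch_exch] at this
  have B₃ : ∀ f, B f ε₃ = S.t ε j (f ε₃) := fun f => by
    have := S.opSwap_of_eq (e₃j.trans (h.trans e₃k.symm)) f
    rwa [S.t_exch_exch ε i j k hij hjk h h'] at this
  have hQr : Q * algebraMap F K q⁻¹ = 1 := by rw [hQ, ← map_mul, mul_inv_cancel₀ hq, map_one]
  have hcQ : c = Q - algebraMap F K q⁻¹ := by rw [hc, map_sub]
  have Z₂i : S.Z ε₂ i = S.Z ε i := S.Z_exch_of_ne hjk h' hij' hik'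
  have Z₂j : S.Z ε₂ j = S.Z ε k := S.Z_exch_left hjk h'
  have hxZ := S.diag_mul hij hne₂
  have hux := S.isUnit_sub ε₂ i j hij hne₂
  rw [Z₂i, Z₂j] at hxZ hux
  have hyZ := S.diag_mul hjk h'
  have huy := S.isUnit_sub ε j k hjk h'
  have htF := commute_algebraMap (K := K) (S.t ε j)
  obtain ⟨hX, hY⟩ := block_commute (htF _)
    (fun v => by rw [algebraMap_smul]; exact S.t_Z_left ε i j hij h v)
    (fun v => by rw [algebraMap_smul]; exact S.t_Z_right ε i j hij h v)
    (S.t_Z_of_ne ε i j hij h k hik'.symm hjk'.symm) hxZ hyZ hux huy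
  have hsq : ∀ v, S.t ε j (S.t ε j v) = c • S.t ε j v + v := fun v => by
    rw [hc, algebraMap_smul]; exact S.t_sq ε i j hij h v
  refine ⟨?_, ?_, ?_⟩
  · rw [A₁, B₁, A₁, A₂, B₁, A₁, B₁, A₂, B₂, B₃]
    exact braid_block_row_one (S.t ε j).toAddMonoidHom Q _ c x y hcQ hQr (htF _) hsq hX hY
      _ _ _
  · rw [A₂, B₂, B₃, A₁, A₂, A₃, B₂, A₁, A₂, B₁, B₂, B₃]
    exact braid_block_row_two (S.t ε j).toAddMonoidHom Q _ c x y hcQ (htF _) (htF _) hX hY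
      _ _ _
  · rw [A₃, B₃, B₂, A₁, A₂, A₃, B₃, A₃, B₂, B₃]
    exact braid_block_row_three (S.t ε j).toAddMonoidHom Q _ c x y hcQ hQr (htF _) (htF _) hsq hX
      hY _ _ _

theorem opSwap_braid (hq : q ≠ 0) {i j k : Fin n} (hij : j.val = i.val + 1)
    (hjk : k.val = j.val + 1) :
    S.opSwap i j * S.opSwap j k * S.opSwap i j = S.opSwap j k * S.opSwap i j * S.opSwap j k := by
  refine LinearMap.ext fun f => funext fun ε => ?_
  simp only [Module.End.mul_apply]
  have hij' : i ≠ j := by rintro rfl; omega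
  have hik' : i ≠ k := by rintro rfl; omega
  have hjk' : j ≠ k := by rintro rfl; omega
  -- Of three signs either all agree or exactly one is odd; its place decides which of the three
  -- rows of a block applies.
  by_cases h : ε i = ε j
  · by_cases h' : ε j = ε k
    · rw [S.opSwap_of_eq h, S.opSwap_of_eq h', S.opSwap_of_eq h, S.opSwap_of_eq h',
        S.opSwap_of_eq h, S.opSwap_of_eq h', S.t_braid ε i j k hij hjk h h']
    · exact (S.opSwap_braid_of_eq_ne hq hij hjk h h' f).1
  · by_cases h' : ε j = ε k
    · have e₁ : exch i j ε j = ε i := exch_right i j ε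
      have e₂ : exch i j ε k = ε k := exch_of_ne hik'.symm hjk'.symm ε
      have e₃ : exch i j ε i = ε j := exch_left i j ε
      have h₁ : exch j k (exch i j ε) i = exch j k (exch i j ε) j := by
        rw [exch_of_ne hij' hik', e₃, exch_left, e₂, h']
      have h₂ : exch j k (exch i j ε) j ≠ exch j k (exch i j ε) k := by
        rw [exch_left, exch_right, e₁, e₂, ← h']; exact Ne.symm h
      have := (S.opSwap_braid_of_eq_ne hq hij hjk h₁ h₂ f).2.2
      simpa only [exch_exch] using this
    · have hik : ε i = ε k := by
        revert h h'
        cases ε i <;> cases ε j <;> cases ε k <;> simp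
      have h₁ : exch j k ε i = exch j k ε j := by
        rw [exch_of_ne hij' hik', exch_left, hik]
      have h₂ : exch j k ε j ≠ exch j k ε k := exch_ne h'
      have := (S.opSwap_braid_of_eq_ne hq hij hjk h₁ h₂ f).2.1
      simpa only [exch_exch] using this

/-- Changing the first sign and exchanging the first two link the four patterns `ε`, `ε₂`, `ε₃`,
`ε₄` in a chain. `T_1` acts by the same map `t` at both ends, where the two signs agree, and mixes
the two in the middle. -/
theorem opFlip_opSwap_braid_of_eq (hp : p ≠ 0) (hq : q ≠ 0) {i j : Fin n} (hi : i.val = 0)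
    (hj : j.val = 1) {ε : Fin n → Bool} (h : ε i = ε j) (f : (Fin n → Bool) → N) :
    let R := S.opFlip p i
    let A := S.opSwap i j
    A (R (A (R f))) ε = R (A (R (A f))) ε ∧
      A (R (A (R f))) (flip i ε) = R (A (R (A f))) (flip i ε) := by
  intro R A
  have hij : j.val = i.val + 1 := by omega
  have hij' : j ≠ i := by rintro rfl; omega
  set ε₂ := flip i ε with hε₂
  set ε₃ := exch i j ε₂ with hε₃
  set ε₄ := flip i ε₃ with hε₄
  have e₂i : ε₂ i = !ε i := flip_self i ε
  have e₂j : ε₂ j = ε j := flip_of_ne hij' ε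
  have e₃i : ε₃ i = ε j := by rw [hε₃, exch_left, e₂j]
  have e₃j : ε₃ j = !ε i := by rw [hε₃, exch_right, e₂i]
  have e₄i : ε₄ i = !ε j := by rw [hε₄, flip_self, e₃i]
  have e₄j : ε₄ j = !ε i := by rw [hε₄, flip_of_ne hij', e₃j]
  have hne₂ : ε₂ i ≠ ε₂ j := by rw [e₂i, e₂j, h]; cases ε j <;> simp
  set c : K := algebraMap F K (q - q⁻¹) with hc
  set a : K := algebraMap F K (p - p⁻¹) with ha
  set Q : K := algebraMap F K q with hQ
  set P : K := algebraMap F K p with hP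
  set x := S.diag ε₂ i j with hx
  set y₁ := S.diagZero p ε i with hy₁
  set y₂ := S.diagZero p ε₃ i with hy₂
  have A₁ : ∀ f, A f ε = S.t ε j (f ε) := fun f => S.opSwap_of_eq h f
  have A₂ : ∀ f, A f ε₂ = x • f ε₂ + (Q - x) • f ε₃ := fun f => S.opSwap_of_ne hne₂ f
  have A₃ : ∀ f, A f ε₃ = (c - x) • f ε₃ + (Q - (c - x)) • f ε₂ := fun f => by
    have := S.opSwap_of_ne (exch_ne hne₂) f
    rwa [S.diag_exch hij hne₂, exch_exch] at this
  have A₄ : ∀ f, A f ε₄ = S.t ε j (f ε₄) := fun f => by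
    have h₁ : ε₄ i = ε₄ j := by rw [e₄i, e₄j, h]
    have := S.opSwap_of_eq h₁ f
    rwa [S.t_flip_exch_flip ε i j hi hj h] at this
  have R₁ : ∀ f, R f ε = y₁ • f ε + (P - y₁) • f ε₂ := fun f => S.opFlip_apply i f ε
  have R₂ : ∀ f, R f ε₂ = (a - y₁) • f ε₂ + (P - (a - y₁)) • f ε := fun f => by
    have := S.opFlip_apply (p := p) i f ε₂
    rwa [hε₂, S.diagZero_flip ε hi, flip_flip] at this
  have R₃ : ∀ f, R f ε₃ = y₂ • f ε₃ + (P - y₂) • f ε₄ := fun f => S.opFlip_apply i f ε₃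
  have R₄ : ∀ f, R f ε₄ = (a - y₂) • f ε₄ + (P - (a - y₂)) • f ε₃ := fun f => by
    have := S.opFlip_apply (p := p) i f ε₄
    rwa [hε₄, S.diagZero_flip ε₃ hi, flip_flip] at this
  have hQr : Q * algebraMap F K q⁻¹ = 1 := by rw [hQ, ← map_mul, mul_inv_cancel₀ hq, map_one]
  have hcQ : c = Q - algebraMap F K q⁻¹ := by rw [hc, map_sub]
  have hPr : P * algebraMap F K p⁻¹ = 1 := by rw [hP, ← map_mul, mul_inv_cancel₀ hp, map_one]
  have haP : a = P - algebraMap F K p⁻¹ := by rw [ha, map_sub]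
  have htF := commute_algebraMap (K := K) (S.t ε j)
  set t := S.t ε j with ht
  have hsq : ∀ v, t (t v) = c • t v + v := fun v => by
    rw [hc, algebraMap_smul]; exact S.t_sq ε i j hij h v
  have Z₂i : S.Z ε₂ i = (S.Z ε i)⁻¹ := S.Z_flip_self ε i hi
  have Z₂j : S.Z ε₂ j = S.Z ε j := S.Z_flip ε i hi j hij'
  have Z₃i : S.Z ε₃ i = S.Z ε j := by rw [hε₃, S.Z_exch_left hij hne₂, Z₂j]
  set Y₁ := S.Z ε i with hY₁
  set Y₂ := S.Z ε j with hY₂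
  have tY₁ : ∀ v, t ((Y₁ : K) • v) = (Y₂ : K) • t v - c • (Y₂ : K) • v := fun v => by
    rw [hc, algebraMap_smul]; exact S.t_Z_left ε i j hij h v
  have tY₂ : ∀ v, t ((Y₂ : K) • v) = (Y₁ : K) • t v + c • (Y₂ : K) • v := fun v => by
    rw [hc, algebraMap_smul]; exact S.t_Z_right ε i j hij h v
  have u₁ := S.isUnit_sub_one ε i hi
  have u₂ := S.isUnit_sub_one ε₃ i hi
  have hy₁Z := S.diagZero_mul (p := p) ε hi
  have hy₂Z := S.diagZero_mul (p := p) ε₃ hi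
  rw [Z₃i] at u₂ hy₂Z
  have hxZ := S.diag_mul hij hne₂
  have hux := S.isUnit_sub ε₂ i j hij hne₂
  rw [Z₂i, Z₂j] at hxZ hux
  set e₁ : K := Ring.inverse ((Y₁ : K) - 1)
  set e₂ : K := Ring.inverse ((Y₂ : K) - 1)
  have he₁ : e₁ * ((Y₁ : K) - 1) = 1 := Ring.inverse_mul_cancel _ u₁
  have he₂ : e₂ * ((Y₂ : K) - 1) = 1 := Ring.inverse_mul_cancel _ u₂
  have hY₁i : (Y₁ : K) * ((Y₁⁻¹ : Kˣ) : K) = 1 := by simp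
  -- At `ε₂` the two lattice elements are `Y₁⁻¹` and `Y₂`; clearing `Y₁⁻¹` makes the denominator `Y₁
  -- * Y₂ - 1`, which commutes with `t`.
  have hx' : x * ((Y₁ : K) * Y₂ - 1) = c * (Y₁ * Y₂) := by
    linear_combination (Y₁ : K) * hxZ + x * hY₁i
  have hux' : IsUnit ((Y₁ : K) * Y₂ - 1) := by
    have := Y₁.isUnit.mul hux
    rwa [mul_sub, hY₁i] at this
  have hxe : x * (1 + e₁ + e₂) = c * (1 + e₁) * (1 + e₂) := by
    refine (u₁.mul u₂).mul_right_cancel ?_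
    linear_combination hx' + (x * ((Y₂ : K) - 1) - c * ((Y₂ : K) - 1) * (1 + e₂)) * he₁ +
      (x * ((Y₁ : K) - 1) - c * Y₁) * he₂
  have hy₁e : y₁ = a * (1 + e₁) := u₁.mul_right_cancel <| by
    linear_combination hy₁Z - a * he₁
  have hy₂e : y₂ = a * (1 + e₂) := u₂.mul_right_cancel <| by
    linear_combination hy₂Z - a * he₂
  have htYY : ∀ v, t (((Y₁ : K) * Y₂) • v) = ((Y₁ : K) * Y₂) • t v := fun v => by
    rw [mul_smul, tY₁, tY₂]; module
  have htx : ∀ v, t (x • v) = x • t v := by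
    intro v
    have hxe : x = c * (Y₁ * Y₂) * Ring.inverse ((Y₁ : K) * Y₂ - 1) := by
      rw [← hx', mul_assoc, Ring.mul_inverse_cancel _ hux', mul_one]
    rw [hxe, mul_smul, mul_smul, htF, htYY, commute_inverse hux'
      (fun v => by rw [sub_smul, sub_smul, map_sub, htYY, one_smul, one_smul]), ← mul_smul,
      ← mul_smul]
  have h₁ : ∀ v, t (e₁ • v) = e₂ • t v + (c * e₁ * (1 + e₂)) • v := by
    intro v
    obtain ⟨w, rfl⟩ : ∃ w, v = ((Y₁ : K) - 1) • w :=
      ⟨e₁ • v, by rw [smul_smul, mul_comm, he₁, one_smul]⟩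
    rw [smul_smul, he₁, one_smul, sub_smul, one_smul, map_sub, tY₁]
    match_scalars
    · linear_combination -he₂
    · linear_combination -c * (1 + e₂) * he₁ + c * he₂
  have h₂ : ∀ v, t (e₂ • v) = e₁ • t v - (c * e₁ * (1 + e₂)) • v := by
    intro v
    obtain ⟨w, rfl⟩ : ∃ w, v = ((Y₂ : K) - 1) • w :=
      ⟨e₂ • v, by rw [smul_smul, mul_comm, he₂, one_smul]⟩
    rw [smul_smul, he₂, one_smul, sub_smul, one_smul, map_sub, tY₂]
    match_scalars
    · linear_combination -he₁
    · linear_combination c * e₁ * he₂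
  constructor
  · rw [A₁, R₁, A₁, A₂, R₁, R₂, R₃, R₁, A₁, A₂, R₁, R₂, R₃, A₁, A₂, A₃, A₄]
    exact braid_zero_block_row_one t.toAddMonoidHom P _ a Q _ c x e₁ e₂ y₁ y₂ haP hPr hcQ hQr
      (htF _) (htF _) (htF _) (htF _) htx hsq h₁ h₂ hxe hy₁e hy₂e _ _ _ _
  · rw [A₂, R₂, R₃, A₁, A₂, A₃, A₄, R₁, R₂, R₃, R₄, R₂, A₁, A₂, R₁, R₂, R₃, A₁, A₂, A₃, A₄]
    exact braid_zero_block_row_two t.toAddMonoidHom P _ a Q _ c x e₁ e₂ y₁ y₂ haP hPr hcQ hQr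
      (htF _) (htF _) (htF _) htx hsq h₁ h₂ hxe hy₁e hy₂e _ _ _ _

theorem opFlip_opSwap_braid (hp : p ≠ 0) (hq : q ≠ 0) {i j : Fin n} (hi : i.val = 0)
    (hj : j.val = 1) :
    S.opSwap i j * S.opFlip p i * S.opSwap i j * S.opFlip p i =
      S.opFlip p i * S.opSwap i j * S.opFlip p i * S.opSwap i j := by
  refine LinearMap.ext fun f => funext fun ε => ?_
  simp only [Module.End.mul_apply]
  have hij : j ≠ i := by rintro rfl; omega
  by_cases h : ε i = ε j
  · exact (S.opFlip_opSwap_braid_of_eq hp hq hi hj h f).1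
  · have h' : flip i ε i = flip i ε j := by
      rw [flip_self, flip_of_ne hij]
      revert h
      cases ε i <;> cases ε j <;> simp
    have := (S.opFlip_opSwap_braid_of_eq hp hq hi hj h' f).2
    simpa only [flip_flip] using this

end SignSystem

end SignSystemRepresentation

/-! ### The representation of `H_n` on the model -/

section SignSystemModule

namespace SignSystem

variable {F : Type u} [Field F] {K N : Type*} [CommRing K] [Algebra F K]
    [AddCommGroup N] [Module F N] [Module K N] [IsScalarTower F K N] {p q : F} {n : ℕ}
    (S : SignSystem F K N q n)

/-- The action of `T_j`. -/
def opT (p : F) (j : Fin n) : Module.End F ((Fin n → Bool) → N) :=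
  if j.val = 0 then S.opFlip p j else S.opSwap ⟨j.val - 1, by omega⟩ j

theorem opT_zero {j : Fin n} (hj : j.val = 0) : S.opT p j = S.opFlip p j := if_pos hj

theorem opT_succ {i j : Fin n} (hij : j.val = i.val + 1) : S.opT p j = S.opSwap i j := by
  have : (⟨j.val - 1, by omega⟩ : Fin n) = i := Fin.ext (by simp [hij])
  rw [opT, if_neg (by omega), this]

/-- The action of the generators of the affine Hecke algebra. -/
def genAction (p : F) : Gen n → Module.End F ((Fin n → Bool) → N)
  | Gen.X i => Fin.cases (motive := fun _ => Module.End F ((Fin n → Bool) → N)) S.opMin S.opX i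
  | Gen.Xinv i =>
    Fin.cases (motive := fun _ => Module.End F ((Fin n → Bool) → N)) S.opMinInv S.opXinv i
  | Gen.T j => S.opT p j

theorem commute_of_diagonal {z w : (Fin n → Bool) → K}
    {A B : Module.End F ((Fin n → Bool) → N)} (hA : ∀ f ε, A f ε = z ε • f ε)
    (hB : ∀ f ε, B f ε = w ε • f ε) : A * B = B * A := by
  refine LinearMap.ext fun f => funext fun ε => ?_
  simp only [Module.End.mul_apply, hA, hB]
  exact smul_comm _ _ _

theorem quad_of_sq {A : Type*} [Ring A] [Algebra F A] {t : F} (ht : t ≠ 0) {a : A}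
    (h : a * a = (t - t⁻¹) • a + 1) :
    (a - algebraMap F A t) * (a + algebraMap F A t⁻¹) = 0 := by
  have h1 : algebraMap F A t * algebraMap F A t⁻¹ = 1 := by
    rw [← map_mul, mul_inv_cancel₀ ht, map_one]
  have h2 : a * algebraMap F A t⁻¹ = t⁻¹ • a := by
    rw [← Algebra.commutes, Algebra.smul_def]
  rw [sub_mul, mul_add, mul_add, h1, h2, ← Algebra.smul_def, h, sub_smul]
  abel

theorem genAction_rel (hp : p ≠ 0) (hq : q ≠ 0) {x y : FreeAlgebra F (Gen n)}
    (h : Rel p q n x y) :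
    FreeAlgebra.lift F (S.genAction p) x = FreeAlgebra.lift F (S.genAction p) y := by
  have hT : ∀ j, FreeAlgebra.lift F (S.genAction p) (fT F j) = S.opT p j := fun j =>
    FreeAlgebra.lift_ι_apply _ _
  have hX0 : FreeAlgebra.lift F (S.genAction p) (fX F 0) = S.opMin :=
    FreeAlgebra.lift_ι_apply _ _
  have hX : ∀ j : Fin n, FreeAlgebra.lift F (S.genAction p) (fX F j.succ) = S.opX j := fun j =>
    FreeAlgebra.lift_ι_apply _ _
  have hY0 : FreeAlgebra.lift F (S.genAction p) (fXinv F 0) = S.opMinInv :=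
    FreeAlgebra.lift_ι_apply _ _
  have hY : ∀ j : Fin n, FreeAlgebra.lift F (S.genAction p) (fXinv F j.succ) = S.opXinv j :=
    fun j => FreeAlgebra.lift_ι_apply _ _
  have hpred : ∀ j : Fin n, j.val ≠ 0 → ∃ i : Fin n, j.val = i.val + 1 := fun j hj =>
    ⟨⟨j.val - 1, by omega⟩, by simp; omega⟩
  cases h with
  | mul_inv i =>
    simp only [map_mul, map_one]
    refine LinearMap.ext fun f => funext fun ε => ?_
    refine Fin.cases ?_ (fun i => ?_) i
    · simp [hX0, hY0, opMin_apply, opMinInv_apply, smul_smul]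
    · simp [hX, hY, opX_apply, opXinv_apply, smul_smul]
  | inv_mul i =>
    simp only [map_mul, map_one]
    refine LinearMap.ext fun f => funext fun ε => ?_
    refine Fin.cases ?_ (fun i => ?_) i
    · simp [hX0, hY0, opMin_apply, opMinInv_apply, smul_smul]
    · simp [hX, hY, opX_apply, opXinv_apply, smul_smul]
  | lattice_comm i j =>
    simp only [map_mul]
    refine Fin.cases ?_ (fun i => ?_) i <;> refine Fin.cases ?_ (fun j => ?_) j <;>
      simp only [hX0, hX]
    · exact commute_of_diagonal S.opMin_apply (S.opX_apply _)
    · exact commute_of_diagonal (S.opX_apply _) S.opMin_apply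
    · exact commute_of_diagonal (S.opX_apply _) (S.opX_apply _)
  | quad_zero i hi =>
    simp only [map_mul, map_sub, map_add, map_zero, AlgHom.commutes, hT, S.opT_zero hi]
    exact quad_of_sq hp (S.opFlip_sq hp hi)
  | quad i hi =>
    obtain ⟨k, hk⟩ := hpred i (by omega)
    simp only [map_mul, map_sub, map_add, map_zero, AlgHom.commutes, hT, S.opT_succ hk]
    exact quad_of_sq hq (S.opSwap_sq hq hk)
  | braid i j hi hj =>
    obtain ⟨k, hk⟩ := hpred i (by omega)
    simp only [map_mul, hT, S.opT_succ hk, S.opT_succ hj]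
    exact S.opSwap_braid hq hk hj
  | far_comm i j hij =>
    obtain ⟨l, hl⟩ := hpred j (by omega)
    simp only [map_mul, hT, S.opT_succ hl]
    by_cases hi : i.val = 0
    · rw [S.opT_zero hi]
      exact S.opFlip_opSwap_comm hi hl (by omega)
    · obtain ⟨k, hk⟩ := hpred i hi
      rw [S.opT_succ hk]
      exact S.opSwap_comm hk hl (Fin.lt_def.2 (by omega))
  | braid_zero i j hi hj =>
    simp only [map_mul, hT, S.opT_zero hi, S.opT_succ (i := i) (j := j) (by omega)]
    exact S.opFlip_opSwap_braid hp hq hi hj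
  | mixed_zero i hi =>
    have : i.castSucc = 0 := Fin.ext (by simp [hi])
    simp only [map_mul, this, hT, hX, hX0, S.opT_zero hi]
    exact S.opFlip_opMin_opFlip hp hi
  | mixed_comm i j h₁ h₂ =>
    simp only [map_mul, hT]
    by_cases hi : i.val = 0
    · rw [S.opT_zero hi]
      have hj0 : j ≠ 0 := by
        rintro rfl; exact h₁ (Fin.ext (by simp [hi]))
      obtain ⟨k, rfl⟩ := Fin.exists_succ_eq.2 hj0
      rw [hX]
      exact S.opFlip_opX_of_ne hi (by rintro rfl; exact h₂ rfl)
    · obtain ⟨l, hl⟩ := hpred i hi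
      rw [S.opT_succ hl]
      revert h₁ h₂
      refine Fin.cases (fun _ _ => ?_) (fun k h₁ h₂ => ?_) j
      · rw [hX0]; exact S.opSwap_opMin hl
      · rw [hX]
        refine S.opSwap_opX_of_ne hl ?_ (by rintro rfl; exact h₂ rfl)
        rintro rfl
        exact h₁ (Fin.ext (by simp [hl]))
  | mixed i hi =>
    obtain ⟨k, hk⟩ := hpred i (by omega)
    have : i.castSucc = k.succ := Fin.ext (by simp [hk])
    simp only [map_mul, this, hT, hX, S.opT_succ hk]
    exact S.opSwap_opX_opSwap hq hk

/-- The representation of the affine Hecke algebra on functions from sign patterns to `N`. -/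
def rep (hp : p ≠ 0) (hq : q ≠ 0) : H p q n →ₐ[F] Module.End F ((Fin n → Bool) → N) :=
  RingQuot.liftAlgHom F
    ⟨FreeAlgebra.lift F (S.genAction p), fun _ _ h => S.genAction_rel hp hq h⟩

theorem rep_mk (hp : p ≠ 0) (hq : q ≠ 0) (x : FreeAlgebra F (Gen n)) :
    S.rep hp hq (AffineHecke.mk p q n x) = FreeAlgebra.lift F (S.genAction p) x :=
  RingQuot.liftAlgHom_mkAlgHom_apply _ _ _ _

theorem rep_T (hp : p ≠ 0) (hq : q ≠ 0) (j : Fin n) :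
    S.rep hp hq (T p q j) = S.opT p j := by
  rw [T, rep_mk]; exact FreeAlgebra.lift_ι_apply _ _

theorem rep_X (hp : p ≠ 0) (hq : q ≠ 0) (j : Fin n) :
    S.rep hp hq (X p q j.succ) = S.opX j := by
  rw [X, rep_mk]; exact FreeAlgebra.lift_ι_apply _ _

theorem rep_Xinv (hp : p ≠ 0) (hq : q ≠ 0) (j : Fin n) :
    S.rep hp hq (Xinv p q j.succ) = S.opXinv j := by
  rw [Xinv, rep_mk]; exact FreeAlgebra.lift_ι_apply _ _

end SignSystem

end SignSystemModule

/-! ### Positions attached to sign patterns -/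

section SignCombinatorics

variable {n : ℕ}

/-- The number of negative signs to the right of a position; `true` stands for a negative sign. -/
def cnt (ε : Fin n → Bool) (k : Fin n) : ℕ := (Finset.univ.filter fun l => k < l ∧ ε l = true).card

/-- The minimal coset representative attached to a sign pattern, without the signs. -/
def pos (ε : Fin n → Bool) (k : Fin n) : ℕ := cnt ε k + if ε k = true then 0 else k.val

/-- The index of the type `A` generator through which `T_j` acts, when the signs at the positions
`j - 1` and `j` agree. -/
def pairPos (ε : Fin n → Bool) (j : Fin n) : ℕ := cnt ε j + if ε j = true then 0 else j.val - 1

theorem cnt_succ (ε : Fin n → Bool) {i j : Fin n} (hij : j.val = i.val + 1) :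
    cnt ε i = cnt ε j + if ε j = true then 1 else 0 := by
  have hs : ∀ l : Fin n, i < l ↔ l = j ∨ j < l := fun l => by
    rw [Fin.lt_def, Fin.lt_def, Fin.ext_iff]; omega
  split_ifs with h
  · have : (Finset.univ.filter fun l => i < l ∧ ε l = true) =
        insert j (Finset.univ.filter fun l => j < l ∧ ε l = true) := by
      ext l
      simp only [Finset.mem_filter_univ, Finset.mem_insert, hs]
      constructor
      · rintro ⟨h₁ | h₁, h₂⟩
        · exact Or.inl h₁
        · exact Or.inr ⟨h₁, h₂⟩
      · rintro (rfl | ⟨h₁, h₂⟩)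
        · exact ⟨Or.inl rfl, h⟩
        · exact ⟨Or.inr h₁, h₂⟩
    rw [cnt, this, Finset.card_insert_of_notMem (by simp), cnt]
  · rw [cnt, cnt, add_zero]
    congr 1
    ext l
    simp only [Finset.mem_filter_univ, hs]
    constructor
    · rintro ⟨rfl | h₁, h₂⟩
      · exact absurd h₂ h
      · exact ⟨h₁, h₂⟩
    · rintro ⟨h₁, h₂⟩
      exact ⟨Or.inr h₁, h₂⟩

theorem cnt_add_lt (ε : Fin n → Bool) (k : Fin n) : cnt ε k + k.val < n := by
  have : cnt ε k ≤ (Finset.Ioi k).card := by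
    refine Finset.card_le_card fun l hl => ?_
    rw [Finset.mem_filter_univ] at hl
    exact Finset.mem_Ioi.2 hl.1
  rw [Fin.card_Ioi] at this
  omega

/-- Strictly between `k` and `l` there are `d` positions, each contributing at most one negative
sign. -/
theorem cnt_bounds (ε : Fin n → Bool) (d : ℕ) (k l : Fin n) (h : l.val = k.val + d + 1) :
    (cnt ε l + if ε l = true then 1 else 0) ≤ cnt ε k ∧
      cnt ε k ≤ (cnt ε l + if ε l = true then 1 else 0) + d := by
  induction d generalizing l with
  | zero => rw [cnt_succ ε (i := k) (j := l) (by omega)]; simp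
  | succ d ih =>
    obtain ⟨h₁, h₂⟩ := ih ⟨k.val + d + 1, by omega⟩ rfl
    have := cnt_succ ε (i := ⟨k.val + d + 1, by omega⟩) (j := l) (by simp; omega)
    split_ifs at * <;> omega

theorem cnt_exch (ε : Fin n → Bool) {i j k : Fin n} (hij : j.val = i.val + 1) (hk : k ≠ i) :
    cnt (exch i j ε) k = cnt ε k := by
  refine Finset.card_equiv (Equiv.swap i j) fun l => ?_
  have : k < Equiv.swap i j l ↔ k < l := by
    rw [Equiv.swap_apply_def]
    have := Fin.val_ne_of_ne hk
    split_ifs with h₁ h₂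
    · subst h₁; rw [Fin.lt_def, Fin.lt_def]; omega
    · subst h₂; rw [Fin.lt_def, Fin.lt_def]; omega
    · rfl
  rw [Finset.mem_filter_univ, Finset.mem_filter_univ, this]
  rfl

theorem cnt_flip (ε : Fin n → Bool) {i : Fin n} (hi : i.val = 0) (k : Fin n) :
    cnt (flip i ε) k = cnt ε k := by
  rw [cnt, cnt]
  congr 1
  ext l
  rw [Finset.mem_filter_univ, Finset.mem_filter_univ]
  refine and_congr_right fun h => ?_
  rw [flip_of_ne]
  rintro rfl
  rw [Fin.lt_def] at h
  omega

theorem pos_lt (ε : Fin n → Bool) (k : Fin n) : pos ε k < n := by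
  have := cnt_add_lt ε k
  unfold pos; split_ifs <;> omega

/-- `pos` lists the negative positions from right to left and after them the positive ones from left
to right. -/
theorem pos_injective (ε : Fin n → Bool) : Function.Injective (pos ε) := by
  have key : ∀ k l : Fin n, k < l → pos ε k ≠ pos ε l := by
    intro k l h
    rw [Fin.lt_def] at h
    have := cnt_bounds ε (l.val - k.val - 1) k l (by omega)
    unfold pos
    split_ifs at * <;> omega
  intro k l h
  rcases lt_trichotomy k l with h' | h' | h'
  · exact absurd h (key k l h')
  · exact h'
  · exact absurd h.symm (key l k h')

theorem pos_exch {ε : Fin n → Bool} {i j : Fin n} (hij : j.val = i.val + 1) (h : ε i ≠ ε j)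
    (k : Fin n) : pos (exch i j ε) k = pos ε (Equiv.swap i j k) := by
  have hji : j ≠ i := by rintro rfl; omega
  by_cases hki : k = i
  · subst hki
    rw [Equiv.swap_apply_left, pos, pos, cnt_succ _ hij, cnt_exch _ hij hji, exch_left, exch_right]
    cases h₁ : ε k <;> cases h₂ : ε j <;> simp_all
    omega
  · by_cases hkj : k = j
    · subst hkj
      rw [Equiv.swap_apply_right, pos, pos, cnt_succ ε hij, cnt_exch _ hij hji, exch_right]
      cases h₁ : ε i <;> cases h₂ : ε k <;> simp_all
      omega
    · rw [Equiv.swap_apply_of_ne_of_ne hki hkj, pos, pos, cnt_exch _ hij hki, exch_of_ne hki hkj]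

theorem pairPos_of_false {ε : Fin n → Bool} {i j : Fin n} (hij : j.val = i.val + 1)
    (h : ε i = ε j) (hj : ε j = false) : pairPos ε j = pos ε i ∧ pairPos ε j + 1 = pos ε j := by
  simp only [pairPos, pos, cnt_succ ε hij, h, hj]
  simp
  omega

/-- Negative positions are listed backwards, so the pair is reversed. This matches the fact that the
Bernstein relation for `Y_a`, `Y_{a+1}` becomes one for `Y_{a+1}⁻¹`, `Y_a⁻¹`. -/
theorem pairPos_of_true {ε : Fin n → Bool} {i j : Fin n} (hij : j.val = i.val + 1)
    (h : ε i = ε j) (hj : ε j = true) : pairPos ε j = pos ε j ∧ pairPos ε j + 1 = pos ε i := by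
  simp [pairPos, pos, cnt_succ ε hij, h, hj]

end SignCombinatorics

/-! ### From type `A` data to a sign system -/

/-- The action of the affine Hecke algebra of type `A` on `N`, with the lattice acting through a
commutative algebra `K`; `τ j` is the action of the generator exchanging `Y j` and `Y (j + 1)`. -/
structure TypeASystem (F : Type*) [Field F] (K N : Type*) [CommRing K] [Algebra F K]
    [AddCommGroup N] [Module F N] [Module K N] (q : F) (n : ℕ) where
  Y : ℕ → Kˣ
  τ : ℕ → N →ₗ[F] N
  sq : ∀ j, j + 1 < n → ∀ v, τ j (τ j v) = (q - q⁻¹) • τ j v + v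
  left : ∀ j, j + 1 < n → ∀ v,
    τ j ((Y j : K) • v) = (Y (j + 1) : K) • τ j v - (q - q⁻¹) • (Y (j + 1) : K) • v
  right : ∀ j, j + 1 < n → ∀ v,
    τ j ((Y (j + 1) : K) • v) = (Y j : K) • τ j v + (q - q⁻¹) • (Y (j + 1) : K) • v
  of_ne : ∀ j, j + 1 < n → ∀ k, k ≠ j → k ≠ j + 1 → ∀ v,
    τ j ((Y k : K) • v) = (Y k : K) • τ j v
  braid : ∀ j, j + 2 < n → ∀ v, τ j (τ (j + 1) (τ j v)) = τ (j + 1) (τ j (τ (j + 1) v))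
  far : ∀ j l, j + 1 < l → l + 1 < n → ∀ v, τ j (τ l v) = τ l (τ j v)
  isUnit_mul_sub_one : ∀ a b, a < n → b < n → a ≠ b → IsUnit ((Y a : K) * Y b - 1)
  isUnit_sub_one : ∀ a < n, IsUnit ((Y a : K) - 1)

namespace TypeASystem

variable {F : Type*} [Field F] {K N : Type*} [CommRing K] [Algebra F K]
    [AddCommGroup N] [Module F N] [Module K N] [IsScalarTower F K N] {q : F} {n : ℕ}
    (S : TypeASystem F K N q n)

theorem left_inv {j : ℕ} (hj : j + 1 < n) (v : N) :
    S.τ j ((((S.Y (j + 1))⁻¹ : Kˣ) : K) • v) =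
      (((S.Y j)⁻¹ : Kˣ) : K) • S.τ j v - (q - q⁻¹) • (((S.Y j)⁻¹ : Kˣ) : K) • v := by
  obtain ⟨w, rfl⟩ : ∃ w, v = (S.Y (j + 1) : K) • w :=
    ⟨(((S.Y (j + 1))⁻¹ : Kˣ) : K) • v, by rw [smul_smul, Units.mul_inv, one_smul]⟩
  rw [smul_smul, Units.inv_mul, one_smul, S.right j hj, smul_add, smul_smul, Units.inv_mul,
    one_smul, smul_algebra_smul_comm, add_sub_cancel_right]

theorem right_inv {j : ℕ} (hj : j + 1 < n) (v : N) :
    S.τ j ((((S.Y j)⁻¹ : Kˣ) : K) • v) =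
      (((S.Y (j + 1))⁻¹ : Kˣ) : K) • S.τ j v + (q - q⁻¹) • (((S.Y j)⁻¹ : Kˣ) : K) • v := by
  obtain ⟨w, rfl⟩ : ∃ w, v = (S.Y j : K) • w :=
    ⟨(((S.Y j)⁻¹ : Kˣ) : K) • v, by rw [smul_smul, Units.mul_inv, one_smul]⟩
  rw [smul_smul, Units.inv_mul, one_smul, S.left j hj, smul_sub, smul_smul, Units.inv_mul,
    one_smul, smul_algebra_smul_comm, smul_smul, Units.inv_mul, one_smul, sub_add_cancel]

theorem of_ne_inv {j k : ℕ} (hj : j + 1 < n) (h₁ : k ≠ j) (h₂ : k ≠ j + 1) (v : N) :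
    S.τ j ((((S.Y k)⁻¹ : Kˣ) : K) • v) = (((S.Y k)⁻¹ : Kˣ) : K) • S.τ j v := by
  rw [← Ring.inverse_unit]
  exact SignSystem.commute_inverse (S.Y k).isUnit (S.of_ne j hj k h₁ h₂) v

/-- The lattice action on the component of a sign pattern. -/
def weight (ε : Fin n → Bool) (k : Fin n) : Kˣ :=
  if ε k = true then (S.Y (pos ε k))⁻¹ else S.Y (pos ε k)

theorem weight_of_true {ε : Fin n → Bool} {k : Fin n} (h : ε k = true) :
    S.weight ε k = (S.Y (pos ε k))⁻¹ := if_pos h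

theorem weight_of_false {ε : Fin n → Bool} {k : Fin n} (h : ε k = false) :
    S.weight ε k = S.Y (pos ε k) := if_neg (by simp [h])

theorem pairPos_lt {ε : Fin n → Bool} {i j : Fin n} (hij : j.val = i.val + 1) (h : ε i = ε j) :
    pairPos ε j + 1 < n := by
  cases hj : ε j
  · rw [(pairPos_of_false hij h hj).2]; exact pos_lt ε j
  · rw [(pairPos_of_true hij h hj).2]; exact pos_lt ε i

theorem pairPos_ne {ε : Fin n → Bool} {i j : Fin n} (hij : j.val = i.val + 1) (h : ε i = ε j)
    {k : Fin n} (hi : k ≠ i) (hj : k ≠ j) : pos ε k ≠ pairPos ε j ∧ pos ε k ≠ pairPos ε j + 1 := by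
  cases hj' : ε j
  · rw [(pairPos_of_false hij h hj').2, (pairPos_of_false hij h hj').1]
    exact ⟨(pos_injective ε).ne hi, (pos_injective ε).ne hj⟩
  · rw [(pairPos_of_true hij h hj').2, (pairPos_of_true hij h hj').1]
    exact ⟨(pos_injective ε).ne hj, (pos_injective ε).ne hi⟩

theorem isUnit_sub_inv {a b : ℕ} (ha : a < n) (hb : b < n) (h : a ≠ b) :
    IsUnit ((S.Y a : K) - ((S.Y b)⁻¹ : Kˣ)) := by
  have := (S.isUnit_mul_sub_one a b ha hb h).mul (S.Y b)⁻¹.isUnit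
  rwa [sub_mul, mul_assoc, Units.mul_inv, mul_one, one_mul] at this

/-- The type `B` data induced from a module over the affine Hecke algebra of type `A`. -/
def signSystem : SignSystem F K N q n where
  Z := S.weight
  t ε j := S.τ (pairPos ε j)
  Z_exch ε i j hij h k := by
    rw [weight, weight, pos_exch hij h]; rfl
  Z_flip_self ε i hi := by
    have hp : pos (flip i ε) i = pos ε i := by
      rw [pos, pos, cnt_flip ε hi, hi]; simp
    rw [weight, weight, hp, flip_self]
    cases ε i <;> simp
  Z_flip ε i hi k hk := by
    rw [weight, weight, pos, pos, cnt_flip ε hi, flip_of_ne hk]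
  t_sq ε i j hij h v := S.sq _ (pairPos_lt hij h) v
  t_Z_left ε i j hij h v := by
    have hlt := pairPos_lt hij h
    cases hj : ε j
    · obtain ⟨h₁, h₂⟩ := pairPos_of_false hij h hj
      rw [S.weight_of_false (h.trans hj), S.weight_of_false hj, ← h₁, ← h₂]
      exact S.left _ hlt v
    · obtain ⟨h₁, h₂⟩ := pairPos_of_true hij h hj
      rw [S.weight_of_true (h.trans hj), S.weight_of_true hj, ← h₁, ← h₂]
      exact S.left_inv hlt v
  t_Z_right ε i j hij h v := by
    have hlt := pairPos_lt hij h
    cases hj : ε j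
    · obtain ⟨h₁, h₂⟩ := pairPos_of_false hij h hj
      rw [S.weight_of_false (h.trans hj), S.weight_of_false hj, ← h₁, ← h₂]
      exact S.right _ hlt v
    · obtain ⟨h₁, h₂⟩ := pairPos_of_true hij h hj
      rw [S.weight_of_true (h.trans hj), S.weight_of_true hj, ← h₁, ← h₂]
      exact S.right_inv hlt v
  t_Z_of_ne ε i j hij h k hki hkj v := by
    obtain ⟨h₁, h₂⟩ := pairPos_ne hij h hki hkj
    cases hk : ε k
    · rw [S.weight_of_false hk]; exact S.of_ne _ (pairPos_lt hij h) _ h₁ h₂ v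
    · rw [S.weight_of_true hk]; exact S.of_ne_inv (pairPos_lt hij h) h₁ h₂ v
  t_braid ε i j k hij hjk h h' v := by
    have hlt₁ := pairPos_lt hij h
    have hlt₂ := pairPos_lt hjk h'
    cases hk : ε k
    · have hj := h'.trans hk
      have h₁ := (pairPos_of_false hij h hj).2
      have h₂ := (pairPos_of_false hjk h' hk).1
      rw [h₂, ← h₁] at hlt₂ ⊢
      exact S.braid _ hlt₂ v
    · have hj := h'.trans hk
      have h₁ := (pairPos_of_true hij h hj).1
      have h₂ := (pairPos_of_true hjk h' hk).2
      rw [h₁, ← h₂] at hlt₁ ⊢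
      exact (S.braid _ hlt₁ v).symm
  t_far ε i j k l hij hkl hjk h h' v := by
    rw [Fin.lt_def] at hjk
    have hlt₁ := pairPos_lt hij h
    have hlt₂ := pairPos_lt hkl h'
    have h₁ := pairPos_ne hij h (k := k) (by rintro rfl; omega) (by rintro rfl; omega)
    have h₂ := pairPos_ne hij h (k := l) (by rintro rfl; omega) (by rintro rfl; omega)
    have h₃ : (pairPos ε l = pos ε k ∧ pairPos ε l + 1 = pos ε l) ∨
        (pairPos ε l = pos ε l ∧ pairPos ε l + 1 = pos ε k) := by
      cases hl : ε l
      · exact Or.inl (pairPos_of_false hkl h' hl)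
      · exact Or.inr (pairPos_of_true hkl h' hl)
    -- Disjoint pairs of positions go to disjoint pairs of consecutive indices, but possibly in the
    -- opposite order.
    have h₄ : pairPos ε j + 1 < pairPos ε l ∨ pairPos ε l + 1 < pairPos ε j := by omega
    rcases h₄ with h₄ | h₄
    · exact S.far _ _ h₄ hlt₂ v
    · exact (S.far _ _ h₄ hlt₁ v).symm
  t_exch ε i j k l hij hkl hjk h := by
    have hli : l ≠ i := by rintro rfl; rw [Fin.lt_def, Fin.lt_def] at hjk; omega
    have hlj : l ≠ j := by rintro rfl; rw [Fin.lt_def, Fin.lt_def] at hjk; omega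
    rw [pairPos, cnt_exch ε hij hli, exch_of_ne hli hlj, pairPos]
  t_flip ε i l hi hl := by
    rw [pairPos, cnt_flip ε hi, flip_of_ne (by rintro rfl; omega), pairPos]
  t_exch_exch ε i j k hij hjk h h' := by
    have hki : k ≠ i := by rintro rfl; omega
    have hkj : k ≠ j := by rintro rfl; omega
    rw [pairPos, pairPos, cnt_exch _ hij hki, cnt_exch _ hjk hkj, exch_of_ne hki hkj, exch_right,
      cnt_succ ε hjk]
    congr 1
    revert h'
    cases ε j <;> cases ε k <;> simp <;> omega
  t_flip_exch_flip ε i j hi hj h := by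
    have hji : j ≠ i := by rintro rfl; omega
    rw [pairPos, pairPos, cnt_flip _ hi, cnt_exch _ (by omega) hji, cnt_flip _ hi, hj]
    simp
  isUnit_sub ε i j hij h := by
    have hne : pos ε i ≠ pos ε j := (pos_injective ε).ne (by rintro rfl; omega)
    cases hj : ε j
    · have hi : ε i = true := by revert h; rw [hj]; simp
      rw [S.weight_of_true hi, S.weight_of_false hj]
      exact S.isUnit_sub_inv (pos_lt _ _) (pos_lt _ _) hne.symm
    · have hi : ε i = false := by revert h; rw [hj]; simp
      rw [S.weight_of_true hj, S.weight_of_false hi, ← neg_sub]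
      exact (S.isUnit_sub_inv (pos_lt _ _) (pos_lt _ _) hne).neg
  isUnit_sub_one ε i hi := by
    have h₁ := S.isUnit_sub_one _ (pos_lt ε i)
    cases h : ε i
    · rw [S.weight_of_false h]; exact h₁
    · rw [S.weight_of_true h]
      have := (h₁.mul (S.Y (pos ε i))⁻¹.isUnit).neg
      rwa [sub_mul, Units.mul_inv, one_mul, neg_sub] at this

end TypeASystem

/-! ### The induced module and Frobenius reciprocity -/

section InducedModule

variable {F : Type u} [Field F] {A : Type v} [Ring A] [Algebra F A] {B : Type v} [Ring B]
  [Algebra F B] (f : B →ₐ[F] A) (N : Type w) [AddCommGroup N] [Module F N] [Module B N]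

/-- The canonical map `x ↦ 1 ⊗ x` to the induced module. -/
def indι : N →ₗ[F] Ind f N where
  toFun x := (indRel f N).mkQ (1 ⊗ₜ[F] x)
  map_add' x y := by rw [TensorProduct.tmul_add, map_add]
  map_smul' r x := by
    rw [TensorProduct.tmul_smul, ← algebraMap_smul A r ((1 : A) ⊗ₜ[F] x), map_smul,
      algebraMap_smul]; rfl

variable {N}

theorem smul_indι (a : A) (x : N) : a • indι f N x = (indRel f N).mkQ (a ⊗ₜ[F] x) := by
  rw [indι, LinearMap.coe_mk, AddHom.coe_mk, ← map_smul, TensorProduct.smul_tmul', smul_eq_mul,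
    mul_one]

theorem indι_smul (b : B) (x : N) : indι f N (b • x) = f b • indι f N x := by
  rw [smul_indι]
  symm
  rw [← sub_eq_zero]
  change (indRel f N).mkQ _ - (indRel f N).mkQ _ = 0
  rw [← map_sub, Submodule.mkQ_apply, Submodule.Quotient.mk_eq_zero]
  exact Submodule.subset_span ⟨1, b, x, by rw [one_mul]⟩

theorem ind_induction {P : Submodule A (Ind f N)} (h : ∀ x, indι f N x ∈ P) : P = ⊤ := by
  rw [eq_top_iff]
  rintro y -
  obtain ⟨t, rfl⟩ := (indRel f N).mkQ_surjective y
  induction t using TensorProduct.induction_on with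
  | zero => simp
  | tmul a x => rw [← smul_indι]; exact P.smul_mem a (h x)
  | add s t hs ht => rw [map_add]; exact P.add_mem hs ht

/-- The universal property of the induced module. -/
theorem exists_ind_lift {M : Type*} [AddCommGroup M] [Module F M] [Module A M]
    [IsScalarTower F A M] (g : N →ₗ[F] M) (hg : ∀ b x, g (b • x) = f b • g x) :
    ∃ φ : Ind f N →ₗ[A] M, ∀ x, φ (indι f N x) = g x := by
  let ψ : A ⊗[F] N →ₗ[A] M :=
    TensorProduct.AlgebraTensorModule.lift
      (LinearMap.toSpanSingleton A (N →ₗ[F] M) g)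
  have hψ : ∀ a x, ψ (a ⊗ₜ x) = a • g x := fun a x => rfl
  refine ⟨(indRel f N).liftQ ψ ?_, fun x => ?_⟩
  · rw [indRel, Submodule.span_le]
    rintro _ ⟨a, b, x, rfl⟩
    rw [SetLike.mem_coe, LinearMap.mem_ker, map_sub, hψ, hψ, hg, mul_smul, sub_self]
  · change ψ (1 ⊗ₜ x) = _
    rw [hψ, one_smul]

theorem ind_hom_ext {M : Type*} [AddCommGroup M] [Module A M] {φ ψ : Ind f N →ₗ[A] M}
    (h : ∀ x, φ (indι f N x) = ψ (indι f N x)) : φ = ψ := by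
  have := ind_induction f (P := LinearMap.eqLocus φ ψ) h
  refine LinearMap.ext fun y => ?_
  exact (this ▸ Submodule.mem_top : y ∈ LinearMap.eqLocus φ ψ)

theorem nonempty_ind_congr [IsScalarTower F B N] {N' : Type*} [AddCommGroup N'] [Module F N']
    [Module B N'] [IsScalarTower F B N'] (e : N ≃ₗ[B] N') :
    Nonempty (Ind f N ≃ₗ[A] Ind f N') := by
  obtain ⟨φ, hφ⟩ := exists_ind_lift f (indι f N' ∘ₗ (e.toLinearMap.restrictScalars F))
    (fun b x => by simp [indι_smul])
  obtain ⟨ψ, hψ⟩ := exists_ind_lift f (indι f N ∘ₗ (e.symm.toLinearMap.restrictScalars F))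
    (fun b x => by simp [indι_smul])
  refine ⟨LinearEquiv.ofLinearMap φ ψ (ind_hom_ext f fun x => ?_) (ind_hom_ext f fun x => ?_)⟩
  · simp [hφ, hψ]
  · simp [hφ, hψ]

end InducedModule

/-! ### Generation of the model by the trivial pattern -/

section SignInduction

variable {n : ℕ}

/-- Every sign pattern is reached from the trivial one by changing the sign at the first position
and by moving negative signs to the right. -/
theorem sign_induction {P : (Fin n → Bool) → Prop} (hzero : P fun _ => false)
    (hflip : ∀ ε (i : Fin n), i.val = 0 → ε i = true → P (flip i ε) → P ε)
    (hexch : ∀ ε (i j : Fin n), j.val = i.val + 1 → ε i = false → ε j = true →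
      P (exch i j ε) → P ε) (ε : Fin n → Bool) : P ε := by
  -- Moving a negative sign one step to the left and removing one at the first position both lower
  -- this sum; the `+ 1` makes the removal count. Taking the leftmost negative sign guarantees a
  -- positive left neighbour.
  let μ : (Fin n → Bool) → ℕ := fun ε => ∑ k : Fin n, if ε k = true then k.val + 1 else 0
  induction hm : μ ε using Nat.strong_induction_on generalizing ε with
  | _ m ih =>
  subst hm
  by_cases h : ∃ j, ε j = true
  · obtain ⟨j, hj, hmin⟩ : ∃ j, ε j = true ∧ ∀ i < j, ε i = false := by
      obtain ⟨j, hj⟩ := h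
      induction hm : j.val using Nat.strong_induction_on generalizing j with
      | _ m ihj =>
      subst hm
      by_cases h' : ∃ i < j, ε i = true
      · obtain ⟨i, hi, hi'⟩ := h'
        exact ihj i.val hi i hi' rfl
      · refine ⟨j, hj, fun i hi => ?_⟩
        by_contra hne
        exact h' ⟨i, hi, by simpa using hne⟩
    by_cases hj0 : j.val = 0
    · refine hflip ε j hj0 hj (ih _ ?_ _ rfl)
      refine Finset.sum_lt_sum (fun k _ => ?_) ⟨j, Finset.mem_univ _, by simp [hj]⟩
      by_cases hk : k = j
      · subst hk; simp [hj]
      · rw [flip_of_ne hk]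
    · set i : Fin n := ⟨j.val - 1, by omega⟩ with hi
      have hij : j.val = i.val + 1 := by simp [hi]; omega
      have hεi : ε i = false := hmin i (Fin.lt_def.2 (by omega))
      refine hexch ε i j hij hεi hj (ih _ ?_ _ rfl)
      have hsum : μ (exch i j ε) =
          ∑ k : Fin n, if ε k = true then (Equiv.swap i j k).val + 1 else 0 := by
        rw [← Equiv.sum_comp (Equiv.swap i j)]
        refine Finset.sum_congr rfl fun k _ => ?_
        rw [show Equiv.swap i j (Equiv.swap i j k) = k by simp]
        rfl
      rw [hsum]
      refine Finset.sum_lt_sum (fun k _ => ?_) ⟨j, Finset.mem_univ _, by simp [hj]; omega⟩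
      by_cases hki : k = i
      · subst hki; simp [hεi]
      · by_cases hkj : k = j
        · subst hkj; simp [hj]; omega
        · rw [Equiv.swap_apply_of_ne_of_ne hki hkj]
  · have : ε = fun _ => false := by
      funext k
      by_contra hne
      exact h ⟨k, by simpa using hne⟩
    rw [this]
    exact hzero

end SignInduction

namespace SignSystem

variable {F : Type*} [Field F] {K N : Type*} [CommRing K] [Algebra F K]
    [AddCommGroup N] [Module F N] [Module K N] [IsScalarTower F K N] {p q : F} {n : ℕ}
    (S : SignSystem F K N q n)

/-- The off-diagonal coefficient times its denominator `Z_j - Z_i` is `q⁻¹ * Z_j - q * Z_i`. -/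
theorem isUnit_sub_diag (hunit : ∀ ε (i j : Fin n), j.val = i.val + 1 → ε i ≠ ε j →
      IsUnit (algebraMap F K q⁻¹ * S.Z ε j - algebraMap F K q * S.Z ε i))
    {ε : Fin n → Bool} {i j : Fin n} (hij : j.val = i.val + 1) (h : ε i ≠ ε j) :
    IsUnit (algebraMap F K q - S.diag ε i j) := by
  refine isUnit_of_mul_isUnit_left (y := (S.Z ε j : K) - S.Z ε i) ?_
  have h₁ := S.diag_mul hij h
  rw [map_sub] at h₁
  convert hunit ε i j hij h using 1
  linear_combination -h₁

theorem isUnit_sub_diagZero (hunit : ∀ ε (i : Fin n), i.val = 0 →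
      IsUnit (algebraMap F K p⁻¹ * S.Z ε i - algebraMap F K p))
    {ε : Fin n → Bool} {i : Fin n} (hi : i.val = 0) :
    IsUnit (algebraMap F K p - S.diagZero p ε i) := by
  refine isUnit_of_mul_isUnit_left (y := (S.Z ε i : K) - 1) ?_
  have h₁ := S.diagZero_mul (p := p) ε hi
  rw [map_sub] at h₁
  convert hunit ε i hi using 1
  linear_combination -h₁

theorem opSwap_single {ε : Fin n → Bool} {i j : Fin n} (h : ε i ≠ ε j) (v : N) :
    S.opSwap i j (Pi.single (exch i j ε) v) =
      Pi.single (exch i j ε) (S.diag (exch i j ε) i j • v) +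
        Pi.single ε ((algebraMap F K q - S.diag ε i j) • v) := by
  have hne : exch i j ε ≠ ε := fun he => exch_ne h (by rw [he]; exact absurd (by
    have := congrFun he i; rw [exch_left] at this; exact this.symm) h)
  funext δ
  rw [Pi.add_apply]
  by_cases h₁ : δ = exch i j ε
  · subst h₁
    rw [S.opSwap_of_ne (exch_ne h), exch_exch, Pi.single_eq_same, Pi.single_eq_same,
      Pi.single_eq_of_ne hne.symm, Pi.single_eq_of_ne hne, smul_zero]
  · by_cases h₂ : δ = ε
    · subst h₂
      rw [S.opSwap_of_ne h, Pi.single_eq_same, Pi.single_eq_same, Pi.single_eq_of_ne h₁,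
        Pi.single_eq_of_ne h₁, smul_zero]
    · rw [Pi.single_eq_of_ne h₁, Pi.single_eq_of_ne h₂, add_zero]
      by_cases h₃ : δ i = δ j
      · rw [S.opSwap_of_eq h₃, Pi.single_eq_of_ne h₁, map_zero]
      · have h₄ : exch i j δ ≠ exch i j ε := fun he => h₂ (by
          rw [← exch_exch i j δ, he, exch_exch])
        rw [S.opSwap_of_ne h₃, Pi.single_eq_of_ne h₁, Pi.single_eq_of_ne h₄, smul_zero, smul_zero,
          add_zero]

theorem opFlip_single {ε : Fin n → Bool} {i : Fin n} (v : N) :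
    S.opFlip p i (Pi.single (flip i ε) v) =
      Pi.single (flip i ε) (S.diagZero p (flip i ε) i • v) +
        Pi.single ε ((algebraMap F K p - S.diagZero p ε i) • v) := by
  have hne : flip i ε ≠ ε := fun he => by
    have := congrFun he i; rw [flip_self] at this; simp at this
  funext δ
  rw [Pi.add_apply, S.opFlip_apply]
  by_cases h₁ : δ = flip i ε
  · subst h₁
    rw [flip_flip, Pi.single_eq_same, Pi.single_eq_same,
      Pi.single_eq_of_ne hne.symm, Pi.single_eq_of_ne hne, smul_zero]
  · by_cases h₂ : δ = ε
    · subst h₂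
      rw [Pi.single_eq_same, Pi.single_eq_same, Pi.single_eq_of_ne h₁,
        Pi.single_eq_of_ne h₁, smul_zero]
    · have h₄ : flip i δ ≠ flip i ε := fun he => h₂ (by
        rw [← flip_flip i δ, he, flip_flip])
      rw [Pi.single_eq_of_ne h₁, Pi.single_eq_of_ne h₂, add_zero,
        Pi.single_eq_of_ne h₁, Pi.single_eq_of_ne h₄, smul_zero, smul_zero, add_zero]

/-- The component of the trivial sign pattern generates everything. -/
theorem eq_top_of_stable
    (hu : ∀ ε (i j : Fin n), j.val = i.val + 1 → ε i ≠ ε j →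
      IsUnit (algebraMap F K q⁻¹ * S.Z ε j - algebraMap F K q * S.Z ε i))
    (hu₀ : ∀ ε (i : Fin n), i.val = 0 →
      IsUnit (algebraMap F K p⁻¹ * S.Z ε i - algebraMap F K p))
    {P : Submodule F ((Fin n → Bool) → N)} (hP : ∀ v, Pi.single (fun _ => false) v ∈ P)
    (hT : ∀ j, ∀ f ∈ P, S.opT p j f ∈ P) : P = ⊤ := by
  have key : ∀ ε v, (Pi.single ε v : (Fin n → Bool) → N) ∈ P := by
    intro ε
    induction ε using sign_induction with
    | hzero => exact hP
    | hflip ε i hi _ ih =>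
      intro v
      have hunit := S.isUnit_sub_diagZero hu₀ (ε := ε) hi
      -- Scaling by the inverse of the off-diagonal coefficient makes the `ε`-component of the image
      -- equal to `v`; the other component lies in `P` by induction.
      have h := hT i _ (ih (Ring.inverse (algebraMap F K p - S.diagZero p ε i) • v))
      rw [S.opT_zero hi, S.opFlip_single, ← smul_assoc (_ - _), smul_eq_mul,
        Ring.mul_inverse_cancel _ hunit, one_smul] at h
      exact (P.add_mem_iff_right (ih _)).1 h
    | hexch ε i j hij hi hj ih =>
      intro v
      have hne : ε i ≠ ε j := by rw [hi, hj]; simp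
      have hunit := S.isUnit_sub_diag hu hij hne
      have h := hT j _ (ih (Ring.inverse (algebraMap F K q - S.diag ε i j) • v))
      rw [S.opT_succ hij, S.opSwap_single hne, ← smul_assoc (_ - _), smul_eq_mul,
        Ring.mul_inverse_cancel _ hunit, one_smul] at h
      exact (P.add_mem_iff_right (ih _)).1 h
  rw [eq_top_iff]
  rintro f -
  rw [← Finset.univ_sum_single f]
  exact P.sum_mem fun ε _ => key ε _

end SignSystem

/-! ### Arithmetic of the sets `I_λ` -/

section Parameters

variable {F : Type u} [Field F]

/-- The conditions on the parameters under which induction from type `A` is exact on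
irreducibles. -/
structure Generic (p q lam : F) : Prop where
  p_ne : p ≠ 0
  q_ne : q ≠ 0
  lam_ne : lam ≠ 0
  p_notMem : p ^ 2 ∉ I q lam
  q_notMem : q ∉ I q lam
  neg_q_notMem : -q ∉ I q lam
  one_notMem : (1 : F) ∉ I q lam
  neg_one_notMem : (-1 : F) ∉ I q lam

namespace Generic

variable {p q lam : F} (h : Generic p q lam)
include h

theorem mem_I_iff {a : F} : a ∈ I q lam ↔ a ∈ Iplus q lam⁻¹ ∨ a⁻¹ ∈ Iplus q lam⁻¹ := by
  constructor
  · rintro ⟨i, rfl | rfl⟩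
    · refine Or.inr ⟨-i, ?_⟩
      rw [mul_inv, ← zpow_neg, mul_neg]
    · exact Or.inl ⟨i, rfl⟩
  · rintro (⟨i, hi⟩ | ⟨i, hi⟩)
    · exact ⟨i, Or.inr hi⟩
    · refine ⟨-i, Or.inl ?_⟩
      rw [← inv_inv a, hi, mul_inv, inv_inv, ← zpow_neg, mul_neg]

theorem ne_zero {a : F} (ha : a ∈ Iplus q lam⁻¹) : a ≠ 0 := by
  obtain ⟨i, rfl⟩ := ha
  exact mul_ne_zero (inv_ne_zero h.lam_ne) (zpow_ne_zero _ h.q_ne)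

theorem inv_mem_I {a : F} (ha : a ∈ I q lam) : a⁻¹ ∈ I q lam := by
  rw [h.mem_I_iff, inv_inv]
  exact (h.mem_I_iff.1 ha).symm

/-- This separates `I⁺` from its inverses. If the product were `1`, then `lam⁻¹ * q ^ (i + j)` would
be a sign; an even exponent puts `1` or `-1` into `I q lam`, an odd one `q` or `-q`. -/
theorem mul_ne_one {a b : F} (ha : a ∈ Iplus q lam⁻¹) (hb : b ∈ Iplus q lam⁻¹) : a * b ≠ 1 := by
  obtain ⟨i, rfl⟩ := ha
  obtain ⟨j, rfl⟩ := hb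
  intro he
  have hq := h.q_ne
  have hl := h.lam_ne
  have hs : (lam⁻¹ * q ^ (i + j)) * (lam⁻¹ * q ^ (i + j)) = 1 := by
    rw [← he, zpow_add₀ hq, two_mul, two_mul, zpow_add₀ hq, zpow_add₀ hq]; ring
  rcases Int.even_or_odd' (i + j) with ⟨t, ht | ht⟩
  · rw [ht] at hs
    rcases mul_self_eq_one_iff.1 hs with h₁ | h₁
    · exact h.one_notMem ⟨t, Or.inr h₁.symm⟩
    · exact h.neg_one_notMem ⟨t, Or.inr h₁.symm⟩
  · have h₂ : q * (lam⁻¹ * q ^ (2 * t)) = lam⁻¹ * q ^ (i + j) := by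
      rw [ht, zpow_add₀ hq, zpow_one]; ring
    have h₃ : lam * q ^ (2 * -t) * (lam⁻¹ * q ^ (2 * t)) = 1 := by
      rw [mul_neg, zpow_neg]
      have := zpow_ne_zero (2 * t) hq
      field_simp
    have h₄ : q * (lam⁻¹ * q ^ (2 * t)) * (lam * q ^ (2 * -t)) = q := by
      linear_combination q * h₃
    rcases mul_self_eq_one_iff.1 hs with h₁ | h₁
    · rw [h₂, h₁, one_mul] at h₄
      exact h.q_notMem ⟨-t, Or.inl h₄.symm⟩
    · rw [h₂, h₁] at h₄
      refine h.neg_q_notMem ⟨-t, Or.inl ?_⟩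
      linear_combination h₄

theorem mul_mem {a : F} (ha : a ∈ Iplus q lam⁻¹) (m : ℤ) : a * q ^ (2 * m) ∈ Iplus q lam⁻¹ := by
  obtain ⟨i, rfl⟩ := ha
  exact ⟨i + m, by rw [mul_add, zpow_add₀ h.q_ne, mul_assoc]⟩

/-- `I⁺` is stable under even powers of `q`, so the power can be absorbed into `b`. -/
theorem mul_ne_zpow {a b : F} (ha : a ∈ Iplus q lam⁻¹) (hb : b ∈ Iplus q lam⁻¹) (m : ℤ) :
    a * b ≠ q ^ (2 * m) := by
  intro he
  refine h.mul_ne_one ha (h.mul_mem hb (-m)) ?_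
  rw [← mul_assoc, he, mul_neg, zpow_neg, mul_inv_cancel₀ (zpow_ne_zero _ h.q_ne)]

theorem mul_ne_sq {a b : F} (ha : a ∈ Iplus q lam⁻¹) (hb : b ∈ Iplus q lam⁻¹) :
    a * b ≠ q ^ 2 := by
  have := h.mul_ne_zpow ha hb 1
  rwa [mul_one, zpow_ofNat] at this

theorem mul_sq_ne_one {a b : F} (ha : a ∈ Iplus q lam⁻¹) (hb : b ∈ Iplus q lam⁻¹) :
    q ^ 2 * (a * b) ≠ 1 := by
  have := h.mul_ne_zpow ha hb (-1)
  rw [mul_neg, mul_one, zpow_neg, zpow_ofNat] at this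
  intro he
  exact this (eq_inv_of_mul_eq_one_right he)

theorem ne_one {a : F} (ha : a ∈ I q lam) : a ≠ 1 := by
  rintro rfl; exact h.one_notMem ha

theorem ne_sq {a : F} (ha : a ∈ I q lam) : a ≠ p ^ 2 := by
  rintro rfl; exact h.p_notMem ha

end Generic

end Parameters

/-! ### Units and characters of finite-dimensional commutative algebras -/

section Characters

variable {F : Type*} [Field F] [IsAlgClosed F] {K : Type*} [CommRing K] [Algebra F K]
  [FiniteDimensional F K]

/-- A nonunit lies in a maximal ideal, whose residue field is finite over the algebraically closed
`F`, hence equal to `F`; the quotient map is a character killing it. -/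
theorem isUnit_of_forall_character {k : K} (h : ∀ χ : K →ₐ[F] F, χ k ≠ 0) : IsUnit k := by
  by_contra hk
  obtain ⟨m, hm, hkm⟩ := exists_max_ideal_of_mem_nonunits hk
  let _ := Ideal.Quotient.field m
  have hbij : Function.Bijective (algebraMap F (K ⧸ m)) :=
    IsAlgClosed.algebraMap_bijective_of_isIntegral
  let e : F ≃ₐ[F] (K ⧸ m) := AlgEquiv.ofBijective (Algebra.ofId F (K ⧸ m)) hbij
  refine h (e.symm.toAlgHom.comp (Ideal.Quotient.mkₐ F m)) ?_
  simp [Ideal.Quotient.eq_zero_iff_mem.2 hkm]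

/-- The value of a character at an element of a commutative algebra of endomorphisms is an
eigenvalue. -/
theorem exists_eigenvector_of_character {N : Type*} [AddCommGroup N] [Module K N]
    [FaithfulSMul K N] [Module F N] [IsScalarTower F K N] (χ : K →ₐ[F] F) (k : K) :
    ∃ v : N, v ≠ 0 ∧ k • v = χ k • v := by
  by_contra hne
  push Not at hne
  -- Without eigenvectors `k - χ k` acts injectively on the faithful module `N`, so it is a
  -- nonzerodivisor of an Artinian ring, hence a unit; yet `χ` kills it.
  have hunit : IsUnit (k - algebraMap F K (χ k)) := by
    have := IsArtinianRing.of_finite F K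
    refine IsArtinianRing.isUnit_of_mem_nonZeroDivisors ?_
    rw [mem_nonZeroDivisors_iff_right]
    intro z hz
    refine FaithfulSMul.eq_of_smul_eq_smul (α := N) fun v => ?_
    by_contra hv
    rw [zero_smul] at hv
    refine hne (z • v) hv ?_
    rw [← sub_eq_zero, ← algebraMap_smul K (χ k), ← sub_smul, smul_smul, mul_comm, hz, zero_smul]
  have := hunit.map χ
  simp at this

end Characters

/-! ### Relations of type `A`, pulled back along the inclusion -/

section TypeARelations

variable {F : Type u} [Field F] {p q : F} {n : ℕ}

theorem TA_sq (hp : p ≠ 0) (hq : q ≠ 0) (i : Fin n) (hi : 1 ≤ i.val) :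
    TA p q i hi * TA p q i hi = (q - q⁻¹) • TA p q i hi + 1 := by
  have hg : gap p q i = q - q⁻¹ := by
    have : i.val ≠ 0 := by omega
    simp [gap, par, this]
  refine incl_injective ?_
  rw [map_mul, map_add, map_smul, map_one, incl_TA, ← hg]
  exact TR_sq hp hq i

theorem TA_XA_left (hp : p ≠ 0) (hq : q ≠ 0) (i j : Fin n) (hij : i.val = j.val + 1)
    (hi : 1 ≤ i.val) :
    TA p q i hi * XA p q j = XA p q i * TA p q i hi - (q - q⁻¹) • XA p q i := by
  have hg : gap p q 1 = q - q⁻¹ := by simp [gap, par]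
  refine incl_injective ?_
  rw [map_sub, map_mul, map_mul, map_smul, incl_TA, incl_XA, incl_XA, ← hg]
  exact TR_XR_left hp hq i j hij

theorem TA_XA_right (hp : p ≠ 0) (hq : q ≠ 0) (i j : Fin n) (hij : i.val = j.val + 1)
    (hi : 1 ≤ i.val) :
    TA p q i hi * XA p q i = XA p q j * TA p q i hi + (q - q⁻¹) • XA p q i := by
  have hg : gap p q 1 = q - q⁻¹ := by simp [gap, par]
  refine incl_injective ?_
  rw [map_add, map_mul, map_mul, map_smul, incl_TA, incl_XA, incl_XA, ← hg]
  exact TR_XR_right hp hq i j hij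

theorem TA_XA_of_ne (i j : Fin n) (h₁ : j ≠ i) (h₂ : i.val ≠ j.val + 1) (hi : 1 ≤ i.val) :
    TA p q i hi * XA p q j = XA p q j * TA p q i hi := by
  refine incl_injective ?_
  rw [map_mul, map_mul, incl_TA, incl_XA]
  exact TR_XR_of_ne i j h₁ h₂

theorem TA_braid (i j : Fin n) (hi : 1 ≤ i.val) (hj : 1 ≤ j.val) (hij : j.val = i.val + 1) :
    TA p q i hi * TA p q j hj * TA p q i hi = TA p q j hj * TA p q i hi * TA p q j hj := by
  refine incl_injective ?_
  simp only [map_mul, incl_TA]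
  exact TR_braid i j hi hij

theorem TA_far (i j : Fin n) (hi : 1 ≤ i.val) (hj : 1 ≤ j.val) (hij : i.val + 1 < j.val) :
    TA p q i hi * TA p q j hj = TA p q j hj * TA p q i hi := by
  refine incl_injective ?_
  simp only [map_mul, incl_TA]
  exact TR_far i j hij

end TypeARelations

/-! ### The lattice algebra of a module and the invertibility of the denominators -/

section LatticeAlgebra

variable {F : Type u} [Field F] (p q : F) (n : ℕ) (N : Type v) [AddCommGroup N] [Module F N]
  [Module (HA p q n) N] [IsScalarTower F (HA p q n) N]

/-- The commutative algebra of operators generated by the lattice. -/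
def latticeAlgebra : Subalgebra F (Module.End F N) :=
  Algebra.adjoin F (Set.range fun i : Fin n => Algebra.lsmul F F N (XA p q i))

instance : CommRing (latticeAlgebra p q n N) :=
  { (inferInstance : Ring (latticeAlgebra p q n N)) with
    mul_comm := (Algebra.isMulCommutative_adjoin F
      (s := Set.range fun i : Fin n => Algebra.lsmul F F N (XA p q i)) (by
        rintro _ ⟨i, rfl⟩ _ ⟨j, rfl⟩
        rw [← map_mul, XA_comm, map_mul])).is_comm.comm }

/-- The image of `X_{i+1}` in the algebra of operators generated by the lattice. -/
def latticeGen (i : Fin n) : latticeAlgebra p q n N :=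
  ⟨Algebra.lsmul F F N (XA p q i), Algebra.subset_adjoin ⟨i, rfl⟩⟩

variable {p q n N}

theorem latticeGen_smul (i : Fin n) (v : N) : latticeGen p q n N i • v = XA p q i • v := rfl

instance : FaithfulSMul (latticeAlgebra p q n N) N :=
  ⟨fun {_ _} h => Subtype.ext (LinearMap.ext h)⟩

instance : IsScalarTower F (latticeAlgebra p q n N) N := ⟨fun _ _ _ => rfl⟩

variable [IsAlgClosed F]

/-- The place where the eigenvalue condition enters: with it, invertibility in the lattice algebra
becomes a statement about elements of `Iplus`. -/
theorem character_latticeGen_mem {lam : F} (hN : InRepA p q n lam N)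
    (χ : latticeAlgebra p q n N →ₐ[F] F) (i : Fin n) :
    χ (latticeGen p q n N i) ∈ Iplus q lam := by
  have := hN.1
  obtain ⟨v, hv, hv'⟩ := exists_eigenvector_of_character (N := N) χ (latticeGen p q n N i)
  exact hN.2 i _ (Module.End.hasEigenvalue_of_hasEigenvector
    ⟨Module.End.mem_eigenspace_iff.2 hv', hv⟩)

theorem isUnit_latticeAlgebra [FiniteDimensional F N] {k : latticeAlgebra p q n N}
    (h : ∀ χ : latticeAlgebra p q n N →ₐ[F] F, χ k ≠ 0) : IsUnit k :=
  isUnit_of_forall_character h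

variable {lam : F} (hG : Generic p q lam) (hN : InRepA p q n lam⁻¹ N)

theorem isUnit_latticeGen (hG : Generic p q lam) (hN : InRepA p q n lam⁻¹ N) (i : Fin n) :
    IsUnit (latticeGen p q n N i) := by
  have := hN.1
  exact isUnit_latticeAlgebra fun χ => hG.ne_zero (character_latticeGen_mem hN χ i)

/-- `X_{i+1}` as a unit of the algebra of operators generated by the lattice. -/
def latticeUnit (hG : Generic p q lam) (hN : InRepA p q n lam⁻¹ N) (k : ℕ) :
    (latticeAlgebra p q n N)ˣ :=
  if h : k < n then (isUnit_latticeGen hG hN ⟨k, h⟩).unit else 1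

theorem latticeUnit_of_lt {k : ℕ} (hk : k < n) :
    (latticeUnit hG hN k : latticeAlgebra p q n N) = latticeGen p q n N ⟨k, hk⟩ := by
  rw [latticeUnit, dif_pos hk, IsUnit.unit_spec]

theorem latticeUnit_val (i : Fin n) :
    (latticeUnit hG hN i : latticeAlgebra p q n N) = latticeGen p q n N i :=
  latticeUnit_of_lt hG hN i.2

variable (p q n N) in
/-- The operator by which `T_{j+1}` acts. -/
def latticeT (j : ℕ) : N →ₗ[F] N :=
  if h : j + 1 < n then Algebra.lsmul F F N (TA p q ⟨j + 1, h⟩ (Nat.le_add_left 1 j)) else 0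

theorem latticeT_apply {j : ℕ} (hj : j + 1 < n) (v : N) :
    latticeT p q n N j v = TA p q ⟨j + 1, hj⟩ (Nat.le_add_left 1 j) • v := by
  rw [latticeT, dif_pos hj, Algebra.lsmul_coe]

/-- The type `A` data attached to a module in `Rep_{λ⁻¹} H_n^A`. -/
def typeASystem : TypeASystem F (latticeAlgebra p q n N) N q n where
  Y := latticeUnit hG hN
  τ := latticeT p q n N
  sq j hj v := by
    rw [latticeT_apply hj, latticeT_apply hj, smul_smul, ← smul_assoc,
      TA_sq hG.p_ne hG.q_ne, add_smul, one_smul]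
  left j hj v := by
    have hj' : j < n := by omega
    rw [latticeUnit_of_lt hG hN hj, latticeUnit_of_lt hG hN hj', latticeT_apply hj,
      latticeT_apply hj, latticeGen_smul, latticeGen_smul, latticeGen_smul,
      ← smul_assoc (q - q⁻¹), smul_smul, smul_smul, ← sub_smul,
      TA_XA_left hG.p_ne hG.q_ne _ ⟨j, hj'⟩ rfl]
  right j hj v := by
    have hj' : j < n := by omega
    rw [latticeUnit_of_lt hG hN hj, latticeUnit_of_lt hG hN hj', latticeT_apply hj,
      latticeT_apply hj, latticeGen_smul, latticeGen_smul,
      ← smul_assoc (q - q⁻¹), smul_smul, smul_smul, ← add_smul,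
      TA_XA_right hG.p_ne hG.q_ne _ ⟨j, hj'⟩ rfl]
  of_ne j hj k h₁ h₂ v := by
    by_cases hk : k < n
    · rw [latticeUnit_of_lt hG hN hk, latticeT_apply hj, latticeT_apply hj, latticeGen_smul,
        latticeGen_smul, smul_smul, smul_smul, TA_XA_of_ne]
      · simpa [Fin.ext_iff] using h₂
      · simp; omega
    -- Beyond the range the default value `1` commutes with everything.
    · rw [latticeUnit, dif_neg hk, Units.val_one, one_smul, one_smul]
  braid j hj v := by
    have hj' : j + 1 < n := by omega
    have h := TA_braid (p := p) (q := q) ⟨j + 1, hj'⟩ ⟨j + 1 + 1, hj⟩ (Nat.le_add_left 1 _)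
      (Nat.le_add_left 1 _) rfl
    simp only [latticeT_apply hj', latticeT_apply hj, smul_smul, ← mul_assoc, h]
  far j l hjl hl v := by
    have hj : j + 1 < n := by omega
    have h := TA_far (p := p) (q := q) ⟨j + 1, hj⟩ ⟨l + 1, hl⟩ (Nat.le_add_left 1 _)
      (Nat.le_add_left 1 _) (by simpa using hjl)
    simp only [latticeT_apply hj, latticeT_apply hl, smul_smul, h]
  isUnit_mul_sub_one a b ha hb _ := by
    have := hN.1
    rw [latticeUnit_of_lt hG hN ha, latticeUnit_of_lt hG hN hb]
    refine isUnit_latticeAlgebra fun χ => ?_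
    rw [map_sub, map_mul, map_one]
    exact sub_ne_zero.2 (hG.mul_ne_one (character_latticeGen_mem hN χ _)
      (character_latticeGen_mem hN χ _))
  isUnit_sub_one a ha := by
    have := hN.1
    rw [latticeUnit_of_lt hG hN ha]
    refine isUnit_latticeAlgebra fun χ => ?_
    rw [map_sub, map_one]
    exact sub_ne_zero.2 (hG.ne_one (hG.mem_I_iff.2 (Or.inl (character_latticeGen_mem hN χ _))))

/-- The type `B` data attached to a module in `Rep_{λ⁻¹} H_n^A`. -/
def inducedSystem : SignSystem F (latticeAlgebra p q n N) N q n := (typeASystem hG hN).signSystem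

theorem character_inducedSystem (χ : latticeAlgebra p q n N →ₐ[F] F) (ε : Fin n → Bool)
    (k : Fin n) : ∃ a ∈ Iplus q lam⁻¹,
      χ ((inducedSystem hG hN).Z ε k) = if ε k = true then a⁻¹ else a := by
  have hval : (latticeUnit hG hN (pos ε k) : latticeAlgebra p q n N) =
      latticeGen p q n N ⟨pos ε k, pos_lt ε k⟩ := latticeUnit_of_lt hG hN _
  refine ⟨_, character_latticeGen_mem hN χ ⟨pos ε k, pos_lt ε k⟩, ?_⟩
  change χ ((typeASystem hG hN).weight ε k) = _
  cases h : ε k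
  · rw [TypeASystem.weight_of_false _ h, if_neg (by simp), ← hval]
    rfl
  · rw [TypeASystem.weight_of_true _ h, if_pos rfl, ← hval]
    refine eq_inv_of_mul_eq_one_left ?_
    change χ (((latticeUnit hG hN (pos ε k))⁻¹ : (latticeAlgebra p q n N)ˣ)) * _ = 1
    rw [← map_mul, Units.inv_mul, map_one]

/-- With opposite signs, a character killing the element would give `a * b = q ^ 2` or `q ^ 2 * (a *
b) = 1` for some `a`, `b` in `I⁺`. -/
theorem isUnit_inducedSystem (ε : Fin n → Bool) (i j : Fin n) (h : ε i ≠ ε j) :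
    IsUnit (algebraMap F (latticeAlgebra p q n N) q⁻¹ * (inducedSystem hG hN).Z ε j -
      algebraMap F (latticeAlgebra p q n N) q * (inducedSystem hG hN).Z ε i) := by
  have := hN.1
  refine isUnit_latticeAlgebra fun χ => ?_
  obtain ⟨a, ha, hχa⟩ := character_inducedSystem hG hN χ ε i
  obtain ⟨b, hb, hχb⟩ := character_inducedSystem hG hN χ ε j
  have ha0 := hG.ne_zero ha
  have hb0 := hG.ne_zero hb
  have hq0 := hG.q_ne
  rw [map_sub, map_mul, map_mul, hχa, hχb, AlgHom.commutes, AlgHom.commutes]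
  simp only [Algebra.algebraMap_self, RingHom.id_apply]
  cases hi : ε i <;> cases hj : ε j
  · exact absurd (hi.trans hj.symm) h
  · simp only [Bool.false_eq_true, if_false, if_true]
    intro he
    refine hG.mul_sq_ne_one ha hb ?_
    field_simp at he
    linear_combination -he
  · simp only [Bool.false_eq_true, if_false, if_true]
    intro he
    refine hG.mul_ne_sq ha hb ?_
    field_simp at he
    linear_combination he
  · exact absurd (hi.trans hj.symm) h

theorem isUnit_inducedSystem_zero (ε : Fin n → Bool) (i : Fin n) :
    IsUnit (algebraMap F (latticeAlgebra p q n N) p⁻¹ * (inducedSystem hG hN).Z ε i -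
      algebraMap F (latticeAlgebra p q n N) p) := by
  have := hN.1
  refine isUnit_latticeAlgebra fun χ => ?_
  obtain ⟨a, ha, hχa⟩ := character_inducedSystem hG hN χ ε i
  have haI : (if ε i = true then a⁻¹ else a) ∈ I q lam := by
    rw [hG.mem_I_iff]
    split_ifs
    · exact Or.inr (by rwa [inv_inv])
    · exact Or.inl ha
  have hp0 := hG.p_ne
  generalize (if ε i = true then a⁻¹ else a) = z at hχa haI
  rw [map_sub, map_mul, hχa, AlgHom.commutes, AlgHom.commutes]
  simp only [Algebra.algebraMap_self, RingHom.id_apply]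
  intro he
  refine hG.ne_sq haI ?_
  field_simp at he
  linear_combination he

/-- A negative sign makes the eigenvalues inverses of elements of `I⁺`, which never lie in `I⁺`.
This is what isolates `N` inside the induced module. -/
theorem isUnit_inducedSystem_sub {ε : Fin n → Bool} {k : Fin n} (hk : ε k = true) {b : F}
    (hb : b ∈ Iplus q lam⁻¹) :
    IsUnit (((inducedSystem hG hN).Z ε k : latticeAlgebra p q n N) - algebraMap F _ b) := by
  have := hN.1
  refine isUnit_latticeAlgebra fun χ => ?_
  obtain ⟨a, ha, hχa⟩ := character_inducedSystem hG hN χ ε k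
  rw [if_pos hk] at hχa
  rw [map_sub, hχa, AlgHom.commutes]
  simp only [Algebra.algebraMap_self, RingHom.id_apply]
  have ha0 := hG.ne_zero ha
  intro he
  refine hG.mul_ne_one ha hb ?_
  rw [← sub_eq_zero.1 he, mul_inv_cancel₀ ha0]

theorem mem_I_of_smul_eq {ε : Fin n → Bool} {k : Fin n} {b : F} {v : N} (hv : v ≠ 0)
    (h : ((inducedSystem hG hN).Z ε k : latticeAlgebra p q n N) • v = b • v) : b ∈ I q lam := by
  have := hN.1
  by_contra hb
  have hu : IsUnit (((inducedSystem hG hN).Z ε k : latticeAlgebra p q n N) -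
      algebraMap F _ b) := by
    refine isUnit_latticeAlgebra fun χ => ?_
    obtain ⟨a, ha, hχa⟩ := character_inducedSystem hG hN χ ε k
    rw [map_sub, hχa, AlgHom.commutes]
    simp only [Algebra.algebraMap_self, RingHom.id_apply]
    intro he
    refine hb ?_
    rw [← sub_eq_zero.1 he, hG.mem_I_iff]
    split_ifs
    · exact Or.inr (by rwa [inv_inv])
    · exact Or.inl ha
  refine hv (hu.smul_eq_zero.1 ?_)
  rw [sub_smul, h, algebraMap_smul, sub_self]

end LatticeAlgebra

/-! ### Identification of the induced module with the model -/

section InducedFromTypeA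

variable {F : Type u} [Field F] [IsAlgClosed F] {p q lam : F} {n : ℕ} {N : Type v}
  [AddCommGroup N] [Module F N] [Module (HA p q n) N] [IsScalarTower F (HA p q n) N]
  (hG : Generic p q lam) (hN : InRepA p q n lam⁻¹ N)

theorem cnt_false (k : Fin n) : cnt (fun _ => false) k = 0 := by simp [cnt]

/-- The representation of `H_n^R` on the functions from sign patterns to `N`. -/
def inducedRep : HR p q n →ₐ[F] Module.End F ((Fin n → Bool) → N) :=
  ((inducedSystem hG hN).rep hG.p_ne hG.q_ne).comp (HR p q n).val

theorem inducedRep_TR (j : Fin n) :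
    inducedRep hG hN (TR p q j) = (inducedSystem hG hN).opT p j :=
  (inducedSystem hG hN).rep_T hG.p_ne hG.q_ne j

theorem inducedRep_XR (j : Fin n) :
    inducedRep hG hN (XR p q j) = (inducedSystem hG hN).opX j :=
  (inducedSystem hG hN).rep_X hG.p_ne hG.q_ne j

theorem inducedRep_XRinv (j : Fin n) :
    inducedRep hG hN (XRinv p q j) = (inducedSystem hG hN).opXinv j :=
  (inducedSystem hG hN).rep_Xinv hG.p_ne hG.q_ne j

theorem inducedSystem_Z_false (k : Fin n) :
    ((inducedSystem hG hN).Z (fun _ => false) k : latticeAlgebra p q n N) =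
      latticeGen p q n N k := by
  change ((typeASystem hG hN).weight (fun _ => false) k : latticeAlgebra p q n N) = _
  rw [TypeASystem.weight_of_false _ rfl, pos, cnt_false, zero_add, if_neg (by simp)]
  exact latticeUnit_val hG hN k

theorem opX_single (k : Fin n) (v : N) :
    (inducedSystem hG hN).opX k (Pi.single (fun _ => false) v) =
      Pi.single (fun _ => false) (XA p q k • v) := by
  funext ε
  rw [SignSystem.opX_apply]
  by_cases h : ε = fun _ => false
  · subst h
    rw [Pi.single_eq_same, Pi.single_eq_same, inducedSystem_Z_false]
    rfl
  · rw [Pi.single_eq_of_ne h, Pi.single_eq_of_ne h, smul_zero]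

theorem opXinv_single (k : Fin n) (v : N) :
    (inducedSystem hG hN).opXinv k (Pi.single (fun _ => false) v) =
      Pi.single (fun _ => false) (XAinv p q k • v) := by
  have h : v = XA p q k • XAinv p q k • v := by rw [smul_smul, XA_mul_XAinv, one_smul]
  conv_lhs => rw [h, ← opX_single hG hN]
  funext ε
  rw [SignSystem.opXinv_apply, SignSystem.opX_apply, smul_smul, Units.inv_mul, one_smul]

theorem opT_single (j : Fin n) (hj : 1 ≤ j.val) (v : N) :
    (inducedSystem hG hN).opT p j (Pi.single (fun _ => false) v) =
      Pi.single (fun _ => false) (TA p q j hj • v) := by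
  obtain ⟨i, hij⟩ : ∃ i : Fin n, j.val = i.val + 1 := ⟨⟨j.val - 1, by omega⟩, by simp; omega⟩
  rw [SignSystem.opT_succ _ hij]
  funext ε
  by_cases h : ε = fun _ => false
  · subst h
    rw [SignSystem.opSwap_of_eq _ (i := i) (ε := fun _ => false) rfl, Pi.single_eq_same, Pi.single_eq_same]
    change latticeT p q n N (pairPos (fun _ => false) j) v = _
    -- On the trivial pattern the index is `j - 1`, and `latticeT (j - 1)` is the action of `T_j`.
    have hpp : pairPos (fun _ => false) j = i.val := by
      rw [pairPos, cnt_false, zero_add, if_neg (by simp)]; omega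
    have hin : i.val + 1 < n := by omega
    rw [hpp, latticeT_apply hin]
    congr 2
    exact Fin.ext hij.symm
  · rw [Pi.single_eq_of_ne h]
    by_cases h' : ε i = ε j
    · rw [SignSystem.opSwap_of_eq _ h', Pi.single_eq_of_ne h, map_zero]
    · have h₂ : exch i j ε ≠ fun _ => false := fun he => h' (by
        have h₃ := congrFun he i
        have h₄ := congrFun he j
        rw [exch_left] at h₃
        rw [exch_right] at h₄
        rw [h₃, h₄])
      rw [SignSystem.opSwap_of_ne _ h', Pi.single_eq_of_ne h, Pi.single_eq_of_ne h₂, smul_zero,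
        smul_zero, add_zero]

theorem inducedRep_incl_single (b : HA p q n) (v : N) :
    inducedRep hG hN (incl p q n b) (Pi.single (fun _ => false) v) =
      Pi.single (fun _ => false) (b • v) := by
  induction b using HA_induction generalizing v with
  | hone => rw [map_one, map_one, one_smul, Module.End.one_apply]
  | hadd a b ha hb => rw [map_add, map_add, LinearMap.add_apply, ha, hb, add_smul, Pi.single_add]
  | hsmul r a ha =>
    rw [map_smul, map_smul, LinearMap.smul_apply, ha, smul_assoc]
    exact (Pi.single_smul' (fun _ : Fin n => false) r (a • v)).symm
  | hT i hi a ha =>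
    rw [map_mul, map_mul, Module.End.mul_apply, ha, incl_TA, inducedRep_TR, opT_single _ _ _ hi,
      mul_smul]
  | hX i a ha =>
    rw [map_mul, map_mul, Module.End.mul_apply, ha, incl_XA, inducedRep_XR, opX_single, mul_smul]
  | hXinv i a ha =>
    rw [map_mul, map_mul, Module.End.mul_apply, ha, incl_XAinv, inducedRep_XRinv, opXinv_single,
      mul_smul]

/-- The induced module is spanned by `2 ^ n` images of `N`. -/
theorem finrank_ind_le (hp : p ≠ 0) (hq : q ≠ 0) [FiniteDimensional F N] :
    FiniteDimensional F (Ind (incl p q n) N) ∧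
      Module.finrank F (Ind (incl p q n) N) ≤ 2 ^ n * Module.finrank F N := by
  have hstable : ∀ b : HA p q n, ∀ y ∈ LinearMap.range (indι (incl p q n) N),
      incl p q n b • y ∈ LinearMap.range (indι (incl p q n) N) := by
    rintro b _ ⟨x, rfl⟩
    exact ⟨b • x, indι_smul _ b x⟩
  obtain ⟨P, hLP, hP, hfin, hle⟩ := exists_smul_stable_span hp hq
    (LinearMap.range (indι (incl p q n) N)) (fun i hi => hstable (TA p q i hi))
    (fun i => hstable (XA p q i)) (fun i => hstable (XAinv p q i))
  have htop : P = ⊤ := by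
    let P' : Submodule (HR p q n) (Ind (incl p q n) N) :=
      { P with smul_mem' := fun a v hv => hP a v hv }
    have : P' = ⊤ := ind_induction _ fun x => hLP ⟨x, rfl⟩
    rw [eq_top_iff]
    rintro y -
    exact (this ▸ Submodule.mem_top : y ∈ P')
  subst htop
  refine ⟨Module.finite_def.2 ((Module.Finite.iff_fg).1 hfin), ?_⟩
  rw [finrank_top] at hle
  exact hle.trans (Nat.mul_le_mul_left _ (LinearMap.finrank_range_le _))

/-- The induced module is the space of functions from sign patterns to `N`. -/
theorem exists_ind_equiv : ∃ Φ : Ind (incl p q n) N ≃ₗ[F] ((Fin n → Bool) → N),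
    (∀ a x, Φ (a • x) = inducedRep hG hN a (Φ x)) ∧
      ∀ v, Φ (indι (incl p q n) N v) = Pi.single (fun _ => false) v := by
  have := hN.1
  let _ : Module (HR p q n) ((Fin n → Bool) → N) :=
    Module.compHom _ (inducedRep hG hN).toRingHom
  have hsmul : ∀ (a : HR p q n) (f : (Fin n → Bool) → N), a • f = inducedRep hG hN a f :=
    fun _ _ => rfl
  have : IsScalarTower F (HR p q n) ((Fin n → Bool) → N) :=
    ⟨fun r a f => by rw [hsmul, hsmul, map_smul, LinearMap.smul_apply]⟩
  obtain ⟨φ, hφ⟩ := exists_ind_lift (incl p q n)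
    (LinearMap.single F (fun _ : Fin n → Bool => N) (fun _ => false))
    (fun b x => (inducedRep_incl_single hG hN b x).symm)
  have hfin := finrank_ind_le (N := N) (n := n) hG.p_ne hG.q_ne
  have := hfin.1
  have hsurj : Function.Surjective (φ.restrictScalars F) := by
    rw [← LinearMap.range_eq_top]
    refine (inducedSystem hG hN).eq_top_of_stable (p := p)
      (fun ε i j _ h => isUnit_inducedSystem hG hN ε i j h)
      (fun ε i _ => isUnit_inducedSystem_zero hG hN ε i) ?_ ?_
    · intro v
      exact ⟨indι (incl p q n) N v, hφ v⟩
    · rintro j _ ⟨y, rfl⟩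
      refine ⟨TR p q j • y, ?_⟩
      rw [← inducedRep_TR, ← hsmul]
      exact map_smul φ _ _
  -- The bound `2 ^ n * dim N` is the dimension of the model, onto which the induced module maps; so
  -- the surjection is an isomorphism.
  have hrank : Module.finrank F (Ind (incl p q n) N) =
      Module.finrank F ((Fin n → Bool) → N) := by
    refine le_antisymm ?_ (LinearMap.finrank_le_finrank_of_surjective hsurj)
    rw [Module.finrank_pi_fintype]
    simpa using hfin.2
  refine ⟨LinearEquiv.ofBijective (φ.restrictScalars F)
    ⟨(LinearMap.injective_iff_surjective_of_finrank_eq_finrank hrank).2 hsurj, hsurj⟩, ?_, ?_⟩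
  · intro a x; exact map_smul φ a x
  · intro v; exact hφ v

include hG hN in
theorem indι_injective : Function.Injective (indι (incl p q n) N) := by
  obtain ⟨Φ, -, hι⟩ := exists_ind_equiv hG hN
  intro x y h
  have := congrArg Φ h
  rw [hι, hι] at this
  exact Pi.single_injective _ this

include hG hN in
theorem ind_inRepR : InRepR p q n lam (Ind (incl p q n) N) := by
  have := hN.1
  refine ⟨(finrank_ind_le hG.p_ne hG.q_ne).1, fun k a ha => ?_⟩
  obtain ⟨Φ, hΦ, -⟩ := exists_ind_equiv hG hN
  obtain ⟨x, hx⟩ := ha.exists_hasEigenvector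
  have hxa : XR p q k • x = a • x := Module.End.mem_eigenspace_iff.1 hx.1
  -- The lattice acts diagonally on the model, so some nonzero component is an eigenvector of `Z ε
  -- k` with the same eigenvalue.
  obtain ⟨ε, hε⟩ := Function.ne_iff.1 (Φ.map_ne_zero_iff.2 hx.2)
  have h := congrFun (hΦ (XR p q k) x) ε
  rw [hxa, map_smul, inducedRep_XR, SignSystem.opX_apply] at h
  exact mem_I_of_smul_eq hG hN hε h.symm

include hG hN in
/-- Joint eigenvectors in the induced module with eigenvalues in `I_{λ⁻¹}^+` come from `N`. -/
theorem mem_range_indι {x : Ind (incl p q n) N} {a : Fin n → F}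
    (ha : ∀ k, a k ∈ Iplus q lam⁻¹) (hx : ∀ k, XR p q k • x = a k • x) :
    x ∈ LinearMap.range (indι (incl p q n) N) := by
  obtain ⟨Φ, hΦ, hι⟩ := exists_ind_equiv hG hN
  refine ⟨Φ x fun _ => false, Φ.injective ?_⟩
  rw [hι]
  funext ε
  by_cases h : ε = fun _ => false
  · subst h; rw [Pi.single_eq_same]
  · rw [Pi.single_eq_of_ne h]
    obtain ⟨k, hk⟩ := Function.ne_iff.1 h
    have h₁ := congrFun (hΦ (XR p q k) x) ε
    rw [hx, map_smul, inducedRep_XR, SignSystem.opX_apply] at h₁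
    symm
    -- At a pattern with a negative sign at `k`, the unit `Z ε k - a k` kills the component of `x`,
    -- which therefore vanishes.
    refine (isUnit_inducedSystem_sub hG hN (by simpa using hk) (ha k)).smul_eq_zero.1 ?_
    rw [sub_smul, ← h₁, algebraMap_smul, Pi.smul_apply, sub_self]

end InducedFromTypeA

/-! ### Joint eigenvectors of commuting operators -/

section JointEigenvectors

variable {F : Type*} [Field F] [IsAlgClosed F] {M : Type*} [AddCommGroup M] [Module F M]
  [FiniteDimensional F M] [Nontrivial M]

theorem exists_joint_eigenvector {ι : Type*} [Fintype ι] (T : ι → Module.End F M)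
    (hT : ∀ i j, T i * T j = T j * T i) :
    ∃ x : M, x ≠ 0 ∧ ∃ a : ι → F, ∀ i, T i x = a i • x := by
  classical
  -- Stability of `W` under all the operators, not only those already treated, lets the next one be
  -- restricted to `W`.
  have key : ∀ s : Finset ι, ∃ W : Submodule F M, W ≠ ⊥ ∧ (∀ i, ∀ x ∈ W, T i x ∈ W) ∧
      ∃ a : ι → F, ∀ i ∈ s, ∀ x ∈ W, T i x = a i • x := by
    intro s
    induction s using Finset.induction_on with
    | empty => exact ⟨⊤, top_ne_bot, fun _ _ _ => Submodule.mem_top, 0, by simp⟩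
    | insert i s hi ih =>
      obtain ⟨W, hW, hinv, a, ha⟩ := ih
      have := Submodule.nontrivial_iff_ne_bot.2 hW
      obtain ⟨b, hb⟩ := Module.End.exists_eigenvalue ((T i).restrict (hinv i))
      obtain ⟨y, hy, hy0⟩ := hb.exists_hasEigenvector
      rw [Module.End.mem_eigenspace_iff] at hy
      refine ⟨W ⊓ (T i).eigenspace b, ?_, ?_, Function.update a i b, ?_⟩
      · refine (Submodule.ne_bot_iff _).2 ⟨y, ⟨y.2, ?_⟩, by simpa using hy0⟩
        rw [SetLike.mem_coe, Module.End.mem_eigenspace_iff]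
        exact congrArg Subtype.val hy
      · rintro j x ⟨hx, hx'⟩
        refine ⟨hinv j x hx, ?_⟩
        rw [SetLike.mem_coe, Module.End.mem_eigenspace_iff] at hx' ⊢
        rw [← Module.End.mul_apply, hT i j, Module.End.mul_apply, hx', map_smul]
      · rintro j hj x ⟨hx, hx'⟩
        by_cases hji : j = i
        · subst hji
          rw [Function.update_self]
          exact Module.End.mem_eigenspace_iff.1 hx'
        · rw [Function.update_of_ne hji]
          exact ha j ((Finset.mem_insert.1 hj).resolve_left hji) x hx
  obtain ⟨W, hW, -, a, ha⟩ := key Finset.univ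
  obtain ⟨x, hx, hx0⟩ := (Submodule.ne_bot_iff _).1 hW
  exact ⟨x, hx0, a, fun i => ha i (Finset.mem_univ i) x hx⟩

end JointEigenvectors

/-! ### Intertwiners moving eigenvalues into `I_{λ⁻¹}^+` -/

section Intertwiners

variable {F : Type u} [Field F] {p q lam : F} {n : ℕ} {M : Type*} [AddCommGroup M] [Module F M]
  [Module (HR p q n) M] [IsScalarTower F (HR p q n) M] (hG : Generic p q lam)

/-- A Hecke generator has only the two obvious eigenvalues. -/
theorem eq_or_eq_of_smul_eq {A : Type*} [Ring A] [Algebra F A] [Module A M] [IsScalarTower F A M]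
    {t d : F} (ht : t ≠ 0) {T : A} (hT : T * T = (t - t⁻¹) • T + 1) {x : M} (hx : x ≠ 0)
    (h : T • x = d • x) : d = t ∨ d = -t⁻¹ := by
  have h₁ : (d * d) • x = ((t - t⁻¹) * d + 1) • x := by
    have := congrArg (· • x) hT
    simp only [mul_smul, add_smul, one_smul, smul_assoc, h] at this
    rw [smul_algebra_smul_comm, h] at this
    rw [mul_smul, add_smul, one_smul, mul_smul, this]
  have h₂ : d * d = (t - t⁻¹) * d + 1 := smul_left_injective F hx h₁
  have h₃ : (d - t) * (d + t⁻¹) = 0 := by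
    have : t * t⁻¹ = 1 := mul_inv_cancel₀ ht
    linear_combination h₂ - this
  rcases mul_eq_zero.1 h₃ with h₄ | h₄
  · exact Or.inl (sub_eq_zero.1 h₄)
  · exact Or.inr (eq_neg_of_add_eq_zero_left h₄)

include hG

/-- The vector is `T_0 • x - d • x`, where `d` is fixed by requiring `X_1` to act on it by the
inverse eigenvalue. If it vanished, `d` would be `p` or `-p⁻¹`, forcing `b = p ^ 2` or `b⁻¹ = p ^
2`; both are excluded since `I q lam` is stable under inversion. -/
theorem exists_flip_eigenvector {i : Fin n} (hi : i.val = 0) {x : M} (hx : x ≠ 0) {a : Fin n → F}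
    (ha : ∀ k, XR p q k • x = a k • x) (hai : (a i)⁻¹ ∈ Iplus q lam⁻¹) :
    ∃ y : M, y ≠ 0 ∧ ∀ k, XR p q k • y = Function.update a i (a i)⁻¹ k • y := by
  set b := a i with hb
  have hbI : b ∈ I q lam := hG.mem_I_iff.2 (Or.inr hai)
  have hb0 : b ≠ 0 := by simpa using hG.ne_zero hai
  have hb1 : b - 1 ≠ 0 := sub_ne_zero.2 (hG.ne_one hbI)
  have hp0 := hG.p_ne
  have hg : gap p q 0 = p - p⁻¹ := by simp [gap, par]
  set d : F := (p - p⁻¹) * b / (b - 1) with hd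
  have hdb : d * (b - 1) = (p - p⁻¹) * b := by rw [hd, div_mul_cancel₀ _ hb1]
  have hinv : XRinv p q i • x = b⁻¹ • x := by
    have h₁ := congrArg (XRinv p q i • ·) (ha i)
    simp only [smul_smul, XRinv_mul_XR, one_smul] at h₁
    rw [← hb, smul_algebra_smul_comm] at h₁
    conv_rhs => rw [h₁, smul_smul b⁻¹ b, inv_mul_cancel₀ hb0, one_smul]
  refine ⟨TR p q i • x - d • x, ?_, fun k => ?_⟩
  · intro h0
    have hsq := TR_sq hG.p_ne hG.q_ne i
    rw [hi, hg] at hsq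
    rcases eq_or_eq_of_smul_eq hp0 hsq hx (sub_eq_zero.1 h0) with h | h
    · refine hG.ne_sq hbI ?_
      rw [h] at hdb
      field_simp at hdb
      linear_combination hdb
    · refine hG.ne_sq (hG.inv_mem_I hbI) ?_
      rw [h] at hdb
      field_simp at hdb
      rw [inv_eq_iff_eq_inv]
      exact eq_inv_of_mul_eq_one_left (by linear_combination -hdb)
  · by_cases hk : k = i
    · subst hk
      have hmul : XR p q k * TR p q k = TR p q k * XRinv p q k + gap p q 0 • (XR p q k + 1) :=
        sub_eq_iff_eq_add.1 (TR_zero_XRinv hG.p_ne hG.q_ne k hi).symm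
      rw [Function.update_self, smul_sub, smul_algebra_smul_comm, smul_smul (XR p q k), hmul,
        add_smul, mul_smul, hinv, smul_algebra_smul_comm, smul_assoc, add_smul, one_smul, ha, hg,
        ← hb]
      have hd₂ : (p - p⁻¹) * (b + 1) - d * b = -(b⁻¹ * d) := by
        refine mul_right_cancel₀ hb0 ?_
        have hbb : b⁻¹ * b = 1 := inv_mul_cancel₀ hb0
        linear_combination (-(1 + b)) * hdb + d * hbb
      generalize TR p q k • x = z
      match_scalars <;> first | ring1 | linear_combination hd₂
    · rw [Function.update_of_ne hk, smul_sub, smul_smul, ← TR_XR_of_ne i k hk (by omega), mul_smul,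
        ha, smul_algebra_smul_comm, smul_algebra_smul_comm, ha, smul_sub, smul_comm d (a k)]

/-- The same construction with `T_j`. It degenerates only for `β = α`, `β = q ^ 2 * α` or `α = q ^ 2
* β`, impossible because `α` and `β⁻¹` both lie in `I⁺`. -/
theorem exists_exch_eigenvector {i j : Fin n} (hij : j.val = i.val + 1) {x : M} (hx : x ≠ 0)
    {a : Fin n → F} (ha : ∀ k, XR p q k • x = a k • x) (hai : a i ∈ Iplus q lam⁻¹)
    (haj : (a j)⁻¹ ∈ Iplus q lam⁻¹) :
    ∃ y : M, y ≠ 0 ∧ ∀ k, XR p q k • y = a (Equiv.swap i j k) • y := by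
  set α := a i with hα
  set β := a j with hβ
  have hβ0 : β ≠ 0 := by simpa using hG.ne_zero haj
  have hq0 := hG.q_ne
  have hne : β - α ≠ 0 := by
    intro h
    refine hG.mul_ne_one hai haj ?_
    rw [← sub_eq_zero.1 h, mul_inv_cancel₀ hβ0]
  have hg : gap p q 1 = q - q⁻¹ := by simp [gap, par]
  set d : F := (q - q⁻¹) * β / (β - α) with hd
  have hdb : d * (β - α) = (q - q⁻¹) * β := by rw [hd, div_mul_cancel₀ _ hne]
  refine ⟨TR p q j • x - d • x, ?_, fun k => ?_⟩
  · intro h0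
    have hsq := TR_sq hG.p_ne hG.q_ne j
    have hgj : gap p q j = q - q⁻¹ := by
      have : j.val ≠ 0 := by omega
      simp [gap, par, this]
    rw [hgj] at hsq
    rcases eq_or_eq_of_smul_eq hq0 hsq hx (sub_eq_zero.1 h0) with h | h
    · refine hG.mul_sq_ne_one hai haj ?_
      rw [h] at hdb
      field_simp at hdb ⊢
      linear_combination -hdb
    · refine hG.mul_ne_sq hai haj ?_
      rw [h] at hdb
      field_simp at hdb ⊢
      linear_combination hdb
  · by_cases hki : k = i
    · subst hki
      have hmul : XR p q k * TR p q j = TR p q j * XR p q j - gap p q 1 • XR p q j :=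
        eq_sub_of_add_eq (TR_XR_right hG.p_ne hG.q_ne j k hij).symm
      rw [Equiv.swap_apply_left, smul_sub, smul_algebra_smul_comm, smul_smul (XR p q k), hmul,
        sub_smul, mul_smul, ha, smul_algebra_smul_comm, smul_assoc, ha, ha, hg, ← hα, ← hβ]
      generalize TR p q j • x = z
      match_scalars <;> first | ring1 | linear_combination hdb
    · by_cases hkj : k = j
      · subst hkj
        have hmul : XR p q k * TR p q k = TR p q k * XR p q i + gap p q 1 • XR p q k :=
          sub_eq_iff_eq_add.1 (TR_XR_left hG.p_ne hG.q_ne k i hij).symm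
        rw [Equiv.swap_apply_right, smul_sub, smul_algebra_smul_comm, smul_smul (XR p q k), hmul,
          add_smul, mul_smul, ha, smul_algebra_smul_comm, smul_assoc, ha, hg, ← hα, ← hβ]
        generalize TR p q k • x = z
        match_scalars <;> first | ring1 | linear_combination -hdb
      · rw [Equiv.swap_apply_of_ne_of_ne hki hkj, smul_sub, smul_smul, ← TR_XR_of_ne j k hkj
          (fun h => hki (Fin.ext (by omega))), mul_smul,
          ha, smul_algebra_smul_comm, smul_algebra_smul_comm, ha, smul_sub, smul_comm d (a k)]

/-- Every nonzero module in `Rep_λ H_n` contains a joint eigenvector of the lattice with all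
eigenvalues in `I_{λ⁻¹}^+`. -/
theorem exists_minus_eigenvector [IsAlgClosed F] [Nontrivial M] (hM : InRepR p q n lam M) :
    ∃ x : M, x ≠ 0 ∧ ∃ a : Fin n → F, (∀ k, a k ∈ Iplus q lam⁻¹) ∧
      ∀ k, XR p q k • x = a k • x := by
  classical
  have := hM.1
  have key : ∀ ε : Fin n → Bool, (∃ x : M, x ≠ 0 ∧ ∃ a : Fin n → F,
      (∀ k, (if ε k = true then (a k)⁻¹ else a k) ∈ Iplus q lam⁻¹) ∧
        ∀ k, XR p q k • x = a k • x) →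
      ∃ x : M, x ≠ 0 ∧ ∃ a : Fin n → F, (∀ k, a k ∈ Iplus q lam⁻¹) ∧
        ∀ k, XR p q k • x = a k • x := by
    intro ε
    induction ε using sign_induction with
    | hzero =>
      rintro ⟨x, hx, a, ha, hxa⟩
      exact ⟨x, hx, a, fun k => by simpa using ha k, hxa⟩
    | hflip ε i hi hεi ih =>
      rintro ⟨x, hx, a, ha, hxa⟩
      have hai := ha i
      rw [if_pos hεi] at hai
      obtain ⟨y, hy, hya⟩ := exists_flip_eigenvector hG hi hx hxa hai
      refine ih ⟨y, hy, _, fun k => ?_, hya⟩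
      by_cases hk : k = i
      · subst hk
        rw [flip_self, Function.update_self, hεi]
        simpa using hai
      · rw [flip_of_ne hk, Function.update_of_ne hk]
        exact ha k
    | hexch ε i j hij hεi hεj ih =>
      rintro ⟨x, hx, a, ha, hxa⟩
      have hai := ha i
      have haj := ha j
      rw [if_neg (by simp [hεi])] at hai
      rw [if_pos hεj] at haj
      obtain ⟨y, hy, hya⟩ := exists_exch_eigenvector hG hij hx hxa hai haj
      exact ih ⟨y, hy, _, fun k => ha (Equiv.swap i j k), hya⟩
  obtain ⟨x, hx, a, ha⟩ := exists_joint_eigenvector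
    (fun k : Fin n => Algebra.lsmul F F M (XR p q k))
    (fun i j => by rw [← map_mul, XR_comm, map_mul])
  -- The starting pattern marks as negative the eigenvalues outside `I⁺`; their inverses are in `I⁺`
  -- by the description of `I q lam`.
  refine key (fun k => decide (a k ∉ Iplus q lam⁻¹)) ⟨x, hx, a, fun k => ?_, ha⟩
  have hk := hG.mem_I_iff.1 (hM.2 k (a k) (Module.End.hasEigenvalue_of_hasEigenvector
    ⟨Module.End.mem_eigenspace_iff.2 (ha k), hx⟩))
  by_cases h : a k ∈ Iplus q lam⁻¹
  · simp [h]
  · simpa [h] using hk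

end Intertwiners

/-! ### Central elements of `H_n^A` and eigenvalues on cyclic modules -/

section CentralElement

variable {F : Type u} [Field F] {p q : F} {n : ℕ} {M : Type v} [AddCommGroup M] [Module F M]
  [Module (HA p q n) M] [IsScalarTower F (HA p q n) M]

/-- The value at `b` of the characteristic polynomial `∏ (b - X_j)`, which is central. -/
def charValue (p q : F) (n : ℕ) (M : Type v) [AddCommGroup M] [Module F M]
    [Module (HA p q n) M] [IsScalarTower F (HA p q n) M] (b : F) : latticeAlgebra p q n M :=
  ∏ j : Fin n, (algebraMap F _ b - latticeGen p q n M j)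

theorem sub_latticeGen_smul (b : F) (j : Fin n) (x : M) :
    (algebraMap F (latticeAlgebra p q n M) b - latticeGen p q n M j) • x =
      b • x - XA p q j • x := by
  rw [sub_smul, algebraMap_smul, latticeGen_smul]

/-- `T_j` commutes with each factor except the two it exchanges, and with the product of these two,
since it commutes with the sum and the product of the two lattice elements. -/
theorem TA_smul_charValue (hp : p ≠ 0) (hq : q ≠ 0) (b : F) (j : Fin n) (hj : 1 ≤ j.val) (x : M) :
    TA p q j hj • charValue p q n M b • x = charValue p q n M b • TA p q j hj • x := by
  obtain ⟨i, hij⟩ : ∃ i : Fin n, j.val = i.val + 1 := ⟨⟨j.val - 1, by omega⟩, by simp; omega⟩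
  have hne : i ≠ j := by rintro rfl; omega
  have key : ∀ s : Finset (Fin n), i ∉ s → j ∉ s → ∀ x : M,
      TA p q j hj • (∏ k ∈ s, (algebraMap F _ b - latticeGen p q n M k)) • x =
        (∏ k ∈ s, (algebraMap F _ b - latticeGen p q n M k)) • TA p q j hj • x := by
    intro s
    induction s using Finset.induction_on with
    | empty => intro _ _ x; simp
    | insert k s hk ih =>
      intro hi' hj' x
      rw [Finset.mem_insert, not_or] at hi' hj'
      rw [Finset.prod_insert hk, mul_smul, mul_smul, ← ih hi'.2 hj'.2, sub_latticeGen_smul,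
        sub_latticeGen_smul, smul_sub, smul_algebra_smul_comm, smul_smul (TA p q j hj),
        TA_XA_of_ne j k (Ne.symm hj'.1) (fun h => hi'.1 (Fin.ext (by omega))), mul_smul]
  have hs : (Finset.univ : Finset (Fin n)) = insert i (insert j (Finset.univ \ {i, j})) := by
    ext k
    by_cases hki : k = i
    · simp [hki]
    · by_cases hkj : k = j <;> simp [hki, hkj]
  have hl : ∀ y : M, TA p q j hj • XA p q i • y =
      XA p q j • TA p q j hj • y - (q - q⁻¹) • XA p q j • y := fun y => by
    rw [smul_smul, TA_XA_left hp hq j i hij, sub_smul, mul_smul, smul_assoc]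
  have hr : ∀ y : M, TA p q j hj • XA p q j • y =
      XA p q i • TA p q j hj • y + (q - q⁻¹) • XA p q j • y := fun y => by
    rw [smul_smul, TA_XA_right hp hq j i hij, add_smul, mul_smul, smul_assoc]
  have hc : ∀ y : M, XA p q i • XA p q j • y = XA p q j • XA p q i • y := fun y => by
    rw [smul_smul, XA_comm, mul_smul]
  rw [charValue, hs, Finset.prod_insert (by simp [hne]), Finset.prod_insert (by simp),
    mul_smul, mul_smul, mul_smul, mul_smul, ← key _ (by simp) (by simp)]
  generalize (∏ k ∈ Finset.univ \ {i, j}, (algebraMap F _ b - latticeGen p q n M k)) • x = y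
  have h₁ : TA p q j hj • XA p q i • XA p q j • y = XA p q i • XA p q j • TA p q j hj • y := by
    rw [hc, hr, ← hc, hl, smul_sub, hc, smul_algebra_smul_comm, hc, sub_add_cancel]
  have h₂ : ∀ z : M, TA p q j hj • b • z = b • TA p q j hj • z := fun z =>
    smul_algebra_smul_comm _ _ _
  have h₃ : ∀ z : M, XA p q i • b • z = b • XA p q i • z := fun z =>
    smul_algebra_smul_comm _ _ _
  simp only [sub_latticeGen_smul, smul_sub, h₂, h₃, h₁]
  simp only [hl, hr, smul_add, smul_sub]
  abel

theorem HA_smul_charValue (hp : p ≠ 0) (hq : q ≠ 0) (b : F) (h : HA p q n) (x : M) :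
    h • charValue p q n M b • x = charValue p q n M b • h • x := by
  have hX : ∀ (i : Fin n) (x : M),
      XA p q i • charValue p q n M b • x = charValue p q n M b • XA p q i • x := by
    intro i x
    rw [← latticeGen_smul, ← latticeGen_smul, smul_comm]
  induction h using HA_induction generalizing x with
  | hone => rw [one_smul, one_smul]
  | hadd a c ha hc => rw [add_smul, add_smul, smul_add, ha, hc]
  | hsmul r a ha => rw [smul_assoc, smul_assoc, ha, smul_algebra_smul_comm r]
  | hT i hi a ha => rw [mul_smul, mul_smul, ha, TA_smul_charValue hp hq]
  | hX i a ha => rw [mul_smul, mul_smul, ha, hX]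
  | hXinv i a ha =>
    rw [mul_smul, mul_smul, ha]
    have h₁ := hX i (XAinv p q i • a • x)
    rw [smul_smul (XA p q i) (XAinv p q i), XA_mul_XAinv, one_smul] at h₁
    rw [← h₁, smul_smul (XAinv p q i) (XA p q i), XAinv_mul_XA, one_smul]

/-- The eigenvalues of the lattice on a cyclic module generated by a joint eigenvector `x` are
among its eigenvalues on `x`. -/
theorem exists_eq_of_mem_span (hp : p ≠ 0) (hq : q ≠ 0) {x : M} {a : Fin n → F}
    (ha : ∀ k, XA p q k • x = a k • x) {w : M} (hw : w ∈ Submodule.span (HA p q n) {x})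
    (hw0 : w ≠ 0) {k : Fin n} {b : F} (hb : XA p q k • w = b • w) : ∃ j, b = a j := by
  obtain ⟨h, rfl⟩ := Submodule.mem_span_singleton.1 hw
  have h₁ : charValue p q n M b • x = (∏ j, (b - a j)) • x := by
    have : ∀ s : Finset (Fin n),
        (∏ j ∈ s, (algebraMap F _ b - latticeGen p q n M j)) • x = (∏ j ∈ s, (b - a j)) • x := by
      intro s
      induction s using Finset.induction_on with
      | empty => simp
      | insert j s hj ih =>
        rw [Finset.prod_insert hj, Finset.prod_insert hj, mul_comm, mul_smul, sub_latticeGen_smul,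
          ha, ← sub_smul, smul_algebra_smul_comm, ih, mul_smul]
    exact this _
  have h₂ : charValue p q n M b • h • x = (∏ j, (b - a j)) • h • x := by
    rw [← HA_smul_charValue hp hq, h₁, smul_algebra_smul_comm]
  -- The same element acts on `w = h • x` by the scalar `∏ (b - a j)` and, `b` being an eigenvalue
  -- of `w`, by zero.
  have h₃ : charValue p q n M b • h • x = 0 := by
    rw [charValue, ← Finset.prod_erase_mul _ _ (Finset.mem_univ k), mul_smul, sub_latticeGen_smul,
      hb, sub_self, smul_zero]
  rw [h₃] at h₂
  obtain ⟨j, -, hj⟩ := Finset.prod_eq_zero_iff.1 ((smul_eq_zero.1 h₂.symm).resolve_right hw0)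
  exact ⟨j, sub_eq_zero.1 hj⟩

end CentralElement

/-! ### Irreducibility and the bijection -/

section Irreducibles

variable {F : Type u} [Field F] [IsAlgClosed F] {p q lam : F} {n : ℕ} (hG : Generic p q lam)
include hG

/-- A nonzero submodule contains a joint eigenvector with eigenvalues in `I⁺`, which lies in the
copy of `N`; by simplicity the submodule contains that copy, which generates. -/
theorem isSimpleModule_ind {N : Type v} [AddCommGroup N] [Module F N] [Module (HA p q n) N]
    [IsScalarTower F (HA p q n) N] (hN : InRepA p q n lam⁻¹ N)
    [hs : IsSimpleModule (HA p q n) N] :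
    IsSimpleModule (HR p q n) (Ind (incl p q n) N) := by
  have hinj := indι_injective hG hN
  have hR := ind_inRepR hG hN
  have := hR.1
  have : Nontrivial N := IsSimpleModule.nontrivial (HA p q n) N
  have : Nontrivial (Ind (incl p q n) N) := hinj.nontrivial
  rw [isSimpleModule_iff]
  refine { eq_bot_or_eq_top := fun P => or_iff_not_imp_left.2 fun hP => ?_ }
  have : Nontrivial P := Submodule.nontrivial_iff_ne_bot.2 hP
  have hPR : InRepR p q n lam P := by
    refine ⟨Module.Finite.of_injective (P.subtype.restrictScalars F) P.injective_subtype, ?_⟩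
    intro k a hk
    obtain ⟨x, hx, hx0⟩ := hk.exists_hasEigenvector
    refine hR.2 k a (Module.End.hasEigenvalue_of_hasEigenvector (x := (x : Ind (incl p q n) N))
      ⟨Module.End.mem_eigenspace_iff.2 ?_, by simpa using hx0⟩)
    exact congrArg Subtype.val (Module.End.mem_eigenspace_iff.1 hx)
  obtain ⟨x, hx0, a, ha, hxa⟩ := exists_minus_eigenvector hG hPR
  obtain ⟨v, hv⟩ := mem_range_indι hG hN ha (x := x) fun k => congrArg Subtype.val (hxa k)
  let Q : Submodule (HA p q n) N :=
    { carrier := {v | indι (incl p q n) N v ∈ P}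
      zero_mem' := by simp
      add_mem' := fun {v w} hv hw => by
        rw [Set.mem_ofPred_eq, map_add]; exact P.add_mem hv hw
      smul_mem' := fun b v hv => by
        rw [Set.mem_ofPred_eq, indι_smul]; exact P.smul_mem _ hv }
  have hQ : Q = ⊤ := by
    refine (eq_bot_or_eq_top Q).resolve_left fun hbot => ?_
    have hvQ : v ∈ Q := by
      change indι (incl p q n) N v ∈ P
      rw [hv]; exact x.2
    rw [hbot, Submodule.mem_bot] at hvQ
    rw [hvQ, map_zero] at hv
    exact hx0 (Subtype.ext hv.symm)
  exact ind_induction _ fun v => (hQ ▸ Submodule.mem_top : v ∈ Q)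

/-- The vectors of `N` sent by `e` into the copy of `N'` form a submodule. It is nonzero, as it
contains a joint eigenvector, so `e` restricts to a nonzero map `N → N'`, bijective by Schur's
lemma. -/
theorem nonempty_equiv_of_ind_equiv {N N' : Type v} [AddCommGroup N] [Module F N]
    [Module (HA p q n) N] [IsScalarTower F (HA p q n) N] [AddCommGroup N'] [Module F N']
    [Module (HA p q n) N'] [IsScalarTower F (HA p q n) N'] (hN : InRepA p q n lam⁻¹ N)
    (hN' : InRepA p q n lam⁻¹ N') [IsSimpleModule (HA p q n) N] [IsSimpleModule (HA p q n) N']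
    (e : Ind (incl p q n) N ≃ₗ[HR p q n] Ind (incl p q n) N') :
    Nonempty (N ≃ₗ[HA p q n] N') := by
  have hinj := indι_injective hG hN
  have hinj' := indι_injective hG hN'
  have := hN.1
  have : Nontrivial N := IsSimpleModule.nontrivial (HA p q n) N
  obtain ⟨v, hv0, a, ha⟩ := exists_joint_eigenvector
    (fun k : Fin n => Algebra.lsmul F F N (XA p q k))
    (fun i j => by rw [← map_mul, XA_comm, map_mul])
  have haI : ∀ k, a k ∈ Iplus q lam⁻¹ := fun k =>
    hN.2 k (a k) (Module.End.hasEigenvalue_of_hasEigenvector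
      ⟨Module.End.mem_eigenspace_iff.2 (ha k), hv0⟩)
  let Q : Submodule (HA p q n) N :=
    { carrier := {w | e (indι (incl p q n) N w) ∈ LinearMap.range (indι (incl p q n) N')}
      zero_mem' := ⟨0, by rw [map_zero, map_zero, map_zero]⟩
      add_mem' := fun {v w} hv hw => by
        rw [Set.mem_ofPred_eq, map_add, map_add]; exact add_mem hv hw
      smul_mem' := fun b w hw => by
        obtain ⟨w', hw'⟩ := hw
        exact ⟨b • w', by rw [indι_smul, indι_smul, map_smul, hw']⟩ }
  have hvQ : v ∈ Q := by
    refine mem_range_indι hG hN' haI fun k => ?_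
    have hk : XA p q k • v = a k • v := ha k
    rw [← map_smul e, ← incl_XA, ← indι_smul, hk, map_smul, ← algebraMap_smul (HR p q n) (a k),
      map_smul, algebraMap_smul]
  have hQ : Q = ⊤ := (eq_bot_or_eq_top Q).resolve_left fun hbot => by
    rw [hbot, Submodule.mem_bot] at hvQ
    exact hv0 hvQ
  have hex : ∀ w, ∃ w', indι (incl p q n) N' w' = e (indι (incl p q n) N w) := fun w =>
    (hQ ▸ Submodule.mem_top : w ∈ Q)
  choose g hg using hex
  let φ : N →ₗ[HA p q n] N' :=
    { toFun := g
      map_add' := fun x y => hinj' (by rw [map_add, hg, hg, hg, map_add, map_add])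
      map_smul' := fun b x => hinj' (by
        rw [RingHom.id_apply, indι_smul, hg, hg, indι_smul, map_smul]) }
  have hφ : φ ≠ 0 := by
    intro h
    have h₁ := hg v
    rw [show g v = φ v from rfl, h, LinearMap.zero_apply, map_zero] at h₁
    exact hv0 (hinj (by rw [map_zero]; exact e.map_eq_zero_iff.1 h₁.symm))
  exact ⟨LinearEquiv.ofBijective φ (LinearMap.bijective_of_ne_zero hφ)⟩

theorem exists_ind_equiv_of_isSimpleModule {M : Type v} [AddCommGroup M] [Module F M]
    [Module (HR p q n) M] [IsScalarTower F (HR p q n) M] (hM : InRepR p q n lam M)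
    [IsSimpleModule (HR p q n) M] :
    ∃ (N : Type v) (_ : AddCommGroup N) (_ : Module F N) (_ : Module (HA p q n) N)
      (_ : IsScalarTower F (HA p q n) N),
      InRepA p q n lam⁻¹ N ∧ IsSimpleModule (HA p q n) N ∧
        Nonempty (Ind (incl p q n) N ≃ₗ[HR p q n] M) := by
  have := hM.1
  have : Nontrivial M := IsSimpleModule.nontrivial (HR p q n) M
  obtain ⟨x, hx0, a, ha, hxa⟩ := exists_minus_eigenvector hG hM
  let _ : Module (HA p q n) M := Module.compHom M (incl p q n).toRingHom
  have hsmul : ∀ (b : HA p q n) (y : M), b • y = incl p q n b • y := fun _ _ => rfl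
  have : IsScalarTower F (HA p q n) M :=
    ⟨fun r b y => by rw [hsmul, hsmul, map_smul, smul_assoc]⟩
  have : IsArtinian (HA p q n) M := isArtinian_of_tower F inferInstance
  -- The simple submodule is taken inside the cyclic module of `x`, where all lattice eigenvalues
  -- are among the `a j`; an arbitrary simple `H_n^A`-submodule of `M` could have eigenvalues
  -- outside `I⁺`.
  obtain hbot | ⟨N, hN, hNle⟩ := eq_bot_or_exists_atom_le (Submodule.span (HA p q n) {x})
  · exact absurd (Submodule.span_singleton_eq_bot.1 hbot) hx0
  have hsimple : IsSimpleModule (HA p q n) N := isSimpleModule_iff_isAtom.2 hN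
  have hNA : InRepA p q n lam⁻¹ N := by
    refine ⟨Module.Finite.of_injective (N.subtype.restrictScalars F) N.injective_subtype, ?_⟩
    intro k b hb
    obtain ⟨w, hw, hw0⟩ := hb.exists_hasEigenvector
    obtain ⟨j, rfl⟩ := exists_eq_of_mem_span hG.p_ne hG.q_ne hxa (hNle w.2) (by simpa using hw0)
      (congrArg Subtype.val (Module.End.mem_eigenspace_iff.1 hw))
    exact ha j
  refine ⟨N, inferInstance, inferInstance, inferInstance, inferInstance, hNA, hsimple, ?_⟩
  have := isSimpleModule_ind hG hNA
  obtain ⟨φ, hφ⟩ := exists_ind_lift (incl p q n) (N.subtype.restrictScalars F)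
    (fun b x => rfl)
  have hφ0 : φ ≠ 0 := by
    rintro rfl
    obtain ⟨y, hy, hy0⟩ := (Submodule.ne_bot_iff _).1 hN.1
    exact hy0 (hφ ⟨y, hy⟩).symm
  exact ⟨LinearEquiv.ofBijective φ (LinearMap.bijective_of_ne_zero hφ0)⟩

end Irreducibles

end AffineHecke

end

theorem mainTheorem11 {F : Type u} [Field F] [IsAlgClosed F] (hchar : ringChar F ≠ 2)
    (p q : F) (hp0 : p ≠ 0) (hq0 : q ≠ 0)
    (hp : ∀ k : ℕ, 0 < k → p ^ k ≠ 1) (hq : ∀ k : ℕ, 0 < k → q ^ k ≠ 1)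
    (n : ℕ) (lam : F) (hlam : lam ≠ 0)
    (hIp : p ^ 2 ∉ AffineHecke.I q lam)
    (hIq : q ∉ AffineHecke.I q lam) (hIq' : -q ∉ AffineHecke.I q lam)
    (hI1 : (1 : F) ∉ AffineHecke.I q lam) (hI1' : (-1 : F) ∉ AffineHecke.I q lam) :
    -- induction sends irreducibles of `Rep_{λ⁻¹} H_n^A` to irreducibles of `Rep_λ H_n`
    (∀ (N : Type v) [AddCommGroup N] [Module F N] [Module (AffineHecke.HA p q n) N]
        [IsScalarTower F (AffineHecke.HA p q n) N],
        AffineHecke.InRepA p q n lam⁻¹ N → IsSimpleModule (AffineHecke.HA p q n) N →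
        AffineHecke.InRepR p q n lam (AffineHecke.Ind (AffineHecke.incl p q n) N) ∧
          IsSimpleModule (AffineHecke.HR p q n)
            (AffineHecke.Ind (AffineHecke.incl p q n) N)) ∧
    -- it is well defined and injective on isomorphism classes of irreducibles
    (∀ (N : Type v) [AddCommGroup N] [Module F N] [Module (AffineHecke.HA p q n) N]
        [IsScalarTower F (AffineHecke.HA p q n) N]
        (N' : Type v) [AddCommGroup N'] [Module F N'] [Module (AffineHecke.HA p q n) N']
        [IsScalarTower F (AffineHecke.HA p q n) N'],
        AffineHecke.InRepA p q n lam⁻¹ N → IsSimpleModule (AffineHecke.HA p q n) N →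
        AffineHecke.InRepA p q n lam⁻¹ N' → IsSimpleModule (AffineHecke.HA p q n) N' →
        (Nonempty (AffineHecke.Ind (AffineHecke.incl p q n) N ≃ₗ[AffineHecke.HR p q n]
            AffineHecke.Ind (AffineHecke.incl p q n) N') ↔
          Nonempty (N ≃ₗ[AffineHecke.HA p q n] N'))) ∧
    -- it is surjective on isomorphism classes of irreducibles
    (∀ (M : Type v) [AddCommGroup M] [Module F M] [Module (AffineHecke.HR p q n) M]
        [IsScalarTower F (AffineHecke.HR p q n) M],
        AffineHecke.InRepR p q n lam M → IsSimpleModule (AffineHecke.HR p q n) M →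
        ∃ (N : Type v) (_ : AddCommGroup N) (_ : Module F N)
          (_ : Module (AffineHecke.HA p q n) N) (_ : IsScalarTower F (AffineHecke.HA p q n) N),
          AffineHecke.InRepA p q n lam⁻¹ N ∧ IsSimpleModule (AffineHecke.HA p q n) N ∧
            Nonempty (AffineHecke.Ind (AffineHecke.incl p q n) N ≃ₗ[AffineHecke.HR p q n] M)) := by
  have hG : AffineHecke.Generic p q lam := ⟨hp0, hq0, hlam, hIp, hIq, hIq', hI1, hI1'⟩
  refine ⟨?_, ?_, ?_⟩
  · intro N _ _ _ _ hN hs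
    exact ⟨AffineHecke.ind_inRepR hG hN, AffineHecke.isSimpleModule_ind hG hN⟩
  · intro N _ _ _ _ N' _ _ _ _ hN hs hN' hs'
    exact ⟨fun ⟨e⟩ => AffineHecke.nonempty_equiv_of_ind_equiv hG hN hN' e,
      fun ⟨e⟩ => AffineHecke.nonempty_ind_congr (AffineHecke.incl p q n) e⟩
  · intro M _ _ _ _ hM hs
    exact AffineHecke.exists_ind_equiv_of_isSimpleModule hG hM
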